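/- Let $T^1=\mathbb R/\mathbb Z$ and let $I\subset(0,+\infty)$ be an interval. The \emph{essential Gowdy equations} for $(P,Q):I\times T^1\to\mathbb R^2$ are $$P_{tt}-P_{\theta\theta}+\tfrac1t P_t=e^{2P}(Q_t^2-Q_\theta^2),\qquad Q_{tt}-Q_{\theta\theta}+\tfrac1t Q_t=-2(P_tQ_t-P_\theta Q_\theta).$$ An $H^1$ weak solution is a pair with $P,Q\in L^\infty_{loc}(I,H^1(T^1))$ and $P_t,Q_t\in L^\infty_{loc}(I,L^2(T^1))$ satisfying them in the sense of distributions. The \emph{full Gowdy equations} for $(P,Q,\lambda)$ consist of these equations together with $$\lambda_{tt}-\lambda_{\theta\theta}=-P_t^2+P_\theta^2+e^{2P}(-Q_t^2+Q_\theta^2)$$ and the constraints $$\tfrac1t\lambda_t=P_t^2+P_\theta^2+e^{2P}(Q_t^2+Q_\theta^2),\qquad \tfrac1t\lambda_\theta=2P_tP_\theta+2e^{2P}Q_tQ_\theta .$$ An $H^1$-$W^{1,1}$ weak solution is a triple such that $(P,Q)$ is an $H^1$ weak solution of the essential equations, $\lambda\in L^\infty_{loc}(I,W^{1,1}(T^1))$,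 $\lambda_t\in L^\infty_{loc}(I,L^1(T^1))$, the equation for $\lambda_{tt}-\lambda_{\theta\theta}$ holds in the sense of distributions, and the constraints hold almost everywhere. Consider the bound $$\limsup_{n\to\infty}\big\|(P^n,Q^n,P^n_t,Q^n_t,P^n_\theta,Q^n_\theta)\big\|_{L^\infty(I,L^2(T^1))}<+\infty. \qquad (*)$$ (1) (Stability of the essential equations.) For every interval $I\subset(0,+\infty)$ and every sequence $(P^n,Q^n)$ of $H^1$ weak solutions of the essential Gowdy equations on $I\times T^1$ satisfying $(*)$, a subsequence converges weakly in $H^1(J\times T^1)$, for every bounded interval $J\subset I$ (in particular in $H^1(I\times T^1)$ if $I$ is bounded), to a limit $(P^\infty,Q^\infty)$ which is an $H^1$ weak solution of the essential Gowdy equations on $I\times T^1$. (2) (Instability of the full equations.) The corresponding property fails for the full Gowdy equations. Precisely, for every interval $I\subset[t_0,+\infty)$, $t_0>0$, with more than one point, there are $H^1$-$W^{1,1}$ weak solutions $(P^n,Q^n,\lambda^n)$ of the full Gowdy equations on $I\times T^1$ satisfying $(*)$, and functions $P^\infty,Q^\infty,\lambda^\infty$, such that: $(P^n,Q^n)\to(P^\infty,Q^\infty)$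 weakly in $H^1(J\times T^1)$ for every bounded interval $J\subset I$; $(P^\infty,Q^\infty)$ is an $H^1$ weak solution of the essential Gowdy equations; $\lambda^n\to\lambda^\infty$ almost everywhere in $I\times T^1$ and in $L^1(J\times T^1)$ for every compact $J\subset I$; but neither of the two constraints, computed from $(P^\infty,Q^\infty)$, is satisfied by $\lambda^\infty$, even in the sense of distributions. Moreover, for no function $\lambda$ whatsoever is $(P^\infty,Q^\infty,\lambda)$ an $H^1$-$W^{1,1}$ weak solution of the full Gowdy equations. -/

import Mathlib

open MeasureTheory Set Filter Topology
open scoped ContDiff ENNReal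

noncomputable section

namespace Gowdy

/-- Points `(t, θ)` of `ℝ × T¹`, where `T¹ = ℝ / ℤ`. -/
abbrev SpaceTime : Type := ℝ × UnitAddCircle

/-- The slab `J × T¹` over a set of times `J`. -/
def slab (J : Set ℝ) : Set SpaceTime := J ×ˢ (univ : Set UnitAddCircle)

/-- The classical time derivative of a function on `ℝ × T¹`. -/
def pdt (φ : SpaceTime → ℝ) (z : SpaceTime) : ℝ :=
  deriv (fun s : ℝ => φ (s, z.2)) z.1

/-- The classical space derivative of a function on `ℝ × T¹`. -/
def pdx (φ : SpaceTime → ℝ) (z : SpaceTime) : ℝ :=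
  deriv (fun h : ℝ => φ (z.1, z.2 + (h : UnitAddCircle))) 0

/-- Test functions: smooth functions on `ℝ × T¹` with compact support in `int(I) × T¹`. -/
structure IsTest (I : Set ℝ) (φ : SpaceTime → ℝ) : Prop where
  smooth : ContDiff ℝ ∞ (fun p : ℝ × ℝ => φ (p.1, (p.2 : UnitAddCircle)))
  compact : HasCompactSupport φ
  support : tsupport φ ⊆ slab (interior I)

/-- `∂_t u = v` in the sense of distributions on `int(I) × T¹`. -/
structure HasWeakDt (I : Set ℝ) (u v : SpaceTime → ℝ) : Prop where
  locInt : LocallyIntegrableOn u (slab (interior I))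
  locInt' : LocallyIntegrableOn v (slab (interior I))
  eq : ∀ φ, IsTest I φ → ∫ z in slab I, u z * pdt φ z = - ∫ z in slab I, v z * φ z

/-- `∂_θ u = v` in the sense of distributions on `int(I) × T¹`. -/
structure HasWeakDx (I : Set ℝ) (u v : SpaceTime → ℝ) : Prop where
  locInt : LocallyIntegrableOn u (slab (interior I))
  locInt' : LocallyIntegrableOn v (slab (interior I))
  eq : ∀ φ, IsTest I φ → ∫ z in slab I, u z * pdx φ z = - ∫ z in slab I, v z * φ z

/-- The norm of `L^∞(J, L^p(T¹))`. -/
def mixedNorm (J : Set ℝ) (p : ℝ≥0∞) (u : SpaceTime → ℝ) : ℝ≥0∞ :=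
  essSup (fun t : ℝ => eLpNorm (fun θ : UnitAddCircle => u (t, θ)) p volume) (volume.restrict J)

/-- The space `L^∞_loc(I, L^p(T¹))`. -/
structure LinfLoc (I : Set ℝ) (p : ℝ≥0∞) (u : SpaceTime → ℝ) : Prop where
  meas : AEStronglyMeasurable u (volume.restrict (slab I))
  bound : ∀ J : Set ℝ, IsCompact J → J ⊆ I → mixedNorm J p u < ⊤

/-- A function on `ℝ × T¹` together with candidates for its two first-order derivatives. That these
really are its weak derivatives is part of `IsRegular`. -/
structure Field where
  val : SpaceTime → ℝ
  dt : SpaceTime → ℝ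
  dx : SpaceTime → ℝ

/-- `u ∈ L^∞_loc(I, W^{1,p}(T¹))` and `u_t ∈ L^∞_loc(I, L^p(T¹))`, with `u_t = u.dt` and
`u_θ = u.dx` in the sense of distributions. -/
structure IsRegular (I : Set ℝ) (p : ℝ≥0∞) (u : Field) : Prop where
  weak_dt : HasWeakDt I u.val u.dt
  weak_dx : HasWeakDx I u.val u.dx
  val_mem : LinfLoc I p u.val
  dt_mem : LinfLoc I p u.dt
  dx_mem : LinfLoc I p u.dx

/-- `u_tt - u_θθ = f` in the sense of distributions on `int(I) × T¹`. -/
def WeakWave (I : Set ℝ) (u : Field) (f : SpaceTime → ℝ) : Prop :=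
  ∀ φ, IsTest I φ →
    ∫ z in slab I, (- (u.dt z * pdt φ z) + u.dx z * pdx φ z) = ∫ z in slab I, f z * φ z

/-- An `H¹` weak solution of the essential Gowdy equations on `I × T¹`:
`P_tt - P_θθ + P_t / t = e^{2P} (Q_t² - Q_θ²)` and
`Q_tt - Q_θθ + Q_t / t = - 2 (P_t Q_t - P_θ Q_θ)`. -/
structure IsEssentialSolution (I : Set ℝ) (P Q : Field) : Prop where
  reg_P : IsRegular I 2 P
  reg_Q : IsRegular I 2 Q
  wave_P : WeakWave I P fun z =>
    - (P.dt z / z.1) + Real.exp (2 * P.val z) * ((Q.dt z) ^ 2 - (Q.dx z) ^ 2)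
  wave_Q : WeakWave I Q fun z =>
    - (Q.dt z / z.1) - 2 * (P.dt z * Q.dt z - P.dx z * Q.dx z)

/-- `P_t² + P_θ² + e^{2P} (Q_t² + Q_θ²)`. -/
def energyDensity (P Q : Field) (z : SpaceTime) : ℝ :=
  (P.dt z) ^ 2 + (P.dx z) ^ 2 + Real.exp (2 * P.val z) * ((Q.dt z) ^ 2 + (Q.dx z) ^ 2)

/-- `2 P_t P_θ + 2 e^{2P} Q_t Q_θ`. -/
def momentumDensity (P Q : Field) (z : SpaceTime) : ℝ :=
  2 * P.dt z * P.dx z + 2 * Real.exp (2 * P.val z) * Q.dt z * Q.dx z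

/-- An `H¹`-`W^{1,1}` weak solution of the full Gowdy equations on `I × T¹`: the evolution equations
hold in the sense of distributions and the two constraints hold almost everywhere. -/
structure IsGowdySolution (I : Set ℝ) (P Q lam : Field) : Prop where
  essential : IsEssentialSolution I P Q
  reg_lam : IsRegular I 1 lam
  wave_lam : WeakWave I lam fun z =>
    - (P.dt z) ^ 2 + (P.dx z) ^ 2 + Real.exp (2 * P.val z) * (- (Q.dt z) ^ 2 + (Q.dx z) ^ 2)
  constraint_t : ∀ᵐ z ∂(volume.restrict (slab I)), (1 / z.1) * lam.dt z = energyDensity P Q z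
  constraint_x : ∀ᵐ z ∂(volume.restrict (slab I)), (1 / z.1) * lam.dx z = momentumDensity P Q z

/-- The `L^∞(I, L²(T¹))` norm of `(P, Q, P_t, Q_t, P_θ, Q_θ)` (sum of the norms of the entries). -/
def totalNorm (I : Set ℝ) (P Q : Field) : ℝ≥0∞ :=
  mixedNorm I 2 P.val + mixedNorm I 2 Q.val + mixedNorm I 2 P.dt + mixedNorm I 2 Q.dt
    + mixedNorm I 2 P.dx + mixedNorm I 2 Q.dx

/-- Weak convergence in `L²(J × T¹)`. -/
structure WeakL2 (J : Set ℝ) (u : ℕ → SpaceTime → ℝ) (v : SpaceTime → ℝ) : Prop where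
  mem : ∀ n, MemLp (u n) 2 (volume.restrict (slab J))
  mem_lim : MemLp v 2 (volume.restrict (slab J))
  tendsto : ∀ g : SpaceTime → ℝ, MemLp g 2 (volume.restrict (slab J)) →
    Tendsto (fun n => ∫ z in slab J, u n z * g z) atTop (𝓝 (∫ z in slab J, v z * g z))

/-- Weak convergence in `H¹(J × T¹)` for every bounded interval `J ⊆ I`; if `I` is bounded this
contains weak convergence in `H¹(I × T¹)`, by taking `J = I`. -/
def WeakH1 (I : Set ℝ) (u : ℕ → Field) (v : Field) : Prop :=
  ∀ J : Set ℝ, J ⊆ I → J.OrdConnected → Bornology.IsBounded J →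
    WeakL2 J (fun n => (u n).val) v.val ∧ WeakL2 J (fun n => (u n).dt) v.dt ∧
      WeakL2 J (fun n => (u n).dx) v.dx

end Gowdy

end

/-!
Stability. The nonlinear terms of the essential equations are quadratic in the derivatives, and such
terms do not pass to weak limits one by one. But the equations are those of a wave map into the
hyperbolic plane, and two Killing fields of the plane turn them into conservation laws (`DivForm`):
`t e^{2P} DQ` and `t (DP - e^{2P} Q DQ)` are divergence-free, with `D = (∂_t, -∂_θ)`. These are linear
in the derivatives, with coefficients continuous in `t`, `P`, `Q`. The two forms are equivalent for
weak solutions (`IsEssentialSolution.divForm`, `DivForm.essential`), because a weak equation may be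
tested with `G(P) H(Q) χ` (`FluxEq.test`): both fields are bounded, by the Sobolev inequality in `θ`
(`IsCutoff.ae_bound`), and are approximated by their mollifications.

Given a bounded sequence of solutions, Hilbert space compactness in a weighted `L²` space yields weak
limits of the fields and of their derivatives (`exists_weakL2_subseq`), and bounds in `L^∞(L²)` survive
(`mixedNorm_le_of_weak`). The fields themselves converge strongly, by a Rellich argument through
mollification (`tendsto_eLpNorm_of_weak`), hence almost everywhere along a further subsequence; being
uniformly bounded, their continuous functions may be multiplied with the weakly convergent derivatives
(`WeakL2.coeff_mul`). So the conservation laws hold in the limit (`exists_subseq_essential`).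

Instability. The constraints, in contrast, are genuinely quadratic. For `Q = 0` the essential equations
reduce to the linear equation `P_tt + P_t / t = P_θθ`. Take for `P^n` the sum of a fixed wave of the
lowest frequency and of a wave of frequency index `n + 2` travelling in the opposite direction, built
from solutions of Bessel's equation (`exists_mode`). The mean of `2 t P_t P_θ` over the circle is
constant in time for each wave, since it is a Wronskian (`IsMode.wronskian`), and the data are chosen
so that these constants cancel. Therefore the constraints can be solved, even explicitly
(`hasPd_lamSeq`). By the Riemann–Lebesgue lemma the fast wave converges weakly to zero with its
derivatives (`tendsto_integral_trig`), so the limit of `P^n` is the fixed wave. The energy of the fast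
wave does not disappear: `t` times its energy tends to a positive constant
(`IsMode.abs_mul_energy_sub_le`). Thus the limit of the `λ^n` violates each constraint by the constant
`t₀` (`hasPd_lamLim`), which test functions depending on time alone detect
(`exists_test_integral_ne`). The same test functions show that no other `λ` exists: the mean momentum
of the fixed wave is nonzero, while the mean of `λ_θ / t` over the circle vanishes.
-/

namespace Gowdy

/-! ### Smooth functions on space-time -/

/-- Smooth functions on `ℝ × T¹`, smoothness being that of the lift to the universal cover. -/
def SmoothL (φ : SpaceTime → ℝ) : Prop :=
  ContDiff ℝ ∞ (fun p : ℝ × ℝ => φ (p.1, (p.2 : UnitAddCircle)))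

/-- The covering map `ℝ × ℝ → ℝ × T¹`. -/
def cover (p : ℝ × ℝ) : SpaceTime := (p.1, (p.2 : UnitAddCircle))

lemma isOpenQuotientMap_cover : IsOpenQuotientMap cover :=
  (IsOpenQuotientMap.id (X := ℝ)).prodMap
    (QuotientAddGroup.isOpenQuotientMap_mk (N := AddSubgroup.zmultiples (1 : ℝ)))

lemma cover_surjective (z : SpaceTime) : ∃ p : ℝ × ℝ, cover p = z :=
  isOpenQuotientMap_cover.surjective z

lemma IsTest.smoothL {I : Set ℝ} {φ : SpaceTime → ℝ} (h : IsTest I φ) : SmoothL φ := h.smooth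

namespace SmoothL

variable {φ ψ : SpaceTime → ℝ}

lemma continuous (h : SmoothL φ) : Continuous φ :=
  isOpenQuotientMap_cover.isQuotientMap.continuous_iff.2 (ContDiff.continuous h)

lemma hasDerivAt_t (h : SmoothL φ) (z : SpaceTime) :
    HasDerivAt (fun s : ℝ => φ (s, z.2)) (pdt φ z) z.1 := by
  obtain ⟨p, rfl⟩ := cover_surjective z
  refine DifferentiableAt.hasDerivAt ?_
  have h1 : DifferentiableAt ℝ (fun p : ℝ × ℝ => φ (p.1, (p.2 : UnitAddCircle))) (p.1, p.2) :=
    (ContDiff.differentiable h (by simp)).differentiableAt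
  exact DifferentiableAt.comp (f := fun s : ℝ => (s, p.2)) p.1 h1 (by fun_prop)

lemma hasDerivAt_x (h : SmoothL φ) (z : SpaceTime) :
    HasDerivAt (fun s : ℝ => φ (z.1, z.2 + (s : UnitAddCircle))) (pdx φ z) 0 := by
  obtain ⟨p, rfl⟩ := cover_surjective z
  refine DifferentiableAt.hasDerivAt ?_
  have h1 : DifferentiableAt ℝ (fun p : ℝ × ℝ => φ (p.1, (p.2 : UnitAddCircle)))
      (p.1, p.2 + 0) :=
    (ContDiff.differentiable h (by simp)).differentiableAt
  have := DifferentiableAt.comp (f := fun s : ℝ => (p.1, p.2 + s)) 0 h1 (by fun_prop)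
  simpa [Function.comp_def, cover] using this

lemma pdt_cover (h : SmoothL φ) (p : ℝ × ℝ) :
    pdt φ (cover p) = fderiv ℝ (fun p : ℝ × ℝ => φ (p.1, (p.2 : UnitAddCircle))) p (1, 0) := by
  have h1 : HasFDerivAt (fun p : ℝ × ℝ => φ (p.1, (p.2 : UnitAddCircle))) _ (p.1, p.2) :=
    (ContDiff.differentiable h (by simp)).differentiableAt.hasFDerivAt
  have h2 : HasDerivAt (fun s : ℝ => (s, p.2)) ((1 : ℝ), (0 : ℝ)) p.1 :=
    (hasDerivAt_id _).prodMk (hasDerivAt_const _ _)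
  exact (h1.comp_hasDerivAt (f := fun s : ℝ => (s, p.2)) p.1 h2).deriv

lemma hasDerivAt_lift (h : SmoothL φ) (p : ℝ × ℝ) :
    HasDerivAt (fun s : ℝ => φ (p.1, (s : UnitAddCircle)))
      (fderiv ℝ (fun p : ℝ × ℝ => φ (p.1, (p.2 : UnitAddCircle))) p (0, 1)) p.2 := by
  have h1 : HasFDerivAt (fun p : ℝ × ℝ => φ (p.1, (p.2 : UnitAddCircle))) _ (p.1, p.2) :=
    (ContDiff.differentiable h (by simp)).differentiableAt.hasFDerivAt
  have h2 : HasDerivAt (fun s : ℝ => (p.1, s)) ((0 : ℝ), (1 : ℝ)) p.2 :=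
    (hasDerivAt_const _ _).prodMk (hasDerivAt_id _)
  exact h1.comp_hasDerivAt (f := fun s : ℝ => (p.1, s)) p.2 h2

lemma pdx_cover (h : SmoothL φ) (p : ℝ × ℝ) :
    pdx φ (cover p) = fderiv ℝ (fun p : ℝ × ℝ => φ (p.1, (p.2 : UnitAddCircle))) p (0, 1) := by
  have h1 := h.hasDerivAt_lift p
  have h2 : HasDerivAt (fun s : ℝ => p.2 + s) 1 0 := by
    simpa using (hasDerivAt_id (0 : ℝ)).const_add p.2
  rw [← add_zero p.2] at h1
  have h3 := (HasDerivAt.comp (0 : ℝ) (h₂ := fun s : ℝ => φ (p.1, (s : UnitAddCircle))) h1 h2).deriv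
  simpa [Function.comp_def, pdx, cover] using h3

lemma hasDerivAt_x_lift (h : SmoothL φ) (p : ℝ × ℝ) :
    HasDerivAt (fun s : ℝ => φ (p.1, (s : UnitAddCircle))) (pdx φ (cover p)) p.2 := by
  rw [h.pdx_cover]; exact h.hasDerivAt_lift p

lemma pdt (h : SmoothL φ) : SmoothL (pdt φ) := by
  have : (fun p : ℝ × ℝ => Gowdy.pdt φ (p.1, (p.2 : UnitAddCircle))) = fun p =>
      fderiv ℝ (fun p : ℝ × ℝ => φ (p.1, (p.2 : UnitAddCircle))) p (1, 0) :=
    funext fun p => h.pdt_cover p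
  unfold SmoothL
  rw [this]
  exact (ContDiff.fderiv_right (m := ∞) h (by simp)).clm_apply contDiff_const

lemma pdx (h : SmoothL φ) : SmoothL (pdx φ) := by
  have : (fun p : ℝ × ℝ => Gowdy.pdx φ (p.1, (p.2 : UnitAddCircle))) = fun p =>
      fderiv ℝ (fun p : ℝ × ℝ => φ (p.1, (p.2 : UnitAddCircle))) p (0, 1) :=
    funext fun p => h.pdx_cover p
  unfold SmoothL
  rw [this]
  exact (ContDiff.fderiv_right (m := ∞) h (by simp)).clm_apply contDiff_const

lemma mul (h : SmoothL φ) (h' : SmoothL ψ) : SmoothL (fun z => φ z * ψ z) :=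
  ContDiff.mul h h'

lemma comp {G : ℝ → ℝ} (hG : ContDiff ℝ ∞ G) (h : SmoothL φ) : SmoothL (fun z => G (φ z)) :=
  ContDiff.comp hG h

lemma time {f : ℝ → ℝ} (hf : ContDiff ℝ ∞ f) : SmoothL (fun z => f z.1) :=
  hf.comp contDiff_fst

lemma space {f : UnitAddCircle → ℝ} (hf : ContDiff ℝ ∞ (fun x : ℝ => f x)) :
    SmoothL (fun z => f z.2) :=
  hf.comp (contDiff_snd (𝕜 := ℝ) (E := ℝ) (F := ℝ))

lemma reflect (h : SmoothL φ) (z : SpaceTime) : SmoothL (fun w => φ (z - w)) := by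
  obtain ⟨p, rfl⟩ := cover_surjective z
  have h1 : ContDiff ℝ ∞ (fun q : ℝ × ℝ => p - q) := contDiff_const.sub contDiff_id
  exact ContDiff.comp (g := fun p : ℝ × ℝ => φ (p.1, (p.2 : UnitAddCircle))) h h1

lemma pdt_reflect (h : SmoothL φ) (z w : SpaceTime) :
    Gowdy.pdt (fun w => φ (z - w)) w = - Gowdy.pdt φ (z - w) := by
  have h1 := h.hasDerivAt_t (z - w)
  have h2 : HasDerivAt (fun s : ℝ => z.1 - s) (-1) w.1 := by
    simpa using (hasDerivAt_id w.1).const_sub z.1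
  have := (HasDerivAt.comp w.1 (h₂ := fun s : ℝ => φ (s, (z - w).2)) h1 h2).deriv
  rw [mul_neg, mul_one] at this
  exact this

lemma pdx_reflect (h : SmoothL φ) (z w : SpaceTime) :
    Gowdy.pdx (fun w => φ (z - w)) w = - Gowdy.pdx φ (z - w) := by
  have h1 := h.hasDerivAt_x (z - w)
  have h2 : HasDerivAt (fun s : ℝ => - s) (-1) 0 := by
    exact (hasDerivAt_id (0 : ℝ)).neg
  rw [← neg_zero] at h1
  have := (HasDerivAt.comp (0 : ℝ)
    (h₂ := fun s : ℝ => φ ((z - w).1, (z - w).2 + (s : UnitAddCircle))) h1 h2).deriv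
  simp only [mul_neg, mul_one] at this
  rw [← this, Gowdy.pdx]
  congr 1
  funext s
  simp only [Function.comp_def, Prod.snd_sub, Prod.fst_sub, AddCircle.coe_neg]
  congr 1
  ext1
  · rfl
  · simp only [Prod.snd_sub]; abel

lemma pdt_mul (h : SmoothL φ) (h' : SmoothL ψ) (z : SpaceTime) :
    Gowdy.pdt (fun z => φ z * ψ z) z = Gowdy.pdt φ z * ψ z + φ z * Gowdy.pdt ψ z :=
  ((h.hasDerivAt_t z).mul (h'.hasDerivAt_t z)).deriv

lemma pdx_mul (h : SmoothL φ) (h' : SmoothL ψ) (z : SpaceTime) :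
    Gowdy.pdx (fun z => φ z * ψ z) z = Gowdy.pdx φ z * ψ z + φ z * Gowdy.pdx ψ z := by
  have := ((h.hasDerivAt_x z).mul (h'.hasDerivAt_x z)).deriv
  simp only [AddCircle.coe_zero, add_zero, Prod.mk.eta] at this
  exact this

lemma pdt_comp {G : ℝ → ℝ} (hG : ContDiff ℝ ∞ G) (h : SmoothL φ) (z : SpaceTime) :
    Gowdy.pdt (fun z => G (φ z)) z = deriv G (φ z) * Gowdy.pdt φ z :=
  (HasDerivAt.comp (h₂ := G) z.1 ((hG.differentiable (by simp)).differentiableAt.hasDerivAt)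
    (h.hasDerivAt_t z)).deriv

lemma pdx_comp {G : ℝ → ℝ} (hG : ContDiff ℝ ∞ G) (h : SmoothL φ) (z : SpaceTime) :
    Gowdy.pdx (fun z => G (φ z)) z = deriv G (φ z) * Gowdy.pdx φ z := by
  have := (HasDerivAt.comp (h₂ := G) 0
    ((hG.differentiable (by simp)).differentiableAt.hasDerivAt) (h.hasDerivAt_x z)).deriv
  simpa [Gowdy.pdx, Function.comp_def] using this

end SmoothL

lemma pdt_time (f : ℝ → ℝ) (z : SpaceTime) : pdt (fun z => f z.1) z = deriv f z.1 := rfl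

lemma pdx_time (f : ℝ → ℝ) (z : SpaceTime) : pdx (fun z => f z.1) z = 0 := by
  simp [pdx]

/-! ### Test functions -/

lemma slab_mono {I J : Set ℝ} (h : I ⊆ J) : slab I ⊆ slab J := prod_mono h subset_rfl

lemma isCompact_slab {K : Set ℝ} (h : IsCompact K) : IsCompact (slab K) := h.prod isCompact_univ

lemma mem_slab {J : Set ℝ} {z : SpaceTime} : z ∈ slab J ↔ z.1 ∈ J := by simp [slab]

lemma measurableSet_slab {J : Set ℝ} (h : MeasurableSet J) : MeasurableSet (slab J) :=
  h.prod MeasurableSet.univ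

/-- A smooth function that vanishes off a compact subset of times inside `I` is a test function. -/
lemma SmoothL.isTest {I K : Set ℝ} {φ : SpaceTime → ℝ} (h : SmoothL φ) (hK : IsCompact K)
    (hKI : K ⊆ interior I) (h0 : ∀ z, z.1 ∉ K → φ z = 0) : IsTest I φ := by
  have hs : tsupport φ ⊆ slab K := by
    refine closure_minimal (fun z hz => ?_) (isCompact_slab hK).isClosed
    by_contra hc
    exact hz (h0 z (fun h => hc (mem_slab.2 h)))
  exact ⟨h, (isCompact_slab hK).of_isClosed_subset (isClosed_tsupport _) hs,
    hs.trans (slab_mono hKI)⟩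

lemma IsTest.mul_smooth {I : Set ℝ} {φ ψ : SpaceTime → ℝ} (h : IsTest I φ) (hψ : SmoothL ψ) :
    IsTest I (fun z => ψ z * φ z) :=
  ⟨hψ.mul h.smoothL, h.compact.mul_left, (tsupport_mul_subset_right).trans h.support⟩

/-- The times carrying a test function lie in a compact interval inside the interior of `I`. -/
lemma IsTest.exists_Icc {I : Set ℝ} (hI : I.OrdConnected) {φ : SpaceTime → ℝ} (h : IsTest I φ) :
    φ = 0 ∨ ∃ a b, a ≤ b ∧ Icc a b ⊆ interior I ∧ ∀ z, z.1 ∉ Icc a b → φ z = 0 := by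
  by_cases h0 : (tsupport φ).Nonempty
  · right
    have hc : IsCompact (Prod.fst '' tsupport φ) := IsCompact.image h.compact continuous_fst
    have hne : (Prod.fst '' tsupport φ).Nonempty := h0.image _
    have hsub : Prod.fst '' tsupport φ ⊆ interior I := by
      rintro _ ⟨z, hz, rfl⟩
      exact mem_slab.1 (h.support hz)
    refine ⟨sInf (Prod.fst '' tsupport φ), sSup (Prod.fst '' tsupport φ), ?_, ?_, ?_⟩
    · exact csInf_le_csSup hne hc.bddBelow hc.bddAbove
    · exact hI.interior.out (hsub (hc.sInf_mem hne)) (hsub (hc.sSup_mem hne))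
    · intro z hz
      by_contra hφ
      have hm : z.1 ∈ Prod.fst '' tsupport φ := ⟨z, subset_tsupport _ hφ, rfl⟩
      exact hz ⟨csInf_le hc.bddBelow hm, le_csSup hc.bddAbove hm⟩
  · left
    rw [not_nonempty_iff_eq_empty, tsupport_eq_empty_iff] at h0
    exact h0

/-- A smooth cut-off in time: `η` vanishes off `[a', b'] ⊆ int(I)`, and equals `1` near
`[a, b]`. -/
structure IsCutoff (I : Set ℝ) (a b a' b' : ℝ) (η : ℝ → ℝ) : Prop where
  sub : Icc a' b' ⊆ interior I
  smooth : ContDiff ℝ ∞ η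
  zero : ∀ t, t ∉ Icc a' b' → η t = 0
  one : ∀ t ∈ Icc a b, η t = 1
  deriv_zero : ∀ t ∈ Icc a b, deriv η t = 0
  range : ∀ t, η t ∈ Icc 0 1

lemma exists_cutoff {I : Set ℝ} (hI : I.OrdConnected) {a b : ℝ} (hab : a ≤ b)
    (h : Icc a b ⊆ interior I) : ∃ a' b' η, IsCutoff I a b a' b' η := by
  obtain ⟨δ, hδ, hδI⟩ := (isCompact_Icc (a := a) (b := b)).exists_cthickening_subset_open
    isOpen_interior h
  have hs : Icc (a - δ) (b + δ) ⊆ interior I := by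
    refine hI.interior.out (hδI ?_) (hδI ?_)
    · exact Metric.mem_cthickening_of_dist_le _ a _ _ (left_mem_Icc.2 hab)
        (by simp [abs_of_pos hδ])
    · exact Metric.mem_cthickening_of_dist_le _ b _ _ (right_mem_Icc.2 hab)
        (by simp [abs_of_pos hδ])
  let f : ContDiffBump ((a + b) / 2) := ⟨(b - a) / 2 + δ / 2, (b - a) / 2 + δ, by linarith,
    by linarith⟩
  have hball : ∀ t ∈ Icc a b, t ∈ Metric.ball ((a + b) / 2) f.rIn := by
    intro t ht
    rw [Metric.mem_ball, Real.dist_eq, abs_lt]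
    simp only [f]
    constructor <;> linarith [ht.1, ht.2]
  refine ⟨a - δ, b + δ, f, hs, f.contDiff, ?_, ?_, ?_, fun t => ⟨f.nonneg, f.le_one⟩⟩
  · intro t ht
    refine f.zero_of_le_dist ?_
    rw [Real.dist_eq]
    by_contra! hc
    obtain ⟨h1, h2⟩ := abs_lt.1 hc
    simp only [f] at h1 h2
    exact ht ⟨by linarith, by linarith⟩
  · exact fun t ht => f.one_of_mem_closedBall (Metric.ball_subset_closedBall (hball t ht))
  · intro t ht
    rw [(f.eventuallyEq_one_of_mem_ball (hball t ht)).deriv_eq]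
    exact deriv_const _ _

lemma pdt_eq_zero {φ : SpaceTime → ℝ} {K : Set ℝ} (hK : IsClosed K)
    (h0 : ∀ z : SpaceTime, z.1 ∉ K → φ z = 0) {z : SpaceTime} (hz : z.1 ∉ K) : pdt φ z = 0 := by
  have : (fun s : ℝ => φ (s, z.2)) =ᶠ[𝓝 z.1] fun _ => 0 := by
    filter_upwards [hK.isOpen_compl.mem_nhds hz] with s hs using h0 _ hs
  rw [Gowdy.pdt, this.deriv_eq]
  simp

lemma pdx_eq_zero {φ : SpaceTime → ℝ} {K : Set ℝ}
    (h0 : ∀ z : SpaceTime, z.1 ∉ K → φ z = 0) {z : SpaceTime} (hz : z.1 ∉ K) : pdx φ z = 0 := by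
  have : (fun s : ℝ => φ (z.1, z.2 + (s : UnitAddCircle))) = fun _ => 0 := by
    funext s; exact h0 _ hz
  rw [Gowdy.pdx, this]
  simp

lemma IsTest.pdt {I : Set ℝ} {φ : SpaceTime → ℝ} (h : IsTest I φ) (hI : I.OrdConnected) :
    IsTest I (Gowdy.pdt φ) := by
  rcases h.exists_Icc hI with rfl | ⟨a, b, hab, hsub, h0⟩
  · have : Gowdy.pdt (0 : SpaceTime → ℝ) = 0 := by
      funext z; simp [Gowdy.pdt]
    rwa [this]
  · exact h.smoothL.pdt.isTest isCompact_Icc hsub fun z hz => pdt_eq_zero isClosed_Icc h0 hz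

lemma IsTest.pdx {I : Set ℝ} {φ : SpaceTime → ℝ} (h : IsTest I φ) (hI : I.OrdConnected) :
    IsTest I (Gowdy.pdx φ) := by
  rcases h.exists_Icc hI with rfl | ⟨a, b, hab, hsub, h0⟩
  · have : Gowdy.pdx (0 : SpaceTime → ℝ) = 0 := by
      funext z; simp [Gowdy.pdx]
    rwa [this]
  · exact h.smoothL.pdx.isTest isCompact_Icc hsub fun z hz => pdx_eq_zero h0 hz

lemma IsTest.exists_bound {I : Set ℝ} {φ : SpaceTime → ℝ} (h : IsTest I φ) :
    ∃ C, ∀ z, |φ z| ≤ C := h.compact.exists_bound_of_continuous h.smoothL.continuous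

lemma IsTest.integrable {I : Set ℝ} {φ : SpaceTime → ℝ} (h : IsTest I φ) : Integrable φ :=
  h.smoothL.continuous.integrable_of_hasCompactSupport h.compact

lemma IsTest.memLp {I : Set ℝ} {φ : SpaceTime → ℝ} (h : IsTest I φ) (p : ℝ≥0∞) : MemLp φ p :=
  h.smoothL.continuous.memLp_of_hasCompactSupport h.compact

lemma IsTest.eq_zero {I : Set ℝ} {φ : SpaceTime → ℝ} (h : IsTest I φ) {z : SpaceTime}
    (hz : z.1 ∉ interior I) : φ z = 0 := by
  by_contra hc
  exact hz (mem_slab.1 (h.support (subset_tsupport _ hc)))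

/-- Integrals against functions supported in the interior of `I` may be taken over all of
space-time. -/
lemma setIntegral_slab_eq {I : Set ℝ} {f : SpaceTime → ℝ}
    (h : ∀ z : SpaceTime, z.1 ∉ interior I → f z = 0) : ∫ z in slab I, f z = ∫ z, f z :=
  setIntegral_eq_integral_of_forall_compl_eq_zero fun z hz =>
    h z fun h' => hz (mem_slab.2 (interior_subset h'))

/-! ### Cosines and sines on the circle -/

/-- `cos (2 π m θ)` as a function on the circle. -/
noncomputable def cosC (m : ℤ) (θ : UnitAddCircle) : ℝ := (fourier m θ).re

/-- `sin (2 π m θ)` as a function on the circle. -/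
noncomputable def sinC (m : ℤ) (θ : UnitAddCircle) : ℝ := (fourier m θ).im

lemma cosC_coe (m : ℤ) (x : ℝ) : cosC m (x : UnitAddCircle) = Real.cos (2 * Real.pi * m * x) := by
  have : (2 * Real.pi * Complex.I * m * x / (1 : ℝ) : ℂ)
      = ((2 * Real.pi * m * x : ℝ) : ℂ) * Complex.I := by
    push_cast; ring
  rw [cosC, fourier_coe_apply, this, Complex.exp_ofReal_mul_I_re]

lemma sinC_coe (m : ℤ) (x : ℝ) : sinC m (x : UnitAddCircle) = Real.sin (2 * Real.pi * m * x) := by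
  have : (2 * Real.pi * Complex.I * m * x / (1 : ℝ) : ℂ)
      = ((2 * Real.pi * m * x : ℝ) : ℂ) * Complex.I := by
    push_cast; ring
  rw [sinC, fourier_coe_apply, this, Complex.exp_ofReal_mul_I_im]

/-! ### Mollification on space-time -/

instance : (volume : Measure SpaceTime).IsAddHaarMeasure :=
  inferInstanceAs (((volume : Measure ℝ).prod (volume : Measure UnitAddCircle)).IsAddHaarMeasure)

instance : (volume : Measure SpaceTime).IsNegInvariant :=
  Measure.IsAddHaarMeasure.isNegInvariant_of_regular _

/-- A nonnegative smooth kernel of integral one, supported within distance `δ` of the origin. -/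
structure IsKernel (δ : ℝ) (ρ : SpaceTime → ℝ) : Prop where
  smooth : SmoothL ρ
  nonneg : ∀ z, 0 ≤ ρ z
  integral : ∫ z, ρ z = 1
  supp : ∀ z, ρ z ≠ 0 → |z.1| ≤ δ ∧ ‖z.2‖ ≤ δ

lemma IsKernel.isTest {δ : ℝ} {ρ : SpaceTime → ℝ} (h : IsKernel δ ρ) : IsTest univ ρ := by
  refine h.smooth.isTest (isCompact_Icc (a := -δ) (b := δ)) (by simp) fun z hz => ?_
  by_contra hc
  exact hz (abs_le.1 (h.supp z hc).1)

/-- Kernels exist at every scale: take a bump function in time, and in space the composition of a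
smooth step with the cosine, which is smooth on the circle and supported near the origin. -/
lemma exists_isKernel {δ : ℝ} (hδ : 0 < δ) : ∃ ρ, IsKernel δ ρ := by
  set d := min δ (1 / 4) with hd
  have hd0 : 0 < d := lt_min hδ (by norm_num)
  have hd4 : d ≤ 1 / 4 := min_le_right _ _
  let f : ContDiffBump (0 : ℝ) := ⟨δ / 2, δ, by linarith, by linarith⟩
  let g : UnitAddCircle → ℝ := fun θ => Real.smoothTransition (cosC 1 θ - Real.cos (2 * Real.pi * d))
  have hg : ContDiff ℝ ∞ (fun x : ℝ => g x) := by
    simp only [g, cosC_coe]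
    exact Real.smoothTransition.contDiff.comp
      ((Real.contDiff_cos.comp (by fun_prop)).sub contDiff_const)
  have hg0 : ∀ θ, 0 ≤ g θ := fun θ => Real.smoothTransition.nonneg _
  have hgs : ∀ θ, g θ ≠ 0 → ‖θ‖ ≤ δ := by
    intro θ hθ
    obtain ⟨x, rfl⟩ := QuotientAddGroup.mk_surjective θ
    by_contra! hc
    apply hθ
    apply Real.smoothTransition.zero_of_nonpos
    have h1 : ‖(x : UnitAddCircle)‖ = |x - round x| := UnitAddCircle.norm_eq
    have h2 : Real.cos (2 * Real.pi * (1 : ℤ) * x) = Real.cos (2 * Real.pi * |x - round x|) := by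
      rw [show 2 * Real.pi * |x - round x| = |2 * Real.pi * (x - round x)| by
        rw [abs_mul, abs_of_pos Real.two_pi_pos], Real.cos_abs]
      rw [show 2 * Real.pi * (x - round x) = 2 * Real.pi * (1 : ℤ) * x - round x * (2 * Real.pi) by
        push_cast; ring, Real.cos_sub_int_mul_two_pi]
    change cosC 1 (x : UnitAddCircle) - _ ≤ 0
    rw [cosC_coe, h2, sub_nonpos]
    have h3 : d < |x - round x| := by
      rw [← h1]; exact (min_le_left _ _).trans_lt hc
    have h4 := abs_sub_round x
    apply Real.cos_le_cos_of_nonneg_of_le_pi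
    · positivity
    · nlinarith [Real.pi_pos]
    · nlinarith [Real.pi_pos]
  have hs : SmoothL (fun z => f z.1 * g z.2) :=
    (SmoothL.time f.contDiff).mul (SmoothL.space hg)
  have hsupp : ∀ z : SpaceTime, f z.1 * g z.2 ≠ 0 → |z.1| ≤ δ ∧ ‖z.2‖ ≤ δ := by
    intro z hz
    refine ⟨?_, hgs _ (right_ne_zero_of_mul hz)⟩
    by_contra! hc
    exact left_ne_zero_of_mul hz (f.zero_of_le_dist (by simpa [Real.dist_eq] using hc.le))
  have ht : IsTest univ (fun z : SpaceTime => f z.1 * g z.2) := by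
    refine hs.isTest (isCompact_Icc (a := -δ) (b := δ)) (by simp) fun z hz => ?_
    by_contra hc
    exact hz (abs_le.1 (hsupp z hc).1)
  have hpos : 0 < ∫ z : SpaceTime, f z.1 * g z.2 := by
    refine hs.continuous.integral_pos_of_hasCompactSupport_nonneg_nonzero ht.compact
      (fun z => mul_nonneg f.nonneg (hg0 _)) (x := 0) ?_
    refine mul_ne_zero ?_ ?_
    · have : f 0 = 1 := f.one_of_mem_closedBall (by simp [f]; linarith)
      simp [this]
    · refine (Real.smoothTransition.pos_of_pos ?_).ne'
      have : cosC 1 (0 : UnitAddCircle) = 1 := by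
        rw [← AddCircle.coe_zero (p := (1 : ℝ)), cosC_coe]; simp
      simp only [Prod.snd_zero, this, sub_pos]
      rw [← Real.cos_zero]
      apply Real.cos_lt_cos_of_nonneg_of_le_pi
      · exact le_rfl
      · nlinarith [Real.pi_pos]
      · have := Real.pi_pos; positivity
  set c := ∫ z : SpaceTime, f z.1 * g z.2 with hcdef
  refine ⟨fun z => c⁻¹ * (f z.1 * g z.2), ?_, ?_, ?_, ?_⟩
  · exact SmoothL.mul (φ := fun _ => c⁻¹) (contDiff_const) hs
  · exact fun z => mul_nonneg (inv_nonneg.2 hpos.le) (mul_nonneg f.nonneg (hg0 _))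
  · rw [integral_const_mul, ← hcdef, inv_mul_cancel₀ hpos.ne']
  · exact fun z hz => hsupp z (right_ne_zero_of_mul hz)

/-- The convolution of `u` with the kernel `ρ` on the group `ℝ × T¹`. -/
noncomputable def moll (ρ u : SpaceTime → ℝ) (z : SpaceTime) : ℝ := ∫ w, ρ (z - w) * u w

lemma moll_eq (ρ u : SpaceTime → ℝ) (z : SpaceTime) : moll ρ u z = ∫ w, ρ w * u (z - w) := by
  rw [moll, ← integral_sub_left_eq_self (fun w => ρ w * u (z - w)) volume z]
  simp

lemma measurePreserving_cover :
    MeasurePreserving cover (volume.restrict (univ ×ˢ Ioc (0 : ℝ) 1)) volume := by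
  have h := UnitAddCircle.measurePreserving_mk 0
  rw [zero_add] at h
  have := (MeasurePreserving.id (volume : Measure ℝ)).prod h
  have e : (volume.restrict (univ ×ˢ Ioc (0 : ℝ) 1) : Measure (ℝ × ℝ))
      = (volume : Measure ℝ).prod (volume.restrict (Ioc (0 : ℝ) 1)) := by
    rw [Measure.volume_eq_prod, ← Measure.prod_restrict, Measure.restrict_univ]
  rw [e]
  exact this

/-- Smoothness of mollifications. The integral is written as a convolution over the universal cover
of the pulled-back kernel, cut off in space, with `u` restricted to a fundamental domain. -/
lemma SmoothL.moll {ρ u : SpaceTime → ℝ} (h : IsTest univ ρ) (hu : Integrable u) :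
    SmoothL (moll ρ u) := by
  unfold SmoothL
  rw [contDiff_iff_contDiffAt]
  intro p₀
  let f : ContDiffBump (0 : ℝ) := ⟨|p₀.2| + 2, |p₀.2| + 3, by positivity, by linarith⟩
  let k : ℝ × ℝ → ℝ := fun p => ρ (cover p) * f p.2
  let u₁ : ℝ × ℝ → ℝ := (univ ×ˢ Ioc (0 : ℝ) 1).indicator (fun p => u (cover p))
  have hm : MeasurableSet ((univ : Set ℝ) ×ˢ Ioc (0 : ℝ) 1) := MeasurableSet.univ.prod measurableSet_Ioc
  have hu₁ : Integrable u₁ := by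
    rw [integrable_indicator_iff hm]
    exact measurePreserving_cover.integrable_comp_of_integrable hu
  have hk : ContDiff ℝ ∞ k := ContDiff.mul h.smooth (f.contDiff.comp contDiff_snd)
  obtain ⟨a, b, hab⟩ : ∃ a b, ∀ z : SpaceTime, z.1 ∉ Icc a b → ρ z = 0 := by
    rcases h.exists_Icc ordConnected_univ with rfl | ⟨a, b, -, -, h0⟩
    · exact ⟨0, 0, fun _ _ => rfl⟩
    · exact ⟨a, b, h0⟩
  have hkc : HasCompactSupport k := by
    refine HasCompactSupport.of_support_subset_isCompact
      ((isCompact_Icc (a := a) (b := b)).prod (isCompact_closedBall (0 : ℝ) (|p₀.2| + 3))) ?_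
    intro p hp
    refine ⟨?_, ?_⟩
    · by_contra hc
      exact left_ne_zero_of_mul hp (hab _ hc)
    · have : p.2 ∈ Function.support f := right_ne_zero_of_mul hp
      rw [f.support_eq] at this
      exact Metric.ball_subset_closedBall this
  have hconv : ContDiff ℝ ∞ (convolution u₁ k (ContinuousLinearMap.mul ℝ ℝ) volume) :=
    hkc.contDiff_convolution_right (n := ⊤) _ hu₁.locallyIntegrable hk
  refine hconv.contDiffAt.congr_of_eventuallyEq ?_
  have hnb : ∀ᶠ p : ℝ × ℝ in 𝓝 p₀, |p.2 - p₀.2| < 1 := by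
    have : Continuous fun p : ℝ × ℝ => |p.2 - p₀.2| := by fun_prop
    exact this.continuousAt.eventually_lt continuousAt_const (by simp)
  filter_upwards [hnb] with p hp
  have h1 : Gowdy.moll ρ u (cover p) = ∫ q in univ ×ˢ Ioc (0 : ℝ) 1,
      ρ (cover p - cover q) * u (cover q) := by
    rw [Gowdy.moll, ← measurePreserving_cover.map_eq, integral_map]
    · exact measurePreserving_cover.measurable.aemeasurable
    · rw [measurePreserving_cover.map_eq]
      exact (h.smoothL.reflect _).continuous.aestronglyMeasurable.mul hu.aestronglyMeasurable
  change Gowdy.moll ρ u (cover p) = _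
  rw [h1, ← integral_indicator hm, convolution_def]
  congr 1
  funext q
  simp only [u₁, indicator, k, ContinuousLinearMap.mul_apply']
  split_ifs with hq
  · have : f (p - q).2 = 1 := by
      refine f.one_of_mem_closedBall ?_
      simp only [f, Metric.mem_closedBall, Real.dist_eq, Prod.snd_sub, sub_zero]
      have h2 := hq.2.1
      have h3 := hq.2.2
      have h4 := abs_lt.1 hp
      have h5 := neg_abs_le p₀.2
      have h6 := le_abs_self p₀.2
      rw [abs_le]
      constructor <;> linarith [h4.1, h4.2]
    rw [this, mul_one, mul_comm]
    rfl
  · simp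

section Derivatives
variable {ρ u : SpaceTime → ℝ}

lemma IsTest.moll_integrable (h : IsTest univ ρ) (hu : Integrable u) (z : SpaceTime) :
    Integrable (fun w => ρ (z - w) * u w) := by
  obtain ⟨C, hC⟩ := h.exists_bound
  exact hu.bdd_mul (c := C) (h.smoothL.reflect z).continuous.aestronglyMeasurable
    (.of_forall fun w => hC _)

lemma pdt_moll (h : IsTest univ ρ) (hu : Integrable u) (z : SpaceTime) :
    pdt (moll ρ u) z = moll (pdt ρ) u z := by
  have h' := h.pdt ordConnected_univ
  obtain ⟨C, hC⟩ := h'.exists_bound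
  refine HasDerivAt.deriv ?_
  refine (hasDerivAt_integral_of_dominated_loc_of_deriv_le (s := univ)
    (F := fun s w => ρ ((s, z.2) - w) * u w) (F' := fun s w => pdt ρ ((s, z.2) - w) * u w)
    (bound := fun w => C * ‖u w‖) univ_mem ?_ (h.moll_integrable hu z) ?_ ?_ ?_ ?_).2
  · exact .of_forall fun s => (h.moll_integrable hu (s, z.2)).aestronglyMeasurable
  · exact (h'.moll_integrable hu z).aestronglyMeasurable
  · refine .of_forall fun w s _ => ?_
    rw [norm_mul]
    exact mul_le_mul_of_nonneg_right (hC _) (norm_nonneg _)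
  · exact hu.norm.const_mul C
  · refine .of_forall fun w s _ => ?_
    refine HasDerivAt.mul_const ?_ _
    have h1 := h.smoothL.hasDerivAt_t ((s, z.2) - w)
    have h2 : HasDerivAt (fun s : ℝ => s - w.1) 1 s := (hasDerivAt_id s).sub_const w.1
    have := HasDerivAt.comp s (h₂ := fun s : ℝ => ρ (s, ((s, z.2) - w).2)) (h₂' := pdt ρ ((s, z.2) - w))
      (h := fun s : ℝ => s - w.1) h1 h2
    rw [mul_one] at this
    exact this

lemma pdx_moll (h : IsTest univ ρ) (hu : Integrable u) (z : SpaceTime) :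
    pdx (moll ρ u) z = moll (pdx ρ) u z := by
  have h' := h.pdx ordConnected_univ
  obtain ⟨C, hC⟩ := h'.exists_bound
  refine HasDerivAt.deriv ?_
  have key := (hasDerivAt_integral_of_dominated_loc_of_deriv_le (𝕜 := ℝ) (s := univ) (x₀ := (0 : ℝ))
    (F := fun s w => ρ ((z.1, z.2 + (s : UnitAddCircle)) - w) * u w)
    (F' := fun s w => pdx ρ ((z.1, z.2 + (s : UnitAddCircle)) - w) * u w)
    (bound := fun w => C * ‖u w‖) (μ := volume) univ_mem ?_
    (h.moll_integrable hu _) ?_ ?_ ?_ ?_).2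
  · simpa [moll] using key
  · exact .of_forall fun s => (h.moll_integrable hu _).aestronglyMeasurable
  · exact (h'.moll_integrable hu _).aestronglyMeasurable
  · refine .of_forall fun w s _ => ?_
    rw [norm_mul]
    exact mul_le_mul_of_nonneg_right (hC _) (norm_nonneg _)
  · exact hu.norm.const_mul C
  · refine .of_forall fun w s _ => ?_
    refine HasDerivAt.mul_const ?_ _
    have h1 := h.smoothL.hasDerivAt_x ((z.1, z.2 + (s : UnitAddCircle)) - w)
    have h2 : HasDerivAt (fun r : ℝ => r - s) 1 s := (hasDerivAt_id s).sub_const s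
    rw [← sub_self s] at h1
    have := HasDerivAt.comp s (h := fun r : ℝ => r - s) h1 h2
    rw [mul_one] at this
    refine this.congr_of_eventuallyEq (.of_forall fun r => ?_)
    simp only [Function.comp_def]
    congr 1
    ext1
    · rfl
    · simp only [Prod.snd_sub, AddCircle.coe_sub]; abel

end Derivatives

/-- `u` is integrable on `ℝ × T¹` with integrable distributional derivatives `a = ∂_t u` and
`b = ∂_θ u`. -/
structure WeakGrad (u a b : SpaceTime → ℝ) : Prop where
  int : Integrable u
  int_t : Integrable a
  int_x : Integrable b
  dt : ∀ φ, IsTest univ φ → ∫ z, u z * pdt φ z = - ∫ z, a z * φ z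
  dx : ∀ φ, IsTest univ φ → ∫ z, u z * pdx φ z = - ∫ z, b z * φ z

lemma IsTest.reflect {ρ : SpaceTime → ℝ} (h : IsTest univ ρ) (z : SpaceTime) :
    IsTest univ (fun w => ρ (z - w)) := by
  rcases h.exists_Icc ordConnected_univ with rfl | ⟨a, b, -, -, h0⟩
  · exact h
  · refine (h.smoothL.reflect z).isTest (isCompact_Icc (a := z.1 - b) (b := z.1 - a)) (by simp)
      fun w hw => h0 _ fun hc => hw ?_
    simp only [Prod.fst_sub, mem_Icc] at hc ⊢
    constructor <;> linarith [hc.1, hc.2]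

namespace WeakGrad
variable {u a b ρ : SpaceTime → ℝ}

lemma pdt_moll (h : WeakGrad u a b) (hρ : IsTest univ ρ) (z : SpaceTime) :
    pdt (moll ρ u) z = moll ρ a z := by
  have := h.dt _ (hρ.reflect z)
  rw [Gowdy.pdt_moll hρ h.int, moll, moll]
  simp only [hρ.smoothL.pdt_reflect, mul_neg, integral_neg, neg_inj] at this
  simpa [mul_comm] using this

lemma pdx_moll (h : WeakGrad u a b) (hρ : IsTest univ ρ) (z : SpaceTime) :
    pdx (moll ρ u) z = moll ρ b z := by
  have := h.dx _ (hρ.reflect z)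
  rw [Gowdy.pdx_moll hρ h.int, moll, moll]
  simp only [hρ.smoothL.pdx_reflect, mul_neg, integral_neg, neg_inj] at this
  simpa [mul_comm] using this

end WeakGrad

/-! ### Mollification and translation in `L²` -/

lemma eLpNorm_two_sq {α : Type*} [MeasurableSpace α] (f : α → ℝ) (μ : Measure α) :
    eLpNorm f 2 μ ^ 2 = ∫⁻ x, ‖f x‖ₑ ^ 2 ∂μ := by
  have := eLpNorm_nnreal_pow_eq_lintegral (f := f) (μ := μ) (p := 2) (by norm_num)
  simpa using this

lemma eLpNorm_two_le {α : Type*} [MeasurableSpace α] {f : α → ℝ} {μ : Measure α} {c : ℝ≥0∞}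
    (h : ∫⁻ x, ‖f x‖ₑ ^ 2 ∂μ ≤ c ^ 2) : eLpNorm f 2 μ ≤ c := by
  rw [← eLpNorm_two_sq] at h
  exact (ENNReal.pow_le_pow_left_iff (by norm_num)).1 h

lemma sq_lintegral_le {α : Type*} [MeasurableSpace α] {μ : Measure α} {f : α → ℝ≥0∞}
    (hf : AEMeasurable f μ) : (∫⁻ x, f x ∂μ) ^ 2 ≤ μ univ * ∫⁻ x, f x ^ 2 ∂μ := by
  have h := ENNReal.lintegral_mul_le_Lp_mul_Lq μ Real.HolderConjugate.two_two
    (f := fun _ => 1) (g := f) aemeasurable_const hf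
  simp only [Pi.mul_apply, one_mul, ENNReal.one_rpow, lintegral_const] at h
  calc (∫⁻ x, f x ∂μ) ^ 2 ≤ (μ univ ^ (1 / 2 : ℝ) * (∫⁻ x, f x ^ (2 : ℝ) ∂μ) ^ (1 / 2 : ℝ)) ^ 2 := by
        gcongr
    _ = _ := by
        rw [mul_pow, ← ENNReal.rpow_natCast, ← ENNReal.rpow_natCast, ← ENNReal.rpow_mul,
          ← ENNReal.rpow_mul]
        norm_num

lemma IsKernel.lintegral {δ : ℝ} {ρ : SpaceTime → ℝ} (h : IsKernel δ ρ) :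
    ∫⁻ z, ENNReal.ofReal (ρ z) = 1 := by
  rw [← ofReal_integral_eq_lintegral_ofReal h.isTest.integrable (.of_forall h.nonneg), h.integral,
    ENNReal.ofReal_one]

lemma IsKernel.integrable_mul {δ : ℝ} {ρ g : SpaceTime → ℝ} (h : IsKernel δ ρ) (hg : Integrable g)
    (z : SpaceTime) : Integrable (fun w => ρ w * g (z - w)) := by
  obtain ⟨C, hC⟩ := h.isTest.exists_bound
  exact (hg.comp_sub_left z).bdd_mul (c := C) h.smooth.continuous.aestronglyMeasurable
    (.of_forall fun w => hC _)

lemma aestronglyMeasurable_sub {g : SpaceTime → ℝ} (hg : AEStronglyMeasurable g) :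
    AEStronglyMeasurable (fun p : SpaceTime × SpaceTime => g (p.1 - p.2) - g p.1)
      (volume.prod volume) :=
  (hg.comp_quasiMeasurePreserving (quasiMeasurePreserving_sub volume volume)).sub
    (hg.comp_quasiMeasurePreserving Measure.quasiMeasurePreserving_fst)

/-- Mollification moves a function no more, in `L²`, than the translations by the elements of the
support of the kernel do. -/
lemma IsKernel.eLpNorm_moll_sub_le {δ : ℝ} {ρ g : SpaceTime → ℝ} (h : IsKernel δ ρ)
    (hg : Integrable g) {c : ℝ≥0∞}
    (hc : ∀ w : SpaceTime, ρ w ≠ 0 → eLpNorm (fun z => g (z - w) - g z) 2 volume ≤ c) :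
    eLpNorm (fun z => moll ρ g z - g z) 2 volume ≤ c := by
  apply eLpNorm_two_le
  have hρm : Measurable (fun w => ENNReal.ofReal (ρ w)) :=
    h.smooth.continuous.measurable.ennreal_ofReal
  have hm := aestronglyMeasurable_sub hg.aestronglyMeasurable
  set ν : Measure SpaceTime := volume.withDensity (fun w => ENNReal.ofReal (ρ w)) with hν
  have hν1 : ν univ = 1 := by rw [hν, withDensity_apply _ MeasurableSet.univ]; simpa using h.lintegral
  have hac : ν ≪ volume := withDensity_absolutelyContinuous _ _
  have : SFinite ν := by rw [hν]; infer_instance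
  have h1 : ∀ z, ‖moll ρ g z - g z‖ₑ ^ 2 ≤ ∫⁻ w, ‖g (z - w) - g z‖ₑ ^ 2 ∂ν := by
    intro z
    have hgz : AEStronglyMeasurable (fun w => g (z - w) - g z) volume :=
      (hg.comp_sub_left z).aestronglyMeasurable.sub aestronglyMeasurable_const
    have e : moll ρ g z - g z = ∫ w, ρ w * (g (z - w) - g z) := by
      simp_rw [mul_sub]
      rw [integral_sub (h.integrable_mul hg z) (h.isTest.integrable.mul_const _),
        integral_mul_const, h.integral, one_mul, moll_eq]
    have h2 : ‖moll ρ g z - g z‖ₑ ≤ ∫⁻ w, ‖g (z - w) - g z‖ₑ ∂ν := by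
      rw [e, hν, lintegral_withDensity_eq_lintegral_mul₀ hρm.aemeasurable hgz.enorm]
      refine (enorm_integral_le_lintegral_enorm _).trans (le_of_eq ?_)
      congr 1; funext w
      rw [enorm_mul, Real.enorm_eq_ofReal (h.nonneg w)]; rfl
    calc ‖moll ρ g z - g z‖ₑ ^ 2 ≤ (∫⁻ w, ‖g (z - w) - g z‖ₑ ∂ν) ^ 2 := by gcongr
      _ ≤ ν univ * ∫⁻ w, ‖g (z - w) - g z‖ₑ ^ 2 ∂ν :=
          sq_lintegral_le (hgz.mono_ac hac).enorm
      _ = _ := by rw [hν1, one_mul]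
  have hm' : AEMeasurable (fun p : SpaceTime × SpaceTime => ‖g (p.1 - p.2) - g p.1‖ₑ ^ 2)
      (volume.prod ν) :=
    ((hm.mono_ac (Measure.AbsolutelyContinuous.rfl.prod hac)).enorm.pow_const 2)
  calc ∫⁻ z, ‖moll ρ g z - g z‖ₑ ^ 2 ≤ ∫⁻ z, ∫⁻ w, ‖g (z - w) - g z‖ₑ ^ 2 ∂ν := lintegral_mono h1
    _ = ∫⁻ w, (∫⁻ z, ‖g (z - w) - g z‖ₑ ^ 2) ∂ν := by rw [lintegral_lintegral_swap hm']
    _ ≤ ∫⁻ _, c ^ 2 ∂ν := by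
        rw [hν]
        refine lintegral_mono_ae ?_
        rw [ae_withDensity_iff hρm]
        refine .of_forall fun w hw => ?_
        rw [← eLpNorm_two_sq]
        gcongr
        refine hc w fun h0 => hw ?_
        simp [h0]
    _ = c ^ 2 := by rw [lintegral_const, hν1, mul_one]

/-- Translations are continuous in `L²`. -/
lemma tendsto_eLpNorm_translate {g : SpaceTime → ℝ} (hg : MemLp g 2 volume) :
    Tendsto (fun w : SpaceTime => eLpNorm (fun z => g (z - w) - g z) 2 volume) (𝓝 0) (𝓝 0) := by
  have hp : ∀ w : SpaceTime, MeasurePreserving (fun z : SpaceTime => z - w) volume volume :=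
    fun w => measurePreserving_sub_right volume w
  let τ : C(SpaceTime, C(SpaceTime, SpaceTime)) :=
    ContinuousMap.curry ⟨fun q : SpaceTime × SpaceTime => q.2 - q.1, by fun_prop⟩
  have h1 : Tendsto (fun w => Lp.compMeasurePreserving (τ w) (hp w) hg.toLp) (𝓝 0)
      (𝓝 (Lp.compMeasurePreserving (τ 0) (hp 0) hg.toLp)) :=
    Tendsto.compMeasurePreservingLp tendsto_const_nhds (τ.continuous.tendsto 0) hp (hp 0) (by simp)
  rw [tendsto_iff_edist_tendsto_0] at h1
  refine h1.congr fun w => ?_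
  rw [Lp.edist_def]
  refine eLpNorm_congr_ae ?_
  have e1 : ∀ w, (Lp.compMeasurePreserving (τ w) (hp w) hg.toLp : SpaceTime → ℝ) =ᵐ[volume]
      fun z => g (z - w) := fun w =>
    (Lp.coeFn_compMeasurePreserving _ (hp w)).trans
      ((hp w).quasiMeasurePreserving.ae_eq_comp hg.coeFn_toLp)
  filter_upwards [e1 w, e1 0] with z h2 h3
  simp [h2, h3]

/-- A sequence of kernels with supports shrinking to the origin. -/
lemma exists_kernel_seq : ∃ ρ : ℕ → SpaceTime → ℝ, ∀ j : ℕ, IsKernel (1 / (j + 1)) (ρ j) :=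
  ⟨fun j => (exists_isKernel (δ := 1 / ((j : ℝ) + 1)) (by positivity)).choose,
    fun j => (exists_isKernel (δ := 1 / ((j : ℝ) + 1)) (by positivity)).choose_spec⟩

lemma tendsto_moll {ρ : ℕ → SpaceTime → ℝ} (hρ : ∀ j : ℕ, IsKernel (1 / (j + 1)) (ρ j))
    {g : SpaceTime → ℝ} (hg : MemLp g 2 volume) (hg' : Integrable g) :
    Tendsto (fun j => eLpNorm (fun z => moll (ρ j) g z - g z) 2 volume) atTop (𝓝 0) := by
  rw [ENNReal.tendsto_nhds_zero]
  intro ε hε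
  have h1 := (ENNReal.tendsto_nhds_zero.1 (tendsto_eLpNorm_translate hg)) ε hε
  obtain ⟨δ, hδ, h2⟩ := Metric.eventually_nhds_iff.1 h1
  have h3 : ∀ᶠ j : ℕ in atTop, 1 / ((j : ℝ) + 1) < δ :=
    tendsto_one_div_add_atTop_nhds_zero_nat.eventually_lt_const hδ
  filter_upwards [h3] with j hj
  refine (hρ j).eLpNorm_moll_sub_le hg' fun w hw => h2 ?_
  obtain ⟨h4, h5⟩ := (hρ j).supp w hw
  rw [dist_zero_right, Prod.norm_def]
  exact (max_le h4 h5).trans_lt hj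

/-- Convergence in `L²` gives convergence almost everywhere of a subsequence. -/
lemma exists_subseq_ae {α : Type*} [MeasurableSpace α] {μ : Measure α} {f : ℕ → α → ℝ} {g : α → ℝ}
    (hf : ∀ n, AEStronglyMeasurable (f n) μ) (hg : AEStronglyMeasurable g μ)
    (h : Tendsto (fun n => eLpNorm (fun z => f n z - g z) 2 μ) atTop (𝓝 0)) :
    ∃ k : ℕ → ℕ, StrictMono k ∧ ∀ᵐ z ∂μ, Tendsto (fun n => f (k n) z) atTop (𝓝 (g z)) :=
  (tendstoInMeasure_of_tendsto_eLpNorm (by norm_num) hf hg h).exists_seq_tendsto_ae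

/-- Difference quotients of a smooth function, in the direction of a one-parameter group, are bounded
in `L²` by the derivative. -/
lemma eLpNorm_shift_le {v d : SpaceTime → ℝ} {τ : ℝ → SpaceTime} (hτ : Continuous τ) (h0 : τ 0 = 0)
    (hd : Continuous d)
    (h : ∀ z r, HasDerivAt (fun r => v (z + τ r)) (d (z + τ r)) r) (s : ℝ) :
    eLpNorm (fun z => v (z + τ s) - v z) 2 volume ≤ ‖s‖ₑ * eLpNorm d 2 volume := by
  apply eLpNorm_two_le
  set ν : Measure ℝ := volume.restrict (uIoc 0 s) with hν
  have hν1 : ν univ = ‖s‖ₑ := by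
    rw [hν, Measure.restrict_apply_univ, uIoc, Real.volume_Ioc, max_sub_min_eq_abs, sub_zero,
      Real.enorm_eq_ofReal_abs]
  have hcont : ∀ z, Continuous fun r => d (z + τ r) := fun z => by fun_prop
  have h1 : ∀ z, ‖v (z + τ s) - v z‖ₑ ^ 2 ≤ ‖s‖ₑ * ∫⁻ r, ‖d (z + τ r)‖ₑ ^ 2 ∂ν := by
    intro z
    have e : v (z + τ s) - v z = ∫ r in (0 : ℝ)..s, d (z + τ r) := by
      rw [intervalIntegral.integral_eq_sub_of_hasDerivAt (fun r _ => h z r)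
        ((hcont z).intervalIntegrable _ _), h0, add_zero]
    have h2 : ‖v (z + τ s) - v z‖ₑ ≤ ∫⁻ r, ‖d (z + τ r)‖ₑ ∂ν := by
      have h3 := intervalIntegral.norm_intervalIntegral_eq (fun r => d (z + τ r)) 0 s volume
      rw [e, ← enorm_norm, h3, enorm_norm]
      exact enorm_integral_le_lintegral_enorm _
    calc ‖v (z + τ s) - v z‖ₑ ^ 2 ≤ (∫⁻ r, ‖d (z + τ r)‖ₑ ∂ν) ^ 2 := by gcongr
      _ ≤ ν univ * ∫⁻ r, ‖d (z + τ r)‖ₑ ^ 2 ∂ν :=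
          sq_lintegral_le (hcont z).measurable.enorm.aemeasurable
      _ = _ := by rw [hν1]
  have hm : Measurable (fun p : SpaceTime × ℝ => ‖d (p.1 + τ p.2)‖ₑ ^ 2) := by
    have : Continuous (fun p : SpaceTime × ℝ => d (p.1 + τ p.2)) := by fun_prop
    exact this.measurable.enorm.pow_const 2
  calc ∫⁻ z, ‖v (z + τ s) - v z‖ₑ ^ 2 ≤ ∫⁻ z, ‖s‖ₑ * ∫⁻ r, ‖d (z + τ r)‖ₑ ^ 2 ∂ν := lintegral_mono h1
    _ = ‖s‖ₑ * ∫⁻ z, ∫⁻ r, ‖d (z + τ r)‖ₑ ^ 2 ∂ν := by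
        rw [lintegral_const_mul' _ _ (by simp)]
    _ = ‖s‖ₑ * ∫⁻ r, (∫⁻ z, ‖d (z + τ r)‖ₑ ^ 2) ∂ν := by
        rw [lintegral_lintegral_swap hm.aemeasurable]
    _ = ‖s‖ₑ * ∫⁻ r, eLpNorm d 2 volume ^ 2 ∂ν := by
        congr 2; funext r
        rw [eLpNorm_two_sq]
        exact lintegral_add_right_eq_self (fun z => ‖d z‖ₑ ^ 2) (τ r)
    _ = _ := by rw [lintegral_const, hν1]; ring

/-- The translation is split into one in time and one, by a representative of least absolute value, in
space. -/
lemma SmoothL.eLpNorm_translate_le {v : SpaceTime → ℝ} (h : SmoothL v) (w : SpaceTime) {δ : ℝ}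
    (h1 : |w.1| ≤ δ) (h2 : ‖w.2‖ ≤ δ) :
    eLpNorm (fun z => v (z - w) - v z) 2 volume
      ≤ ENNReal.ofReal δ * (eLpNorm (Gowdy.pdt v) 2 volume + eLpNorm (Gowdy.pdx v) 2 volume) := by
  obtain ⟨x, hx, hxn⟩ : ∃ x : ℝ, (x : UnitAddCircle) = w.2 ∧ |x| ≤ δ := by
    obtain ⟨y, hy⟩ := QuotientAddGroup.mk_surjective w.2
    refine ⟨y - round y, ?_, ?_⟩
    · rw [← hy, AddCircle.coe_sub]
      have : ((round y : ℝ) : UnitAddCircle) = 0 :=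
        (AddCircle.coe_eq_zero_iff 1).2 ⟨round y, by simp⟩
      rw [this, sub_zero]
    · rw [← UnitAddCircle.norm_eq]
      rw [hy]; exact h2
  have key : ∀ s : ℝ, |s| ≤ δ → ‖-s‖ₑ ≤ ENNReal.ofReal δ := fun s hs => by
    rw [enorm_neg, Real.enorm_eq_ofReal_abs]; exact ENNReal.ofReal_le_ofReal hs
  have ht := eLpNorm_shift_le (v := v) (d := Gowdy.pdt v) (τ := fun r => (r, 0)) (by fun_prop) rfl
    h.pdt.continuous (fun z r => by
      have a1 := h.hasDerivAt_t (z + (r, 0))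
      have a2 : HasDerivAt (fun r : ℝ => z.1 + r) 1 r := by
        simpa using (hasDerivAt_id r).const_add z.1
      have := HasDerivAt.comp r (h := fun r : ℝ => z.1 + r) a1 a2
      rw [mul_one] at this
      exact this.congr_of_eventuallyEq (.of_forall fun s => by
        simp [Prod.add_def])) (-w.1)
  have hx' := eLpNorm_shift_le (v := v) (d := Gowdy.pdx v)
    (τ := fun r => (0, (r : UnitAddCircle))) (by
      have : Continuous (fun r : ℝ => (r : UnitAddCircle)) := AddCircle.continuous_mk' 1
      fun_prop) rfl
    h.pdx.continuous (fun z r => by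
      have a1 := h.hasDerivAt_x (z + (0, (r : UnitAddCircle)))
      have a2 : HasDerivAt (fun s : ℝ => s - r) 1 r := (hasDerivAt_id r).sub_const r
      have a3 : HasDerivAt (fun s : ℝ => v ((z + (0, (r : UnitAddCircle))).1,
          (z + (0, (r : UnitAddCircle))).2 + (s : UnitAddCircle)))
          (Gowdy.pdx v (z + (0, (r : UnitAddCircle)))) (r - r) := by
        rw [sub_self]; exact a1
      have := HasDerivAt.comp r (h := fun s : ℝ => s - r) a3 a2
      rw [mul_one] at this
      refine this.congr_of_eventuallyEq (.of_forall fun s => ?_)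
      simp only [Function.comp_def]
      congr 1
      ext1
      · simp
      · simp only [Prod.snd_add, AddCircle.coe_sub]; abel) (-x)
  have hmp : MeasurePreserving (fun z : SpaceTime => z + (-w.1, 0)) volume volume :=
    measurePreserving_add_right volume _
  have hm2 : AEStronglyMeasurable
      (fun z : SpaceTime => v (z + (0, ((-x : ℝ) : UnitAddCircle))) - v z) volume := by
    have := h.continuous
    exact Continuous.aestronglyMeasurable (by fun_prop)
  have hm1 : AEStronglyMeasurable (fun z : SpaceTime => v (z + (-w.1, 0)) - v z) volume := by
    have := h.continuous
    exact Continuous.aestronglyMeasurable (by fun_prop)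
  have e : (fun z => v (z - w) - v z) =
      (fun z => (fun z => v (z + (0, ((-x : ℝ) : UnitAddCircle))) - v z) (z + (-w.1, 0)))
        + fun z => v (z + (-w.1, 0)) - v z := by
    funext z
    simp only [Pi.add_apply, sub_add_sub_cancel]
    congr 2
    rw [AddCircle.coe_neg, hx]
    ext1 <;> simp [sub_eq_add_neg]
  rw [e]
  refine (eLpNorm_add_le (hm2.comp_measurePreserving hmp) hm1 (by norm_num)).trans ?_
  have e2 := eLpNorm_comp_measurePreserving (p := 2) hm2 hmp
  rw [e2, mul_add, add_comm]
  exact add_le_add (ht.trans (by gcongr; exact key _ h1)) (hx'.trans (by gcongr; exact key _ hxn))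

/-- Translations move a function with derivatives in `L²` by at most the length of the translation
times the norm of the derivatives. -/
lemma WeakGrad.eLpNorm_translate_le {u a b : SpaceTime → ℝ} (h : WeakGrad u a b)
    (hu : MemLp u 2 volume) (ha : MemLp a 2 volume) (hb : MemLp b 2 volume) (w : SpaceTime) {δ : ℝ}
    (h1 : |w.1| ≤ δ) (h2 : ‖w.2‖ ≤ δ) :
    eLpNorm (fun z => u (z - w) - u z) 2 volume
      ≤ ENNReal.ofReal δ * (eLpNorm a 2 volume + eLpNorm b 2 volume) := by
  obtain ⟨ρ, hρ⟩ := exists_kernel_seq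
  have hmp : MeasurePreserving (fun z : SpaceTime => z - w) volume volume :=
    measurePreserving_sub_right volume w
  have hsm : ∀ {g : SpaceTime → ℝ} (_ : Integrable g) j,
      AEStronglyMeasurable (moll (ρ j) g) volume := fun hg j =>
    (SmoothL.moll (hρ j).isTest hg).continuous.aestronglyMeasurable
  set E : (SpaceTime → ℝ) → ℕ → ℝ≥0∞ :=
    fun g j => eLpNorm (fun z => moll (ρ j) g z - g z) 2 volume with hE
  have hn : ∀ {g : SpaceTime → ℝ} (_ : Integrable g) j,
      eLpNorm (moll (ρ j) g) 2 volume ≤ E g j + eLpNorm g 2 volume := fun {g} hg j => by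
    have : moll (ρ j) g = (fun z => moll (ρ j) g z - g z) + g := by funext z; simp
    calc eLpNorm (moll (ρ j) g) 2 volume
        = eLpNorm ((fun z => moll (ρ j) g z - g z) + g) 2 volume := by rw [← this]
      _ ≤ _ := eLpNorm_add_le ((hsm hg j).sub hg.aestronglyMeasurable) hg.aestronglyMeasurable
          (by norm_num)
  have key : ∀ j, eLpNorm (fun z => u (z - w) - u z) 2 volume ≤
      E u j + ENNReal.ofReal δ * ((E a j + eLpNorm a 2 volume) + (E b j + eLpNorm b 2 volume))
        + E u j := by
    intro j
    have hv := SmoothL.moll (hρ j).isTest h.int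
    have h3 := hv.eLpNorm_translate_le w h1 h2
    have e1 : Gowdy.pdt (moll (ρ j) u) = moll (ρ j) a := funext fun z => h.pdt_moll (hρ j).isTest z
    have e2 : Gowdy.pdx (moll (ρ j) u) = moll (ρ j) b := funext fun z => h.pdx_moll (hρ j).isTest z
    rw [e1, e2] at h3
    have m1 : AEStronglyMeasurable (fun z => moll (ρ j) u z - u z) volume :=
      (hsm h.int j).sub h.int.aestronglyMeasurable
    have m1' : AEStronglyMeasurable (fun z => u z - moll (ρ j) u z) volume :=
      h.int.aestronglyMeasurable.sub (hsm h.int j)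
    have m2 : AEStronglyMeasurable (fun z => moll (ρ j) u (z - w) - moll (ρ j) u z) volume :=
      ((hsm h.int j).comp_measurePreserving hmp).sub (hsm h.int j)
    have e3 : (fun z => u (z - w) - u z) = ((fun z => (fun z => u z - moll (ρ j) u z) (z - w))
        + fun z => moll (ρ j) u (z - w) - moll (ρ j) u z)
        + fun z => moll (ρ j) u z - u z := by
      funext z; simp
    have e4 := eLpNorm_comp_measurePreserving (p := 2) m1' hmp
    have e5 : eLpNorm (fun z => u z - moll (ρ j) u z) 2 volume = E u j := by
      rw [hE, ← eLpNorm_neg]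
      congr 1; funext z; simp
    rw [e3]
    refine (eLpNorm_add_le ((m1'.comp_measurePreserving hmp).add m2) m1 (by norm_num)).trans ?_
    gcongr
    refine (eLpNorm_add_le (m1'.comp_measurePreserving hmp) m2 (by norm_num)).trans ?_
    rw [e4, e5]
    gcongr
    refine h3.trans ?_
    gcongr
    · exact hn h.int_t j
    · exact hn h.int_x j
  refine ge_of_tendsto' (x := atTop) ?_ key
  have t1 := tendsto_moll hρ hu h.int
  have t2 := tendsto_moll hρ ha h.int_t
  have t3 := tendsto_moll hρ hb h.int_x
  have := (t1.add (ENNReal.Tendsto.const_mul ((t2.add_const (eLpNorm a 2 volume)).add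
    (t3.add_const (eLpNorm b 2 volume))) (Or.inr (ENNReal.ofReal_ne_top (r := δ))))).add t1
  simpa using this

/-- Mollification error of a function with derivatives in `L²`. -/
lemma WeakGrad.eLpNorm_moll_sub_le {u a b ρ : SpaceTime → ℝ} (h : WeakGrad u a b)
    (hu : MemLp u 2 volume) (ha : MemLp a 2 volume) (hb : MemLp b 2 volume) {δ : ℝ}
    (hρ : IsKernel δ ρ) :
    eLpNorm (fun z => moll ρ u z - u z) 2 volume
      ≤ ENNReal.ofReal δ * (eLpNorm a 2 volume + eLpNorm b 2 volume) :=
  hρ.eLpNorm_moll_sub_le h.int fun w hw =>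
    h.eLpNorm_translate_le hu ha hb w (hρ.supp w hw).1 (hρ.supp w hw).2

/-! ### Mixed norms, cut-offs in time and bounds in `L^∞` -/

instance : IsProbabilityMeasure (volume : Measure UnitAddCircle) := ⟨UnitAddCircle.measure_univ⟩

lemma restrict_slab (J : Set ℝ) :
    (volume.restrict (slab J) : Measure SpaceTime) = (volume.restrict J).prod volume := by
  rw [slab, Measure.volume_eq_prod, ← Measure.prod_restrict, Measure.restrict_univ]

lemma mixedNorm_mono {J K : Set ℝ} (h : J ⊆ K) (p : ℝ≥0∞) (u : SpaceTime → ℝ) :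
    mixedNorm J p u ≤ mixedNorm K p u :=
  essSup_mono_measure' (Measure.restrict_mono_set _ h)

lemma ae_eLpNorm_le_mixedNorm (J : Set ℝ) (p : ℝ≥0∞) (u : SpaceTime → ℝ) :
    ∀ᵐ t ∂(volume.restrict J), eLpNorm (fun θ : UnitAddCircle => u (t, θ)) p volume
      ≤ mixedNorm J p u := ae_le_essSup

/-- The `L²` norm over a slab is controlled by the mixed norm. -/
lemma lintegral_slab_sq_le {J : Set ℝ} {u : SpaceTime → ℝ}
    (hu : AEStronglyMeasurable u (volume.restrict (slab J))) :
    ∫⁻ z in slab J, ‖u z‖ₑ ^ 2 ≤ mixedNorm J 2 u ^ 2 * volume J := by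
  rw [restrict_slab] at hu ⊢
  rw [lintegral_prod _ (hu.enorm.pow_const 2)]
  calc ∫⁻ t in J, ∫⁻ θ, ‖u (t, θ)‖ₑ ^ 2 ≤ ∫⁻ t in J, mixedNorm J 2 u ^ 2 := by
        refine lintegral_mono_ae ?_
        filter_upwards [ae_eLpNorm_le_mixedNorm J 2 u] with t ht
        rw [← eLpNorm_two_sq]
        gcongr
    _ = _ := by rw [lintegral_const, Measure.restrict_apply_univ]

lemma memLp_slab {J : Set ℝ} {u : SpaceTime → ℝ}
    (hu : AEStronglyMeasurable u (volume.restrict (slab J))) (h : mixedNorm J 2 u < ⊤)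
    (hJ : volume J < ⊤) : MemLp u 2 (volume.restrict (slab J)) := by
  refine ⟨hu, ?_⟩
  have h1 := lintegral_slab_sq_le hu
  rw [← eLpNorm_two_sq] at h1
  have h2 : eLpNorm u 2 (volume.restrict (slab J)) ^ 2 < ⊤ :=
    h1.trans_lt (ENNReal.mul_lt_top (ENNReal.pow_lt_top h) hJ)
  exact (ENNReal.pow_lt_top_iff.1 h2).resolve_right (by norm_num)

lemma LinfLoc.memLp {I : Set ℝ} {u : SpaceTime → ℝ} (h : LinfLoc I 2 u) {a b : ℝ}
    (hab : Icc a b ⊆ I) : MemLp u 2 (volume.restrict (slab (Icc a b))) :=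
  memLp_slab (h.meas.mono_measure (Measure.restrict_mono_set _ (slab_mono hab)))
    (h.bound _ isCompact_Icc hab) (by simp)

instance isFiniteMeasure_slab (a b : ℝ) :
    IsFiniteMeasure ((volume : Measure SpaceTime).restrict (slab (Icc a b))) :=
  ⟨by rw [Measure.restrict_apply_univ]; exact (isCompact_slab isCompact_Icc).measure_lt_top⟩

/-- A function supported in a slab has the integrability that it has on that slab. -/
lemma memLp_of_slab {a b : ℝ} {u : SpaceTime → ℝ} {p : ℝ≥0∞}
    (h0 : ∀ z : SpaceTime, z.1 ∉ Icc a b → u z = 0)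
    (hu : MemLp u p (volume.restrict (slab (Icc a b)))) : MemLp u p volume := by
  have : (slab (Icc a b)).indicator u = u :=
    indicator_eq_self.2 fun z hz => mem_slab.2 (by_contra fun hc => hz (h0 z hc))
  rw [← this, memLp_indicator_iff_restrict (measurableSet_slab measurableSet_Icc)]
  exact hu

lemma integrable_of_slab {a b : ℝ} {u : SpaceTime → ℝ}
    (h0 : ∀ z : SpaceTime, z.1 ∉ Icc a b → u z = 0) (hu : MemLp u 2 volume) :
    Integrable u := by
  rw [← memLp_one_iff_integrable]
  exact memLp_of_slab h0 ((hu.restrict _).mono_exponent (by norm_num))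

/-- The Sobolev inequality on circles for smooth functions: average the fundamental theorem of calculus
over one period. -/
lemma SmoothL.enorm_le {v : SpaceTime → ℝ} (h : SmoothL v) (z : SpaceTime) :
    ‖v z‖ₑ ≤ (∫⁻ y, ‖v (z.1, y)‖ₑ) + ∫⁻ y, ‖Gowdy.pdx v (z.1, y)‖ₑ := by
  obtain ⟨p, rfl⟩ := cover_surjective z
  obtain ⟨t, x⟩ := p
  have hc : Continuous fun s : ℝ => Gowdy.pdx v (t, (s : UnitAddCircle)) :=
    h.pdx.continuous.comp ((continuous_const).prodMk (AddCircle.continuous_mk' 1))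
  have key : ∀ y ∈ Ioc x (x + 1), ‖v (t, (x : UnitAddCircle))‖ₑ ≤ ‖v (t, (y : UnitAddCircle))‖ₑ
      + ∫⁻ s in Ioc x (x + 1), ‖Gowdy.pdx v (t, (s : UnitAddCircle))‖ₑ := by
    intro y hy
    have e : v (t, (y : UnitAddCircle)) - v (t, (x : UnitAddCircle))
        = ∫ s in x..y, Gowdy.pdx v (t, (s : UnitAddCircle)) :=
      (intervalIntegral.integral_eq_sub_of_hasDerivAt (f := fun s : ℝ => v (t, (s : UnitAddCircle)))
        (fun s _ => h.hasDerivAt_x_lift (t, s)) (hc.intervalIntegrable _ _)).symm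
    have e2 : v (t, (x : UnitAddCircle)) = v (t, (y : UnitAddCircle))
        - ∫ s in x..y, Gowdy.pdx v (t, (s : UnitAddCircle)) := by rw [← e]; ring
    rw [e2]
    refine (enorm_sub_le).trans ?_
    gcongr
    rw [intervalIntegral.integral_of_le hy.1.le]
    refine (enorm_integral_le_lintegral_enorm _).trans ?_
    exact lintegral_mono_set (Ioc_subset_Ioc_right hy.2)
  have h1 : ∫⁻ _ in Ioc x (x + 1), ‖v (t, (x : UnitAddCircle))‖ₑ ≤
      ∫⁻ y in Ioc x (x + 1), (‖v (t, (y : UnitAddCircle))‖ₑ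
      + ∫⁻ s in Ioc x (x + 1), ‖Gowdy.pdx v (t, (s : UnitAddCircle))‖ₑ) :=
    setLIntegral_mono' measurableSet_Ioc key
  have hvm : Measurable fun y : ℝ => ‖v (t, (y : UnitAddCircle))‖ₑ :=
    (h.continuous.comp ((continuous_const).prodMk (AddCircle.continuous_mk' 1))).measurable.enorm
  rw [lintegral_add_left hvm] at h1
  simp only [lintegral_const, Measure.restrict_apply_univ, Real.volume_Ioc, add_sub_cancel_left,
    ENNReal.ofReal_one, mul_one] at h1
  rw [UnitAddCircle.lintegral_preimage x (fun y => ‖v (t, y)‖ₑ),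
    UnitAddCircle.lintegral_preimage x (fun y => ‖Gowdy.pdx v (t, y)‖ₑ)] at h1
  exact h1

/-- Mollification does not increase the norm of `L^∞(L¹)`. -/
lemma IsKernel.lintegral_moll_le {δ : ℝ} {ρ g : SpaceTime → ℝ} (h : IsKernel δ ρ)
    (hg : Integrable g) {M : ℝ≥0∞} (hM : ∀ᵐ t : ℝ, ∫⁻ θ : UnitAddCircle, ‖g (t, θ)‖ₑ ≤ M) (t : ℝ) :
    ∫⁻ y, ‖moll ρ g (t, y)‖ₑ ≤ M := by
  obtain ⟨g', hg'm, hgg'⟩ := hg.aestronglyMeasurable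
  have e : moll ρ g = moll ρ g' := by
    funext z
    refine integral_congr_ae ?_
    filter_upwards [hgg'] with w hw
    rw [hw]
  have hM' : ∀ᵐ t : ℝ, ∫⁻ θ : UnitAddCircle, ‖g' (t, θ)‖ₑ ≤ M := by
    filter_upwards [hM, Measure.ae_ae_of_ae_prod hgg'] with t h1 h2
    refine (lintegral_congr_ae ?_).le.trans h1
    filter_upwards [h2] with θ hθ
    rw [hθ]
  rw [e]
  have hρm : Measurable (fun w => ENNReal.ofReal (ρ w)) :=
    h.smooth.continuous.measurable.ennreal_ofReal
  have h1 : ∀ y, ‖moll ρ g' (t, y)‖ₑ ≤ ∫⁻ w : SpaceTime, ENNReal.ofReal (ρ w) * ‖g' ((t, y) - w)‖ₑ := by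
    intro y
    rw [moll_eq]
    refine (enorm_integral_le_lintegral_enorm _).trans (le_of_eq ?_)
    congr 1; funext w
    rw [enorm_mul, Real.enorm_eq_ofReal (h.nonneg w)]
  have hm : Measurable (fun q : UnitAddCircle × SpaceTime =>
      ENNReal.ofReal (ρ q.2) * ‖g' ((t, q.1) - q.2)‖ₑ) := by
    refine (hρm.comp measurable_snd).mul (hg'm.measurable.comp ?_).enorm
    fun_prop
  have hae : ∀ᵐ w : SpaceTime, ∫⁻ θ : UnitAddCircle, ‖g' (t - w.1, θ)‖ₑ ≤ M := by
    have a1 : ∀ᵐ s : ℝ, ∫⁻ θ : UnitAddCircle, ‖g' (t - s, θ)‖ₑ ≤ M :=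
      (quasiMeasurePreserving_sub_left volume t).ae hM'
    exact Measure.quasiMeasurePreserving_fst.ae a1
  calc ∫⁻ y, ‖moll ρ g' (t, y)‖ₑ
      ≤ ∫⁻ y, ∫⁻ w : SpaceTime, ENNReal.ofReal (ρ w) * ‖g' ((t, y) - w)‖ₑ := lintegral_mono h1
    _ = ∫⁻ w : SpaceTime, ∫⁻ y, ENNReal.ofReal (ρ w) * ‖g' ((t, y) - w)‖ₑ :=
        lintegral_lintegral_swap hm.aemeasurable
    _ ≤ ∫⁻ w : SpaceTime, ENNReal.ofReal (ρ w) * M := by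
        refine lintegral_mono_ae ?_
        filter_upwards [hae] with w hw
        rw [lintegral_const_mul' _ _ ENNReal.ofReal_ne_top]
        gcongr
        refine le_trans (le_of_eq ?_) hw
        exact lintegral_sub_right_eq_self (fun y => ‖g' (t - w.1, y)‖ₑ) w.2
    _ = M := by rw [lintegral_mul_const _ hρm, h.lintegral, one_mul]

/-- The Sobolev inequality on circles, for functions with weak derivatives. -/
lemma WeakGrad.ae_enorm_le {u a b : SpaceTime → ℝ} (h : WeakGrad u a b) (hu : MemLp u 2 volume)
    {M N : ℝ≥0∞} (hM : ∀ᵐ t : ℝ, ∫⁻ θ : UnitAddCircle, ‖u (t, θ)‖ₑ ≤ M)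
    (hN : ∀ᵐ t : ℝ, ∫⁻ θ : UnitAddCircle, ‖b (t, θ)‖ₑ ≤ N) : ∀ᵐ z, ‖u z‖ₑ ≤ M + N := by
  obtain ⟨ρ, hρ⟩ := exists_kernel_seq
  have hs : ∀ j, SmoothL (moll (ρ j) u) := fun j => SmoothL.moll (hρ j).isTest h.int
  obtain ⟨k, -, hk⟩ := exists_subseq_ae (fun j => (hs j).continuous.aestronglyMeasurable)
    h.int.aestronglyMeasurable (tendsto_moll hρ hu h.int)
  filter_upwards [hk] with z hz
  refine le_of_tendsto' hz.enorm fun n => ((hs (k n)).enorm_le z).trans ?_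
  gcongr
  · exact (hρ _).lintegral_moll_le h.int hM _
  · have e : Gowdy.pdx (moll (ρ (k n)) u) = moll (ρ (k n)) b :=
      funext fun z => h.pdx_moll (hρ _).isTest z
    rw [e]
    exact (hρ _).lintegral_moll_le h.int_x hN _

lemma IsKernel.abs_moll_le {δ : ℝ} {ρ g : SpaceTime → ℝ} (h : IsKernel δ ρ)
    {C : ℝ} (hC : ∀ᵐ z, |g z| ≤ C) (z : SpaceTime) : |moll ρ g z| ≤ C := by
  have h1 : ∫ w, ρ (z - w) = 1 := by rw [integral_sub_left_eq_self ρ volume z, h.integral]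
  have hi : Integrable fun w => ρ (z - w) := (h.isTest.reflect z).integrable
  calc |moll ρ g z| ≤ ∫ w, ρ (z - w) * C := by
        refine norm_integral_le_of_norm_le (f := fun w => ρ (z - w) * g w) (hi.mul_const C) ?_
        filter_upwards [hC] with w hw
        rw [norm_mul, Real.norm_of_nonneg (h.nonneg _)]
        exact mul_le_mul_of_nonneg_left hw (h.nonneg _)
    _ = C := by rw [integral_mul_const, h1, one_mul]

section Cutoff

variable {I : Set ℝ} {u : Field} {a b a' b' : ℝ} {η : ℝ → ℝ}

lemma IsCutoff.deriv_eq_zero (h : IsCutoff I a b a' b' η) {t : ℝ} (ht : t ∉ Icc a' b') :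
    deriv η t = 0 := by
  have : η =ᶠ[𝓝 t] fun _ => 0 := by
    filter_upwards [isClosed_Icc.isOpen_compl.mem_nhds ht] with s hs using h.zero _ hs
  rw [this.deriv_eq]; simp

lemma IsCutoff.contDiff_deriv (h : IsCutoff I a b a' b' η) : ContDiff ℝ ∞ (deriv η) := by
  have := (contDiff_infty_iff_deriv (𝕜 := ℝ) (f := η)).1 h.smooth
  exact this.2

lemma IsCutoff.exists_deriv_bound (h : IsCutoff I a b a' b' η) : ∃ D, ∀ t, |deriv η t| ≤ D := by
  obtain ⟨D, hD⟩ := (isCompact_Icc (a := a') (b := b')).exists_bound_of_continuousOn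
    h.contDiff_deriv.continuous.continuousOn
  refine ⟨max D 0, fun t => ?_⟩
  by_cases ht : t ∈ Icc a' b'
  · exact (hD t ht).trans (le_max_left _ _)
  · rw [h.deriv_eq_zero ht]; simp

lemma IsCutoff.memLp (h : IsCutoff I a b a' b' η) {g : SpaceTime → ℝ} (hg : LinfLoc I 2 g) :
    MemLp (fun z => η z.1 * g z) 2 volume := by
  refine memLp_of_slab (a := a') (b := b') (fun z hz => by simp [h.zero _ hz]) ?_
  refine (hg.memLp (h.sub.trans interior_subset)).of_le_mul (c := 1) ?_ ?_
  · exact (h.smooth.continuous.comp continuous_fst).aestronglyMeasurable.mul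
      (hg.memLp (h.sub.trans interior_subset)).1
  · refine .of_forall fun z => ?_
    rw [norm_mul, one_mul, Real.norm_of_nonneg (h.range _).1]
    exact mul_le_of_le_one_left (norm_nonneg _) (h.range _).2

lemma IsCutoff.memLp_deriv (h : IsCutoff I a b a' b' η) {g : SpaceTime → ℝ} (hg : LinfLoc I 2 g) :
    MemLp (fun z => deriv η z.1 * g z) 2 volume := by
  obtain ⟨D, hD⟩ := h.exists_deriv_bound
  refine memLp_of_slab (a := a') (b := b') (fun z hz => by simp [h.deriv_eq_zero hz]) ?_
  refine (hg.memLp (h.sub.trans interior_subset)).of_le_mul (c := D) ?_ ?_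
  · exact (h.contDiff_deriv.continuous.comp continuous_fst).aestronglyMeasurable.mul
      (hg.memLp (h.sub.trans interior_subset)).1
  · refine .of_forall fun z => ?_
    rw [norm_mul]
    exact mul_le_mul_of_nonneg_right (hD _) (norm_nonneg _)

lemma IsCutoff.memLp_dt (h : IsCutoff I a b a' b' η) (hu : IsRegular I 2 u) :
    MemLp (fun z => η z.1 * u.dt z + deriv η z.1 * u.val z) 2 volume :=
  (h.memLp hu.dt_mem).add (h.memLp_deriv hu.val_mem)

lemma integral_slab_restrict {g φ : SpaceTime → ℝ} (h : IsTest I φ) :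
    ∫ z in slab I, g z * φ z = ∫ z, g z * φ z :=
  setIntegral_slab_eq fun z hz => by simp [h.eq_zero hz]

/-- Cutting off in time extends a regular function by zero to a function on all of space-time with
integrable weak derivatives, to which mollification applies. -/
lemma IsCutoff.weakGrad (hI : I.OrdConnected) (h : IsCutoff I a b a' b' η) (hu : IsRegular I 2 u) :
    WeakGrad (fun z => η z.1 * u.val z) (fun z => η z.1 * u.dt z + deriv η z.1 * u.val z)
      (fun z => η z.1 * u.dx z) := by
  have i1 := integrable_of_slab (a := a') (b := b') (fun z hz => by simp [h.zero _ hz])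
    (h.memLp hu.val_mem)
  have i2 := integrable_of_slab (a := a') (b := b') (fun z hz => by simp [h.zero _ hz])
    (h.memLp hu.dt_mem)
  have i3 := integrable_of_slab (a := a') (b := b') (fun z hz => by simp [h.zero _ hz])
    (h.memLp hu.dx_mem)
  have i4 := integrable_of_slab (a := a') (b := b') (fun z hz => by simp [h.deriv_eq_zero hz])
    (h.memLp_deriv hu.val_mem)
  have hbd : ∀ {g φ : SpaceTime → ℝ}, Integrable g → IsTest univ φ → Integrable fun z => g z * φ z := by
    intro g φ hg hφ
    obtain ⟨C, hC⟩ := hφ.exists_bound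
    exact hg.mul_bdd (c := C) hφ.smoothL.continuous.aestronglyMeasurable (.of_forall hC)
  have hηφ : ∀ φ, IsTest univ φ → IsTest I (fun z => η z.1 * φ z) := by
    intro φ hφ
    exact ((SmoothL.time h.smooth).mul hφ.smoothL).isTest isCompact_Icc h.sub
      fun z hz => by simp [h.zero _ hz]
  refine ⟨i1, i2.add i4, i3, fun φ hφ => ?_, fun φ hφ => ?_⟩
  · have e := hu.weak_dt.eq _ (hηφ φ hφ)
    rw [integral_slab_restrict ((hηφ φ hφ).pdt hI), integral_slab_restrict (hηφ φ hφ)] at e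
    have e1 : ∀ z, u.val z * pdt (fun z => η z.1 * φ z) z
        = deriv η z.1 * u.val z * φ z + η z.1 * u.val z * pdt φ z := by
      intro z
      rw [(SmoothL.time h.smooth).pdt_mul hφ.smoothL, pdt_time]; ring
    simp_rw [e1] at e
    rw [integral_add (hbd i4 hφ) (hbd i1 (hφ.pdt ordConnected_univ))] at e
    simp_rw [add_mul]
    rw [integral_add (hbd i2 hφ) (hbd i4 hφ)]
    have e2 : ∫ z, u.dt z * (η z.1 * φ z) = ∫ z, η z.1 * u.dt z * φ z := by
      congr 1; funext z; ring
    rw [e2] at e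
    linarith
  · have e := hu.weak_dx.eq _ (hηφ φ hφ)
    rw [integral_slab_restrict ((hηφ φ hφ).pdx hI), integral_slab_restrict (hηφ φ hφ)] at e
    have e1 : ∀ z, u.val z * pdx (fun z => η z.1 * φ z) z = η z.1 * u.val z * pdx φ z := by
      intro z
      rw [(SmoothL.time h.smooth).pdx_mul hφ.smoothL, pdx_time]; ring
    simp_rw [e1] at e
    rw [e]
    congr 2; funext z; ring

lemma IsCutoff.ae_lintegral_le (h : IsCutoff I a b a' b' η) {g : SpaceTime → ℝ}
    (hg : LinfLoc I 2 g) :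
    ∀ᵐ t : ℝ, ∫⁻ θ : UnitAddCircle, ‖η t * g (t, θ)‖ₑ ≤ mixedNorm (Icc a' b') 2 g := by
  have hJ := h.sub.trans interior_subset
  have hm := (hg.memLp hJ).1
  rw [restrict_slab] at hm
  have h1 := (ae_eLpNorm_le_mixedNorm (Icc a' b') 2 g).and hm.prodMk_left
  rw [ae_restrict_iff' measurableSet_Icc] at h1
  filter_upwards [h1] with t ht
  by_cases hin : t ∈ Icc a' b'
  · obtain ⟨h2, h3⟩ := ht hin
    refine le_trans ?_ (le_trans (eLpNorm_le_eLpNorm_of_exponent_le (p := 1) (by norm_num) h3) h2)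
    rw [eLpNorm_one_eq_lintegral_enorm]
    refine lintegral_mono fun θ => ?_
    rw [enorm_mul]
    refine mul_le_of_le_one_left (by simp) ?_
    rw [Real.enorm_eq_ofReal (h.range t).1]
    exact ENNReal.ofReal_le_one.2 (h.range t).2
  · simp [h.zero t hin]

/-- Cut-offs of regular functions are bounded, by the norms in `L^∞(H¹)`. -/
lemma IsCutoff.ae_bound (hI : I.OrdConnected) (h : IsCutoff I a b a' b' η) (hu : IsRegular I 2 u) :
    ∀ᵐ z : SpaceTime, |η z.1 * u.val z| ≤
      (mixedNorm (Icc a' b') 2 u.val + mixedNorm (Icc a' b') 2 u.dx).toReal := by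
  have hJ := h.sub.trans interior_subset
  have h1 := (h.weakGrad hI hu).ae_enorm_le (h.memLp hu.val_mem) (h.ae_lintegral_le hu.val_mem)
    (h.ae_lintegral_le hu.dx_mem)
  filter_upwards [h1] with z hz
  have hfin : mixedNorm (Icc a' b') 2 u.val + mixedNorm (Icc a' b') 2 u.dx ≠ ⊤ :=
    ENNReal.add_ne_top.2 ⟨(hu.val_mem.bound _ isCompact_Icc hJ).ne,
      (hu.dx_mem.bound _ isCompact_Icc hJ).ne⟩
  have := ENNReal.toReal_mono hfin hz
  simpa using this

end Cutoff

/-! ### Products of weakly and strongly convergent sequences -/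

section Products
variable {α : Type*} [MeasurableSpace α] {μ : Measure α}

lemma abs_integral_mul_le {f g : α → ℝ} (hf : MemLp f 2 μ) (hg : MemLp g 2 μ) :
    |∫ z, f z * g z ∂μ| ≤ (eLpNorm f 2 μ).toReal * (eLpNorm g 2 μ).toReal := by
  have h := abs_real_inner_le_norm (hg.toLp g) (hf.toLp f)
  rw [L2.inner_def, Lp.norm_toLp, Lp.norm_toLp] at h
  have e : ∫ z, inner ℝ (hg.toLp g z) (hf.toLp f z) ∂μ = ∫ z, f z * g z ∂μ := by
    refine integral_congr_ae ?_
    filter_upwards [hf.coeFn_toLp, hg.coeFn_toLp] with z h1 h2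
    rw [h1, h2]; simp
  rw [e, mul_comm] at h
  exact h

lemma integrable_mul_of_memLp {f g : α → ℝ} (hf : MemLp f 2 μ) (hg : MemLp g 2 μ) :
    Integrable (fun z => f z * g z) μ := hf.integrable_mul hg

lemma integral_five {f₁ f₂ f₃ f₄ f₅ : α → ℝ} (h₁ : Integrable f₁ μ) (h₂ : Integrable f₂ μ)
    (h₃ : Integrable f₃ μ) (h₄ : Integrable f₄ μ) (h₅ : Integrable f₅ μ) :
    ∫ z, (f₁ z + f₂ z - f₃ z - f₄ z + f₅ z) ∂μ
      = ∫ z, f₁ z ∂μ + ∫ z, f₂ z ∂μ - ∫ z, f₃ z ∂μ - ∫ z, f₄ z ∂μ + ∫ z, f₅ z ∂μ := by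
  rw [← integral_add h₁ h₂]
  refine (integral_add (((h₁.add h₂).sub h₃).sub h₄) h₅).trans ?_
  congr 1
  refine (integral_sub ((h₁.add h₂).sub h₃) h₄).trans ?_
  congr 1
  exact integral_sub (h₁.add h₂) h₃

lemma MemLp.bdd_mul {f m : α → ℝ} {p : ℝ≥0∞} (hf : MemLp f p μ) (hm : AEStronglyMeasurable m μ)
    {C : ℝ} (hC : ∀ᵐ z ∂μ, |m z| ≤ C) : MemLp (fun z => m z * f z) p μ := by
  refine hf.of_le_mul (c := C) (hm.mul hf.1) ?_
  filter_upwards [hC] with z hz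
  rw [norm_mul]
  exact mul_le_mul_of_nonneg_right hz (norm_nonneg _)

lemma ae_bound_of_tendsto {m : ℕ → α → ℝ} {m₀ : α → ℝ} {C : ℝ} (hC : ∀ n, ∀ᵐ z ∂μ, |m n z| ≤ C)
    (hm₀ : ∀ᵐ z ∂μ, Tendsto (fun n => m n z) atTop (𝓝 (m₀ z))) : ∀ᵐ z ∂μ, |m₀ z| ≤ C := by
  filter_upwards [hm₀, ae_all_iff.2 hC] with z h1 h2
  exact le_of_tendsto' h1.abs h2

lemma tendsto_integral_bdd {m : ℕ → α → ℝ} {m₀ f : α → ℝ} {C : ℝ}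
    (hm : ∀ n, AEStronglyMeasurable (m n) μ) (hC : ∀ n, ∀ᵐ z ∂μ, |m n z| ≤ C)
    (hm₀ : ∀ᵐ z ∂μ, Tendsto (fun n => m n z) atTop (𝓝 (m₀ z))) (hf : Integrable f μ) :
    Tendsto (fun n => ∫ z, m n z * f z ∂μ) atTop (𝓝 (∫ z, m₀ z * f z ∂μ)) := by
  refine tendsto_integral_of_dominated_convergence (fun z => C * ‖f z‖)
    (fun n => (hm n).mul hf.1) (hf.norm.const_mul C) (fun n => ?_) ?_
  · filter_upwards [hC n] with z hz
    rw [norm_mul]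
    exact mul_le_mul_of_nonneg_right hz (norm_nonneg _)
  · filter_upwards [hm₀] with z hz using hz.mul_const _

/-- Bounded almost everywhere convergence, times strong convergence in `L²`. -/
lemma tendsto_integral_strong {m a : ℕ → α → ℝ} {m₀ a₀ g : α → ℝ} {C : ℝ}
    (hm : ∀ n, AEStronglyMeasurable (m n) μ) (hC : ∀ n, ∀ᵐ z ∂μ, |m n z| ≤ C)
    (hm₀ : ∀ᵐ z ∂μ, Tendsto (fun n => m n z) atTop (𝓝 (m₀ z))) (hg : MemLp g 2 μ)
    (ha : ∀ n, MemLp (a n) 2 μ) (ha₀ : MemLp a₀ 2 μ)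
    (h : Tendsto (fun n => eLpNorm (fun z => a n z - a₀ z) 2 μ) atTop (𝓝 0)) :
    Tendsto (fun n => ∫ z, m n z * (a n z * g z) ∂μ) atTop (𝓝 (∫ z, m₀ z * (a₀ z * g z) ∂μ)) := by
  have hag : ∀ n, Integrable (fun z => a n z * g z) μ := fun n => (ha n).integrable_mul hg
  have ha0g : Integrable (fun z => a₀ z * g z) μ := ha₀.integrable_mul hg
  have h1 := tendsto_integral_bdd hm hC hm₀ ha0g
  have h2 : Tendsto (fun n => ∫ z, (a n z - a₀ z) * (m n z * g z) ∂μ) atTop (𝓝 0) := by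
    have hC0 : ∀ n, eLpNorm (fun z => m n z * g z) 2 μ ≤ ENNReal.ofReal C * eLpNorm g 2 μ := by
      intro n
      refine eLpNorm_le_mul_eLpNorm_of_ae_le_mul ?_ 2
      filter_upwards [hC n] with z hz
      rw [norm_mul]
      exact mul_le_mul_of_nonneg_right hz (norm_nonneg _)
    have hfin : ENNReal.ofReal C * eLpNorm g 2 μ ≠ ⊤ := ENNReal.mul_ne_top (by simp) hg.2.ne
    have h3 := ((ENNReal.tendsto_toReal (by simp)).comp h).mul_const
      (ENNReal.ofReal C * eLpNorm g 2 μ).toReal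
    simp only [ENNReal.toReal_zero, zero_mul] at h3
    refine squeeze_zero_norm (fun n => ?_) h3
    refine (abs_integral_mul_le ((ha n).sub ha₀) (MemLp.bdd_mul hg (hm n) (hC n))).trans ?_
    exact mul_le_mul_of_nonneg_left (ENNReal.toReal_mono hfin (hC0 n)) ENNReal.toReal_nonneg
  have h4 := h2.add h1
  rw [zero_add] at h4
  refine h4.congr fun n => ?_
  have hbm : ∀ {f : α → ℝ}, Integrable f μ → Integrable (fun z => m n z * f z) μ := fun hf =>
    Integrable.bdd_mul hf (hm n) (hC n)
  rw [← integral_add]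
  · congr 1; funext z; ring
  · exact ((ha n).sub ha₀).integrable_mul (MemLp.bdd_mul hg (hm n) (hC n))
  · exact hbm ha0g

/-- Multiplication by a bounded sequence converging almost everywhere converges strongly on `L²`. -/
lemma tendsto_eLpNorm_bdd {m : ℕ → α → ℝ} {m₀ g : α → ℝ} {C : ℝ}
    (hm : ∀ n, AEStronglyMeasurable (m n) μ) (hC : ∀ n, ∀ᵐ z ∂μ, |m n z| ≤ C)
    (hm₀ : ∀ᵐ z ∂μ, Tendsto (fun n => m n z) atTop (𝓝 (m₀ z))) (hg : MemLp g 2 μ) :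
    Tendsto (fun n => eLpNorm (fun z => m n z * g z - m₀ z * g z) 2 μ) atTop (𝓝 0) := by
  have hm0 : AEStronglyMeasurable m₀ μ := aestronglyMeasurable_of_tendsto_ae atTop hm hm₀
  have hC0 := ae_bound_of_tendsto hC hm₀
  have hm0g : MemLp (fun z => m₀ z * g z) 2 μ := MemLp.bdd_mul hg hm0 hC0
  have hmng : ∀ n, MemLp (fun z => m n z * g z) 2 μ := fun n => MemLp.bdd_mul hg (hm n) (hC n)
  have h1 : Tendsto (fun n => ∫⁻ z, ‖m n z * g z - m₀ z * g z‖ₑ ^ 2 ∂μ) atTop (𝓝 0) := by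
    have := tendsto_lintegral_of_dominated_convergence' (μ := μ) (f := fun _ => 0)
      (F := fun n z => ‖m n z * g z - m₀ z * g z‖ₑ ^ 2)
      (fun z => ENNReal.ofReal (2 * C) ^ 2 * ‖g z‖ₑ ^ 2)
      (fun n => ((hmng n).sub hm0g).1.enorm.pow_const 2) (fun n => ?_) ?_ ?_
    · simpa using this
    · filter_upwards [hC n, hC0] with z h1 h2
      rw [← mul_pow, ← sub_mul, enorm_mul]
      gcongr
      rw [Real.enorm_eq_ofReal_abs]
      refine ENNReal.ofReal_le_ofReal ((abs_sub _ _).trans (by linarith))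
    · rw [lintegral_const_mul' _ _ (by finiteness), ← eLpNorm_two_sq]
      exact ENNReal.mul_ne_top (by finiteness) (ENNReal.pow_ne_top hg.2.ne)
    · filter_upwards [hm₀] with z hz
      have h2 := ((hz.mul_const (g z)).sub_const (m₀ z * g z)).enorm.ennrpow_const (2 : ℝ)
      rw [sub_self, enorm_zero, ENNReal.zero_rpow_of_pos (by norm_num)] at h2
      refine h2.congr fun n => ?_
      exact ENNReal.rpow_two _
  have h2 := h1.ennrpow_const (1 / 2 : ℝ)
  rw [ENNReal.zero_rpow_of_pos (by norm_num)] at h2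
  refine h2.congr fun n => ?_
  rw [← eLpNorm_two_sq, ← ENNReal.rpow_natCast, ← ENNReal.rpow_mul]
  norm_num

/-- Bounded almost everywhere convergence, times weak convergence in `L²`. -/
lemma tendsto_integral_weak {m a : ℕ → α → ℝ} {m₀ a₀ g : α → ℝ} {C : ℝ} {M : ℝ≥0∞}
    (hm : ∀ n, AEStronglyMeasurable (m n) μ) (hC : ∀ n, ∀ᵐ z ∂μ, |m n z| ≤ C)
    (hm₀ : ∀ᵐ z ∂μ, Tendsto (fun n => m n z) atTop (𝓝 (m₀ z))) (hg : MemLp g 2 μ)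
    (ha : ∀ n, MemLp (a n) 2 μ) (hM : M ≠ ⊤) (haM : ∀ n, eLpNorm (a n) 2 μ ≤ M)
    (h : ∀ f, MemLp f 2 μ → Tendsto (fun n => ∫ z, a n z * f z ∂μ) atTop (𝓝 (∫ z, a₀ z * f z ∂μ))) :
    Tendsto (fun n => ∫ z, m n z * (a n z * g z) ∂μ) atTop (𝓝 (∫ z, m₀ z * (a₀ z * g z) ∂μ)) := by
  have hm0 : AEStronglyMeasurable m₀ μ := aestronglyMeasurable_of_tendsto_ae atTop hm hm₀
  have hC0 := ae_bound_of_tendsto hC hm₀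
  have hm0g : MemLp (fun z => m₀ z * g z) 2 μ := MemLp.bdd_mul hg hm0 hC0
  have hmng : ∀ n, MemLp (fun z => m n z * g z) 2 μ := fun n => MemLp.bdd_mul hg (hm n) (hC n)
  have hs := tendsto_eLpNorm_bdd hm hC hm₀ hg
  have h2 : Tendsto (fun n => ∫ z, a n z * (m n z * g z - m₀ z * g z) ∂μ) atTop (𝓝 0) := by
    have h3 := ((ENNReal.tendsto_toReal (by simp)).comp hs).const_mul M.toReal
    simp only [ENNReal.toReal_zero, mul_zero] at h3
    refine squeeze_zero_norm (fun n => ?_) h3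
    refine (abs_integral_mul_le (ha n) ((hmng n).sub hm0g)).trans ?_
    exact mul_le_mul_of_nonneg_right (ENNReal.toReal_mono hM (haM n)) ENNReal.toReal_nonneg
  have h4 := h2.add (h _ hm0g)
  rw [zero_add] at h4
  have e0 : ∫ z, m₀ z * (a₀ z * g z) ∂μ = ∫ z, a₀ z * (m₀ z * g z) ∂μ := by
    congr 1; funext z; ring
  rw [e0]
  refine h4.congr fun n => ?_
  refine (integral_add (integrable_mul_of_memLp (ha n) ((hmng n).sub hm0g))
    (integrable_mul_of_memLp (ha n) hm0g)).symm.trans ?_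
  congr 1; funext z; simp only [Pi.sub_apply]; ring

end Products

/-! ### Testing a weak equation with nonlinear functions of regular fields -/

/-- Two regular fields are approximated, on slabs over compact intervals, by smooth functions,
boundedly almost everywhere and with derivatives converging in `L²`. -/
lemma exists_smooth_approx {I : Set ℝ} (hI : I.OrdConnected) {P Q : Field} (hP : IsRegular I 2 P)
    (hQ : IsRegular I 2 Q) {a b : ℝ} (hab : a ≤ b) (h : Icc a b ⊆ interior I) :
    ∃ (p q : ℕ → SpaceTime → ℝ) (C : ℝ), (∀ j, SmoothL (p j)) ∧ (∀ j, SmoothL (q j)) ∧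
      (∀ j z, |p j z| ≤ C) ∧ (∀ j z, |q j z| ≤ C) ∧
      (∀ᵐ z ∂(volume.restrict (slab (Icc a b))), Tendsto (fun j => p j z) atTop (𝓝 (P.val z))) ∧
      (∀ᵐ z ∂(volume.restrict (slab (Icc a b))), Tendsto (fun j => q j z) atTop (𝓝 (Q.val z))) ∧
      (∀ j, MemLp (pdt (p j)) 2 (volume.restrict (slab (Icc a b)))) ∧
      (∀ j, MemLp (pdx (p j)) 2 (volume.restrict (slab (Icc a b)))) ∧
      (∀ j, MemLp (pdt (q j)) 2 (volume.restrict (slab (Icc a b)))) ∧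
      (∀ j, MemLp (pdx (q j)) 2 (volume.restrict (slab (Icc a b)))) ∧
      Tendsto (fun j => eLpNorm (fun z => pdt (p j) z - P.dt z) 2
        (volume.restrict (slab (Icc a b)))) atTop (𝓝 0) ∧
      Tendsto (fun j => eLpNorm (fun z => pdx (p j) z - P.dx z) 2
        (volume.restrict (slab (Icc a b)))) atTop (𝓝 0) ∧
      Tendsto (fun j => eLpNorm (fun z => pdt (q j) z - Q.dt z) 2
        (volume.restrict (slab (Icc a b)))) atTop (𝓝 0) ∧
      Tendsto (fun j => eLpNorm (fun z => pdx (q j) z - Q.dx z) 2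
        (volume.restrict (slab (Icc a b)))) atTop (𝓝 0) := by
  obtain ⟨a', b', η, hη⟩ := exists_cutoff hI hab h
  obtain ⟨ρ, hρ⟩ := exists_kernel_seq
  have gP := hη.weakGrad hI hP
  have gQ := hη.weakGrad hI hQ
  set p₀ : SpaceTime → ℝ := fun z => η z.1 * P.val z
  set q₀ : SpaceTime → ℝ := fun z => η z.1 * Q.val z
  have sP : ∀ j, SmoothL (moll (ρ j) p₀) := fun j => SmoothL.moll (hρ j).isTest gP.int
  have sQ : ∀ j, SmoothL (moll (ρ j) q₀) := fun j => SmoothL.moll (hρ j).isTest gQ.int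
  obtain ⟨k, hk, hkP⟩ := exists_subseq_ae (fun j => (sP j).continuous.aestronglyMeasurable)
    gP.int.aestronglyMeasurable (tendsto_moll hρ (hη.memLp hP.val_mem) gP.int)
  have tQ := tendsto_moll hρ (hη.memLp hQ.val_mem) gQ.int
  obtain ⟨l, hl, hlQ⟩ := exists_subseq_ae (f := fun j => moll (ρ (k j)) q₀)
    (fun j => (sQ (k j)).continuous.aestronglyMeasurable)
    gQ.int.aestronglyMeasurable (tQ.comp hk.tendsto_atTop)
  have hkl : Tendsto (fun j => k (l j)) atTop atTop := hk.tendsto_atTop.comp hl.tendsto_atTop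
  obtain ⟨CP, hCP⟩ : ∃ C : ℝ, ∀ᵐ z : SpaceTime, |p₀ z| ≤ C := ⟨_, hη.ae_bound hI hP⟩
  obtain ⟨CQ, hCQ⟩ : ∃ C : ℝ, ∀ᵐ z : SpaceTime, |q₀ z| ≤ C := ⟨_, hη.ae_bound hI hQ⟩
  have hms : MeasurableSet (slab (Icc a b)) := measurableSet_slab measurableSet_Icc
  have conv : ∀ {g g₀ : SpaceTime → ℝ} {d : ℕ → SpaceTime → ℝ}, MemLp g 2 volume → Integrable g →
      (∀ j, d j = moll (ρ j) g) → (∀ z : SpaceTime, z.1 ∈ Icc a b → g z = g₀ z) →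
      (∀ j, MemLp (d j) 2 (volume.restrict (slab (Icc a b)))) ∧
      Tendsto (fun j => eLpNorm (fun z => d (k (l j)) z - g₀ z) 2
        (volume.restrict (slab (Icc a b)))) atTop (𝓝 0) := by
    intro g g₀ d hg hg' hd heq
    constructor
    · intro j
      have hc : Continuous (d j) := by
        rw [hd]; exact (SmoothL.moll (hρ j).isTest hg').continuous
      obtain ⟨C, hC⟩ := (isCompact_slab (isCompact_Icc (a := a) (b := b))).exists_bound_of_continuousOn
        hc.continuousOn
      refine MemLp.of_bound hc.aestronglyMeasurable C ?_
      rw [ae_restrict_iff' hms]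
      exact .of_forall hC
    · refine tendsto_of_tendsto_of_tendsto_of_le_of_le tendsto_const_nhds
        ((tendsto_moll hρ hg hg').comp hkl) (fun _ => zero_le) fun j => ?_
      refine le_trans (le_of_eq (eLpNorm_congr_ae ?_))
        (eLpNorm_mono_measure _ (Measure.restrict_le_self (s := slab (Icc a b))))
      filter_upwards [ae_restrict_mem hms] with z hz
      rw [heq z (mem_slab.1 hz), hd]
  have cPt := conv (hη.memLp_dt hP) gP.int_t (d := fun j => pdt (moll (ρ j) p₀)) (g₀ := P.dt)
    (fun j => funext fun z => gP.pdt_moll (hρ j).isTest z)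
    (fun z hz => by simp [hη.one _ hz, hη.deriv_zero _ hz])
  have cPx := conv (hη.memLp hP.dx_mem) gP.int_x (d := fun j => pdx (moll (ρ j) p₀)) (g₀ := P.dx)
    (fun j => funext fun z => gP.pdx_moll (hρ j).isTest z)
    (fun z hz => by simp [hη.one _ hz])
  have cQt := conv (hη.memLp_dt hQ) gQ.int_t (d := fun j => pdt (moll (ρ j) q₀)) (g₀ := Q.dt)
    (fun j => funext fun z => gQ.pdt_moll (hρ j).isTest z)
    (fun z hz => by simp [hη.one _ hz, hη.deriv_zero _ hz])
  have cQx := conv (hη.memLp hQ.dx_mem) gQ.int_x (d := fun j => pdx (moll (ρ j) q₀)) (g₀ := Q.dx)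
    (fun j => funext fun z => gQ.pdx_moll (hρ j).isTest z)
    (fun z hz => by simp [hη.one _ hz])
  refine ⟨fun j => moll (ρ (k (l j))) p₀, fun j => moll (ρ (k (l j))) q₀, max CP CQ,
    fun j => sP _, fun j => sQ _,
    fun j z => ((hρ _).abs_moll_le hCP z).trans (le_max_left _ _),
    fun j z => ((hρ _).abs_moll_le hCQ z).trans (le_max_right _ _), ?_, ?_,
    fun j => cPt.1 _, fun j => cPx.1 _, fun j => cQt.1 _, fun j => cQx.1 _,
    cPt.2, cPx.2, cQt.2, cQx.2⟩
  · filter_upwards [ae_restrict_of_ae hkP, ae_restrict_mem hms] with z hz hz'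
    have := hz.comp hl.tendsto_atTop
    simpa [Function.comp_def, p₀, hη.one _ (mem_slab.1 hz')] using this
  · filter_upwards [ae_restrict_of_ae hlQ, ae_restrict_mem hms] with z hz hz'
    simpa [q₀, hη.one _ (mem_slab.1 hz')] using hz

/-- `A` is locally square integrable in the interior of the slab. -/
def LocL2 (I : Set ℝ) (A : SpaceTime → ℝ) : Prop :=
  ∀ a b : ℝ, Icc a b ⊆ interior I → MemLp A 2 (volume.restrict (slab (Icc a b)))

/-- `f` is locally integrable in the interior of the slab. -/
def LocL1 (I : Set ℝ) (f : SpaceTime → ℝ) : Prop :=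
  ∀ a b : ℝ, Icc a b ⊆ interior I → Integrable f (volume.restrict (slab (Icc a b)))

/-- `∂_t A - ∂_θ B = f` in the sense of distributions, with locally integrable terms. -/
structure FluxEq (I : Set ℝ) (A B f : SpaceTime → ℝ) : Prop where
  flux_t : LocL2 I A
  flux_x : LocL2 I B
  source : LocL1 I f
  eq : ∀ φ, IsTest I φ → ∫ z in slab I, (-(A z * pdt φ z) + B z * pdx φ z - f z * φ z) = 0

lemma setIntegral_slab_Icc {I : Set ℝ} {a b : ℝ} (hab : Icc a b ⊆ interior I) {f : SpaceTime → ℝ}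
    (h : ∀ z : SpaceTime, z.1 ∉ Icc a b → f z = 0) :
    ∫ z in slab I, f z = ∫ z in slab (Icc a b), f z := by
  rw [setIntegral_slab_eq fun z hz => h z fun h' => hz (hab h')]
  exact (setIntegral_eq_integral_of_forall_compl_eq_zero fun z hz =>
    h z fun h' => hz (mem_slab.2 h')).symm

lemma integrableOn_slab_of_Icc {I : Set ℝ} {a b : ℝ} {f : SpaceTime → ℝ}
    (h : ∀ z : SpaceTime, z.1 ∉ Icc a b → f z = 0)
    (hf : Integrable f (volume.restrict (slab (Icc a b)))) : IntegrableOn f (slab I) := by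
  rw [← memLp_one_iff_integrable] at hf
  exact (memLp_one_iff_integrable.1 (memLp_of_slab h hf)).integrableOn

/-- A weak equation `∂_t A - ∂_θ B = f` may be tested with `G(P) H(Q) χ` for regular fields `P`, `Q`,
smooth functions `G`, `H` and a test function `χ`. -/
lemma FluxEq.test {I : Set ℝ} (hI : I.OrdConnected) {P Q : Field} (hP : IsRegular I 2 P)
    (hQ : IsRegular I 2 Q) {A B f : SpaceTime → ℝ} (hF : FluxEq I A B f) {G H : ℝ → ℝ}
    (hG : ContDiff ℝ ∞ G) (hH : ContDiff ℝ ∞ H) {χ : SpaceTime → ℝ} (hχ : IsTest I χ)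
    {R : SpaceTime → ℝ}
    (hR : ∀ z : SpaceTime, z.1 ∈ interior I → R z =
      -(A z * ((deriv G (P.val z) * P.dt z * H (Q.val z) + G (P.val z) * (deriv H (Q.val z) * Q.dt z))
          * χ z + G (P.val z) * H (Q.val z) * pdt χ z))
      + B z * ((deriv G (P.val z) * P.dx z * H (Q.val z) + G (P.val z) * (deriv H (Q.val z) * Q.dx z))
          * χ z + G (P.val z) * H (Q.val z) * pdx χ z)
      - f z * (G (P.val z) * H (Q.val z) * χ z))
    (hR0 : ∀ z : SpaceTime, z.1 ∉ interior I → R z = 0) :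
    IntegrableOn R (slab I) ∧ ∫ z in slab I, R z = 0 := by
  rcases hχ.exists_Icc hI with rfl | ⟨a, b, hab, hsub, h0⟩
  · have : R = 0 := by
      funext z
      by_cases hz : z.1 ∈ interior I
      · rw [hR z hz]; simp [pdt, pdx]
      · exact hR0 z hz
    subst this
    exact ⟨integrableOn_zero, by simp⟩
  have hχt : ∀ z : SpaceTime, z.1 ∉ Icc a b → pdt χ z = 0 := fun z hz =>
    pdt_eq_zero isClosed_Icc h0 hz
  have hχx : ∀ z : SpaceTime, z.1 ∉ Icc a b → pdx χ z = 0 := fun z hz => pdx_eq_zero h0 hz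
  have hR0' : ∀ z : SpaceTime, z.1 ∉ Icc a b → R z = 0 := fun z hz => by
    by_cases hz' : z.1 ∈ interior I
    · rw [hR z hz', h0 z hz, hχt z hz, hχx z hz]; ring
    · exact hR0 z hz'
  obtain ⟨p, q, C, sp, sq, hp, hq, tp, tq, mpt, mpx, mqt, mqx, cpt, cpx, cqt, cqx⟩ :=
    exists_smooth_approx hI hP hQ hab hsub
  set μ : Measure SpaceTime := volume.restrict (slab (Icc a b)) with hμ
  have hms : MeasurableSet (slab (Icc a b)) := measurableSet_slab measurableSet_Icc
  have hA := hF.flux_t a b hsub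
  have hB := hF.flux_x a b hsub
  have hf := hF.source a b hsub
  have hPt := hP.dt_mem.memLp (hsub.trans interior_subset)
  have hPx := hP.dx_mem.memLp (hsub.trans interior_subset)
  have hQt := hQ.dt_mem.memLp (hsub.trans interior_subset)
  have hQx := hQ.dx_mem.memLp (hsub.trans interior_subset)
  obtain ⟨c0, hc0⟩ := hχ.exists_bound
  obtain ⟨c1, hc1⟩ := (hχ.pdt hI).exists_bound
  obtain ⟨c2, hc2⟩ := (hχ.pdx hI).exists_bound
  have hχm : AEStronglyMeasurable χ μ := hχ.smoothL.continuous.aestronglyMeasurable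
  have hχtm : AEStronglyMeasurable (pdt χ) μ := hχ.smoothL.pdt.continuous.aestronglyMeasurable
  have hχxm : AEStronglyMeasurable (pdx χ) μ := hχ.smoothL.pdx.continuous.aestronglyMeasurable
  have hAχ : MemLp (fun z => χ z * A z) 2 μ := MemLp.bdd_mul hA hχm (.of_forall hc0)
  have hBχ : MemLp (fun z => χ z * B z) 2 μ := MemLp.bdd_mul hB hχm (.of_forall hc0)
  have hf1 : Integrable (fun z => -(pdt χ z * A z) + pdx χ z * B z - χ z * f z) μ := by
    refine Integrable.sub (Integrable.add (Integrable.neg ?_) ?_) ?_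
    · exact (MemLp.bdd_mul hA hχtm (.of_forall hc1)).integrable (by norm_num)
    · exact (MemLp.bdd_mul hB hχxm (.of_forall hc2)).integrable (by norm_num)
    · exact hf.bdd_mul hχm (.of_forall hc0)
  -- bounds for smooth functions of the approximations
  have bdd : ∀ {F : ℝ → ℝ}, ContDiff ℝ ∞ F → ∃ D, ∀ x, |x| ≤ C → |F x| ≤ D := by
    intro F hF
    obtain ⟨D, hD⟩ := (isCompact_Icc (a := -C) (b := C)).exists_bound_of_continuousOn
      hF.continuous.continuousOn
    exact ⟨D, fun x hx => hD x (abs_le.1 hx)⟩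
  have bddm : ∀ {F K : ℝ → ℝ}, ContDiff ℝ ∞ F → ContDiff ℝ ∞ K →
      ∃ D : ℝ, (∀ j, AEStronglyMeasurable (fun z => F (p j z) * K (q j z)) μ) ∧
      (∀ j, ∀ᵐ z ∂μ, |F (p j z) * K (q j z)| ≤ D) ∧
      (∀ᵐ z ∂μ, Tendsto (fun j => F (p j z) * K (q j z)) atTop
        (𝓝 (F (P.val z) * K (Q.val z)))) := by
    intro F K hF hK
    obtain ⟨D, hD⟩ := bdd hF
    obtain ⟨E, hE⟩ := bdd hK
    refine ⟨D * E, fun j => ?_, fun j => .of_forall fun z => ?_, ?_⟩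
    · exact (((sp j).comp hF).mul ((sq j).comp hK)).continuous.aestronglyMeasurable
    · rw [abs_mul]
      have h1 := hD _ (hp j z)
      exact mul_le_mul h1 (hE _ (hq j z)) (abs_nonneg _) ((abs_nonneg _).trans h1)
    · filter_upwards [tp, tq] with z h1 h2
      exact ((hF.continuous.tendsto _).comp h1).mul ((hK.continuous.tendsto _).comp h2)
  have hG' : ContDiff ℝ ∞ (deriv G) := ((contDiff_infty_iff_deriv (𝕜 := ℝ) (f := G)).1 hG).2
  have hH' : ContDiff ℝ ∞ (deriv H) := ((contDiff_infty_iff_deriv (𝕜 := ℝ) (f := H)).1 hH).2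
  obtain ⟨D1, m1, n1, l1⟩ := bddm hG' hH
  obtain ⟨D2, m2, n2, l2⟩ := bddm hG hH'
  obtain ⟨D3, m3, n3, l3⟩ := bddm hG hH
  have T1 := tendsto_integral_strong m1 n1 l1 hAχ mpt hPt cpt
  have T2 := tendsto_integral_strong m2 n2 l2 hAχ mqt hQt cqt
  have T3 := tendsto_integral_strong m1 n1 l1 hBχ mpx hPx cpx
  have T4 := tendsto_integral_strong m2 n2 l2 hBχ mqx hQx cqx
  have T5 := tendsto_integral_bdd m3 n3 l3 hf1
  have T := ((((T3.add T4).sub T1).sub T2).add T5)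
  -- the integrand of the limit is the sum of five integrable functions
  have i : ∀ {F K : ℝ → ℝ} (_ : ContDiff ℝ ∞ F) (_ : ContDiff ℝ ∞ K) {g : SpaceTime → ℝ}
      (_ : Integrable g μ), Integrable (fun z => F (P.val z) * K (Q.val z) * g z) μ := by
    intro F K hF hK g hg
    obtain ⟨D, m, n, l⟩ := bddm hF hK
    exact hg.bdd_mul (aestronglyMeasurable_of_tendsto_ae atTop m l) (ae_bound_of_tendsto n l)
  have i' : ∀ j {F K : ℝ → ℝ} (_ : ContDiff ℝ ∞ F) (_ : ContDiff ℝ ∞ K) {g : SpaceTime → ℝ}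
      (_ : Integrable g μ), Integrable (fun z => F (p j z) * K (q j z) * g z) μ := by
    intro j F K hF hK g hg
    obtain ⟨D, m, n, l⟩ := bddm hF hK
    exact hg.bdd_mul (m j) (n j)
  have j1 := i hG' hH (integrable_mul_of_memLp hPt hAχ)
  have j2 := i hG hH' (integrable_mul_of_memLp hQt hAχ)
  have j3 := i hG' hH (integrable_mul_of_memLp hPx hBχ)
  have j4 := i hG hH' (integrable_mul_of_memLp hQx hBχ)
  have j5 := i hG hH hf1
  have hRe : R =ᵐ[μ] fun z => deriv G (P.val z) * H (Q.val z) * (P.dx z * (χ z * B z))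
      + G (P.val z) * deriv H (Q.val z) * (Q.dx z * (χ z * B z))
      - deriv G (P.val z) * H (Q.val z) * (P.dt z * (χ z * A z))
      - G (P.val z) * deriv H (Q.val z) * (Q.dt z * (χ z * A z))
      + G (P.val z) * H (Q.val z) * (-(pdt χ z * A z) + pdx χ z * B z - χ z * f z) := by
    filter_upwards [ae_restrict_mem hms] with z hz
    rw [hR z (hsub (mem_slab.1 hz))]
    ring
  have hRi : Integrable R μ := ((((j3.add j4).sub j1).sub j2).add j5).congr hRe.symm
  refine ⟨integrableOn_slab_of_Icc hR0' hRi, ?_⟩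
  rw [setIntegral_slab_Icc hsub hR0', integral_congr_ae hRe]
  refine (integral_five j3 j4 j1 j2 j5).trans ?_
  refine tendsto_nhds_unique T ?_
  refine tendsto_const_nhds.congr fun j => ?_
  have k1 := i' j hG' hH (integrable_mul_of_memLp (mpt j) hAχ)
  have k2 := i' j hG hH' (integrable_mul_of_memLp (mqt j) hAχ)
  have k3 := i' j hG' hH (integrable_mul_of_memLp (mpx j) hBχ)
  have k4 := i' j hG hH' (integrable_mul_of_memLp (mqx j) hBχ)
  have k5 := i' j hG hH hf1
  have sGH : SmoothL (fun z => G (p j z) * H (q j z)) := ((sp j).comp hG).mul ((sq j).comp hH)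
  have hφ : IsTest I (fun z => G (p j z) * H (q j z) * χ z) := hχ.mul_smooth sGH
  have h0' : ∀ z : SpaceTime, z.1 ∉ Icc a b → G (p j z) * H (q j z) * χ z = 0 := fun z hz => by
    simp [h0 z hz]
  have e := hF.eq _ hφ
  rw [setIntegral_slab_Icc hsub (fun z hz => by
    simp [h0 z hz, pdt_eq_zero isClosed_Icc h0' hz, pdx_eq_zero h0' hz])] at e
  rw [← e]
  refine Eq.trans ?_ (integral_five k3 k4 k1 k2 k5)
  congr 1
  funext z
  rw [sGH.pdt_mul hχ.smoothL, sGH.pdx_mul hχ.smoothL, ((sp j).comp hG).pdt_mul ((sq j).comp hH),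
    ((sp j).comp hG).pdx_mul ((sq j).comp hH), SmoothL.pdt_comp hG (sp j),
    SmoothL.pdx_comp hG (sp j), SmoothL.pdt_comp hH (sq j), SmoothL.pdx_comp hH (sq j)]
  ring

/-! ### The essential equations in divergence form -/

/-- Regular fields are locally bounded, by the Sobolev inequality in `θ`. -/
lemma IsRegular.ae_bound {I : Set ℝ} (hI : I.OrdConnected) {P : Field} (hP : IsRegular I 2 P)
    {a b : ℝ} (hab : a ≤ b) (h : Icc a b ⊆ interior I) :
    ∃ C, ∀ᵐ z ∂(volume.restrict (slab (Icc a b))), |P.val z| ≤ C := by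
  obtain ⟨a', b', η, hη⟩ := exists_cutoff hI hab h
  refine ⟨(mixedNorm (Icc a' b') 2 P.val + mixedNorm (Icc a' b') 2 P.dx).toReal, ?_⟩
  filter_upwards [ae_restrict_of_ae (hη.ae_bound hI hP),
    ae_restrict_mem (measurableSet_slab measurableSet_Icc)] with z hz hz'
  simpa [hη.one _ (mem_slab.1 hz')] using hz

section Coefficients

variable {I : Set ℝ} {P Q : Field} {F : ℝ × ℝ × ℝ → ℝ}

/-- Continuous functions of `t > 0` and of two regular fields are locally bounded. -/
lemma coeff_bound (hI : I.OrdConnected) (hI0 : I ⊆ Ioi 0) (hP : IsRegular I 2 P)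
    (hQ : IsRegular I 2 Q) (hF : ContinuousOn F {p | 0 < p.1}) {a b : ℝ}
    (h : Icc a b ⊆ interior I) :
    AEStronglyMeasurable (fun z : SpaceTime => F (z.1, P.val z, Q.val z))
      (volume.restrict (slab (Icc a b))) ∧
    ∃ C, ∀ᵐ z : SpaceTime ∂(volume.restrict (slab (Icc a b))), |F (z.1, P.val z, Q.val z)| ≤ C := by
  by_cases hab : a ≤ b
  swap
  · have : slab (Icc a b) = ∅ := by simp [slab, Icc_eq_empty hab]
    rw [this]; simp
  have hms : MeasurableSet (slab (Icc a b)) := measurableSet_slab measurableSet_Icc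
  have hpos : ∀ t ∈ Icc a b, 0 < t := fun t ht => hI0 (interior_subset (h ht))
  obtain ⟨C, hC⟩ := hP.ae_bound hI hab h
  obtain ⟨D, hD⟩ := hQ.ae_bound hI hab h
  constructor
  · have hm : AEMeasurable (fun z : SpaceTime => (z.1, P.val z, Q.val z))
        (volume.restrict (slab (Icc a b))) :=
      measurable_fst.aemeasurable.prodMk
        ((hP.val_mem.memLp (h.trans interior_subset)).1.aemeasurable.prodMk
          (hQ.val_mem.memLp (h.trans interior_subset)).1.aemeasurable)
    have hs : MeasurableSet {p : ℝ × ℝ × ℝ | 0 < p.1} := measurableSet_lt measurable_const measurable_fst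
    have h1 : Measurable (({p : ℝ × ℝ × ℝ | 0 < p.1}).indicator F) :=
      (hF.measurable_piecewise (g := fun _ => 0) continuousOn_const hs)
    refine ((h1.comp_aemeasurable hm).congr ?_).aestronglyMeasurable
    filter_upwards [ae_restrict_mem hms] with z hz
    exact indicator_of_mem (s := {p : ℝ × ℝ × ℝ | 0 < p.1}) (hpos _ (mem_slab.1 hz)) F
  · have hK : IsCompact ((Icc a b) ×ˢ (Icc (-C) C) ×ˢ (Icc (-D) D)) :=
      isCompact_Icc.prod (isCompact_Icc.prod isCompact_Icc)
    obtain ⟨E, hE⟩ := hK.exists_bound_of_continuousOn (hF.mono fun p hp => hpos _ hp.1)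
    refine ⟨E, ?_⟩
    filter_upwards [ae_restrict_mem hms, hC, hD] with z h1 h2 h3
    exact hE _ ⟨mem_slab.1 h1, abs_le.1 h2, abs_le.1 h3⟩

lemma LocL2.coeff_mul (hI : I.OrdConnected) (hI0 : I ⊆ Ioi 0) (hP : IsRegular I 2 P)
    (hQ : IsRegular I 2 Q) (hF : ContinuousOn F {p | 0 < p.1}) {A : SpaceTime → ℝ} (hA : LocL2 I A) :
    LocL2 I (fun z => F (z.1, P.val z, Q.val z) * A z) := fun a b h => by
  obtain ⟨hm, C, hC⟩ := coeff_bound hI hI0 hP hQ hF h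
  exact MemLp.bdd_mul (hA a b h) hm hC

lemma LocL1.coeff_mul (hI : I.OrdConnected) (hI0 : I ⊆ Ioi 0) (hP : IsRegular I 2 P)
    (hQ : IsRegular I 2 Q) (hF : ContinuousOn F {p | 0 < p.1}) {A : SpaceTime → ℝ} (hA : LocL1 I A) :
    LocL1 I (fun z => F (z.1, P.val z, Q.val z) * A z) := fun a b h => by
  obtain ⟨hm, C, hC⟩ := coeff_bound hI hI0 hP hQ hF h
  exact (hA a b h).bdd_mul hm hC

lemma LocL2.mul {A B : SpaceTime → ℝ} (hA : LocL2 I A) (hB : LocL2 I B) :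
    LocL1 I (fun z => A z * B z) := fun a b h => integrable_mul_of_memLp (hA a b h) (hB a b h)

lemma LocL2.locL1 {A : SpaceTime → ℝ} (hA : LocL2 I A) : LocL1 I A := fun a b h =>
  (hA a b h).integrable (by norm_num)

lemma LocL1.add {A B : SpaceTime → ℝ} (hA : LocL1 I A) (hB : LocL1 I B) :
    LocL1 I (fun z => A z + B z) := fun a b h => (hA a b h).add (hB a b h)

lemma LocL1.sub {A B : SpaceTime → ℝ} (hA : LocL1 I A) (hB : LocL1 I B) :
    LocL1 I (fun z => A z - B z) := fun a b h => (hA a b h).sub (hB a b h)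

lemma LocL2.sub {A B : SpaceTime → ℝ} (hA : LocL2 I A) (hB : LocL2 I B) :
    LocL2 I (fun z => A z - B z) := fun a b h => (hA a b h).sub (hB a b h)

lemma LocL1.congr {A B : SpaceTime → ℝ} (hA : LocL1 I A)
    (h : ∀ z : SpaceTime, z.1 ∈ interior I → A z = B z) : LocL1 I B := fun a b hab => by
  refine (hA a b hab).congr ?_
  filter_upwards [ae_restrict_mem (measurableSet_slab measurableSet_Icc)] with z hz
  exact h z (hab (mem_slab.1 hz))

lemma LinfLoc.locL2 {A : SpaceTime → ℝ} (hA : LinfLoc I 2 A) : LocL2 I A := fun _ _ h =>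
  hA.memLp (h.trans interior_subset)

end Coefficients

lemma IsTest.integrableOn_mul {I : Set ℝ} (hI : I.OrdConnected) {φ f : SpaceTime → ℝ}
    (hφ : IsTest I φ) (hf : LocL1 I f) : IntegrableOn (fun z => f z * φ z) (slab I) := by
  rcases hφ.exists_Icc hI with rfl | ⟨a, b, hab, hsub, h0⟩
  · simp
  · obtain ⟨C, hC⟩ := hφ.exists_bound
    exact integrableOn_slab_of_Icc (fun z hz => by simp [h0 z hz])
      ((hf a b hsub).mul_bdd (c := C) hφ.smoothL.continuous.aestronglyMeasurable (.of_forall hC))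

/-- Residual form of a weak equation. -/
lemma integral_residual {I : Set ℝ} (hI : I.OrdConnected) {A B f : SpaceTime → ℝ} (hA : LocL2 I A)
    (hB : LocL2 I B) (hf : LocL1 I f) {φ : SpaceTime → ℝ} (hφ : IsTest I φ) :
    ∫ z in slab I, (-(A z * pdt φ z) + B z * pdx φ z - f z * φ z)
      = (∫ z in slab I, (-(A z * pdt φ z) + B z * pdx φ z)) - ∫ z in slab I, f z * φ z :=
  integral_sub ((((hφ.pdt hI).integrableOn_mul hI hA.locL1).neg).add
    ((hφ.pdx hI).integrableOn_mul hI hB.locL1)) (hφ.integrableOn_mul hI hf)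

lemma WeakWave.fluxEq {I : Set ℝ} (hI : I.OrdConnected) {u : Field} {f : SpaceTime → ℝ}
    (hu : IsRegular I 2 u) (hf : LocL1 I f) (h : WeakWave I u f) : FluxEq I u.dt u.dx f :=
  ⟨hu.dt_mem.locL2, hu.dx_mem.locL2, hf, fun φ hφ => by
    rw [integral_residual hI hu.dt_mem.locL2 hu.dx_mem.locL2 hf hφ, h φ hφ, sub_self]⟩

/-- The right-hand side of the equation for `P`. -/
noncomputable def sourceP (P Q : Field) (z : SpaceTime) : ℝ :=
  - (P.dt z / z.1) + Real.exp (2 * P.val z) * ((Q.dt z) ^ 2 - (Q.dx z) ^ 2)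

/-- The right-hand side of the equation for `Q`. -/
noncomputable def sourceQ (P Q : Field) (z : SpaceTime) : ℝ :=
  - (Q.dt z / z.1) - 2 * (P.dt z * Q.dt z - P.dx z * Q.dx z)

/-- The weight `t e^{2P}`. -/
noncomputable def weight (P : Field) (z : SpaceTime) : ℝ := z.1 * Real.exp (2 * P.val z)

/-- The essential equations as conservation laws, associated with two Killing fields of the
hyperbolic plane: `t e^{2P} DQ` and `t (DP - e^{2P} Q DQ)` are divergence free. -/
structure DivForm (I : Set ℝ) (P Q : Field) : Prop where
  flux_Q : FluxEq I (fun z => weight P z * Q.dt z) (fun z => weight P z * Q.dx z) 0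
  flux_P : FluxEq I (fun z => z.1 * P.dt z - weight P z * Q.val z * Q.dt z)
    (fun z => z.1 * P.dx z - weight P z * Q.val z * Q.dx z) 0

section Equivalence

variable {I : Set ℝ} {P Q : Field}

lemma contDiff_exp_mul (c : ℝ) : ContDiff ℝ ∞ fun x : ℝ => Real.exp (c * x) :=
  Real.contDiff_exp.comp (contDiff_const.mul contDiff_id)

lemma deriv_exp_mul (c x : ℝ) : deriv (fun x : ℝ => Real.exp (c * x)) x = c * Real.exp (c * x) := by
  have h : HasDerivAt (fun x : ℝ => c * x) c x := by simpa using (hasDerivAt_id x).const_mul c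
  rw [h.exp.deriv, mul_comm]

lemma locL1_sourceP (hI : I.OrdConnected) (hI0 : I ⊆ Ioi 0) (hP : IsRegular I 2 P)
    (hQ : IsRegular I 2 Q) : LocL1 I (sourceP P Q) := by
  have h1 := LocL1.coeff_mul (F := fun p => -p.1⁻¹) hI hI0 hP hQ
    (ContinuousOn.neg (continuousOn_fst.inv₀ fun p hp => (ne_of_gt hp : p.1 ≠ 0)))
    hP.dt_mem.locL2.locL1
  have h2 := LocL1.coeff_mul (F := fun p => Real.exp (2 * p.2.1)) hI hI0 hP hQ
    (by fun_prop) ((hQ.dt_mem.locL2.mul hQ.dt_mem.locL2).sub (hQ.dx_mem.locL2.mul hQ.dx_mem.locL2))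
  refine (h1.add h2).congr fun z _ => ?_
  simp only [sourceP]; ring

lemma locL1_sourceQ (hI : I.OrdConnected) (hI0 : I ⊆ Ioi 0) (hP : IsRegular I 2 P)
    (hQ : IsRegular I 2 Q) : LocL1 I (sourceQ P Q) := by
  have h1 := LocL1.coeff_mul (F := fun p => -p.1⁻¹) hI hI0 hP hQ
    (ContinuousOn.neg (continuousOn_fst.inv₀ fun p hp => (ne_of_gt hp : p.1 ≠ 0)))
    hQ.dt_mem.locL2.locL1
  have h2 := LocL1.coeff_mul (F := fun _ => 2) hI hI0 hP hQ
    continuousOn_const ((hP.dt_mem.locL2.mul hQ.dt_mem.locL2).sub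
      (hP.dx_mem.locL2.mul hQ.dx_mem.locL2))
  refine (h1.sub h2).congr fun z _ => ?_
  simp only [sourceQ]; ring

lemma locL2_weight (hI : I.OrdConnected) (hI0 : I ⊆ Ioi 0) (hP : IsRegular I 2 P)
    (hQ : IsRegular I 2 Q) {A : SpaceTime → ℝ} (hA : LocL2 I A) :
    LocL2 I (fun z => weight P z * A z) :=
  LocL2.coeff_mul (F := fun p => p.1 * Real.exp (2 * p.2.1)) hI hI0 hP hQ (by fun_prop) hA

lemma locL2_weight_mul (hI : I.OrdConnected) (hI0 : I ⊆ Ioi 0) (hP : IsRegular I 2 P)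
    (hQ : IsRegular I 2 Q) {A B : SpaceTime → ℝ} (hA : LocL2 I A) (hB : LocL2 I B) :
    LocL2 I (fun z => z.1 * A z - weight P z * Q.val z * B z) :=
  (LocL2.coeff_mul (F := fun p => p.1) hI hI0 hP hQ (by fun_prop) hA).sub
    (LocL2.coeff_mul (F := fun p => p.1 * Real.exp (2 * p.2.1) * p.2.2) hI hI0 hP hQ
      (by fun_prop) hB)

lemma IsTest.time_mul {φ : SpaceTime → ℝ} (hφ : IsTest I φ) : IsTest I (fun z => z.1 * φ z) :=
  hφ.mul_smooth (SmoothL.time contDiff_id)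

lemma IsTest.pdt_time_mul {φ : SpaceTime → ℝ} (hφ : IsTest I φ) (z : SpaceTime) :
    Gowdy.pdt (fun z => z.1 * φ z) z = φ z + z.1 * Gowdy.pdt φ z := by
  have := (SmoothL.time (f := fun t => t) contDiff_id).pdt_mul hφ.smoothL z
  rw [this, pdt_time fun t => t]
  simp

lemma IsTest.pdx_time_mul {φ : SpaceTime → ℝ} (hφ : IsTest I φ) (z : SpaceTime) :
    Gowdy.pdx (fun z => z.1 * φ z) z = z.1 * Gowdy.pdx φ z := by
  have := (SmoothL.time (f := fun t => t) contDiff_id).pdx_mul hφ.smoothL z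
  rw [this, pdx_time fun t => t]
  simp

lemma IsTest.time_inv_mul (hI : I.OrdConnected) (hI0 : I ⊆ Ioi 0) {φ : SpaceTime → ℝ}
    (hφ : IsTest I φ) : IsTest I (fun z => z.1⁻¹ * φ z) := by
  rcases hφ.exists_Icc hI with rfl | ⟨a, b, hab, hsub, h0⟩
  · simpa [Pi.zero_def] using hφ
  · have ha : 0 < a := hI0 (interior_subset (hsub (left_mem_Icc.2 hab)))
    refine SmoothL.isTest ?_ isCompact_Icc hsub fun z hz => by simp [h0 z hz]
    refine contDiff_iff_contDiffAt.2 fun p => ?_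
    by_cases hp : p.1 = 0
    · refine (contDiffAt_const (c := (0 : ℝ))).congr_of_eventuallyEq ?_
      have : ∀ᶠ q : ℝ × ℝ in 𝓝 p, q.1 < a :=
        continuous_fst.continuousAt.eventually_lt continuousAt_const (by rw [hp]; exact ha)
      filter_upwards [this] with q hq
      rw [h0 _ (fun h => not_lt.2 h.1 hq), mul_zero]
    · exact (contDiffAt_fst.inv hp).mul hφ.smooth.contDiffAt

lemma IsTest.pdt_time_inv_mul {φ : SpaceTime → ℝ} (hφ : IsTest I φ) {z : SpaceTime}
    (hz : z.1 ≠ 0) :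
    Gowdy.pdt (fun z => z.1⁻¹ * φ z) z = -(z.1 ^ 2)⁻¹ * φ z + z.1⁻¹ * Gowdy.pdt φ z :=
  ((hasDerivAt_inv hz).mul (hφ.smoothL.hasDerivAt_t z)).deriv

lemma IsTest.pdx_time_inv_mul {φ : SpaceTime → ℝ} (hφ : IsTest I φ) (z : SpaceTime) :
    Gowdy.pdx (fun z => z.1⁻¹ * φ z) z = z.1⁻¹ * Gowdy.pdx φ z :=
  ((hφ.smoothL.hasDerivAt_x z).const_mul z.1⁻¹).deriv

/-- The conservation laws arise by testing the equation for `Q` with `t e^{2P} φ` and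
`t e^{2P} Q φ`, and the one for `P` with `t φ`. -/
lemma IsEssentialSolution.divForm (hI : I.OrdConnected) (hI0 : I ⊆ Ioi 0)
    (h : IsEssentialSolution I P Q) : DivForm I P Q := by
  have hP := h.reg_P
  have hQ := h.reg_Q
  have fP : FluxEq I P.dt P.dx (sourceP P Q) :=
    WeakWave.fluxEq hI hP (locL1_sourceP hI hI0 hP hQ) h.wave_P
  have fQ : FluxEq I Q.dt Q.dx (sourceQ P Q) :=
    WeakWave.fluxEq hI hQ (locL1_sourceQ hI hI0 hP hQ) h.wave_Q
  have hne : ∀ z : SpaceTime, z.1 ∈ interior I → z.1 ≠ 0 := fun z hz =>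
    (hI0 (interior_subset hz)).ne'
  have hz0 : LocL1 I (0 : SpaceTime → ℝ) := fun a b _ => integrable_zero _ _ _
  refine ⟨⟨locL2_weight hI hI0 hP hQ hQ.dt_mem.locL2, locL2_weight hI hI0 hP hQ hQ.dx_mem.locL2,
    hz0, fun φ hφ => ?_⟩, ⟨locL2_weight_mul hI hI0 hP hQ hP.dt_mem.locL2 hQ.dt_mem.locL2,
      locL2_weight_mul hI hI0 hP hQ hP.dx_mem.locL2 hQ.dx_mem.locL2, hz0, fun φ hφ => ?_⟩⟩
  · refine (fQ.test hI hP hQ (contDiff_exp_mul 2) (contDiff_const (c := (1 : ℝ))) hφ.time_mul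
      (fun z hz => ?_) fun z hz => ?_).2
    · have := hne z hz
      simp only [hφ.pdt_time_mul, hφ.pdx_time_mul, deriv_exp_mul, deriv_const, sourceQ, weight,
        Pi.zero_apply]
      field_simp
      ring
    · simp [hφ.eq_zero hz, (hφ.pdt hI).eq_zero hz, (hφ.pdx hI).eq_zero hz]
  · have r1 := fP.test hI hP hQ (contDiff_const (c := (1 : ℝ))) (contDiff_const (c := (1 : ℝ)))
      hφ.time_mul (R := fun z => -(z.1 * P.dt z * pdt φ z) + z.1 * P.dx z * pdx φ z
        - weight P z * ((Q.dt z) ^ 2 - (Q.dx z) ^ 2) * φ z)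
      (fun z hz => by
        have := hne z hz
        simp only [hφ.pdt_time_mul, hφ.pdx_time_mul, deriv_const, sourceP, weight]
        field_simp
        ring)
      (fun z hz => by simp [hφ.eq_zero hz, (hφ.pdt hI).eq_zero hz, (hφ.pdx hI).eq_zero hz])
    have r2 := fQ.test hI hP hQ (contDiff_exp_mul 2) contDiff_id
      hφ.time_mul (R := fun z => -(weight P z * Q.val z * Q.dt z * pdt φ z)
        + weight P z * Q.val z * Q.dx z * pdx φ z
        - weight P z * ((Q.dt z) ^ 2 - (Q.dx z) ^ 2) * φ z)
      (fun z hz => by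
        have := hne z hz
        simp only [hφ.pdt_time_mul, hφ.pdx_time_mul, deriv_exp_mul, deriv_id, id, sourceQ, weight]
        field_simp
        ring)
      (fun z hz => by simp [hφ.eq_zero hz, (hφ.pdt hI).eq_zero hz, (hφ.pdx hI).eq_zero hz])
    have r3 := integral_sub r1.1 r2.1
    rw [r1.2, r2.2, sub_zero] at r3
    rw [← r3]
    congr 1
    funext z
    simp only [Pi.zero_apply]
    ring

/-- The converse of `IsEssentialSolution.divForm`: test the first conservation law with
`t⁻¹ e^{-2P} φ` and `t⁻¹ Q φ`, the second with `t⁻¹ φ`. -/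
lemma DivForm.essential (hI : I.OrdConnected) (hI0 : I ⊆ Ioi 0) (hP : IsRegular I 2 P)
    (hQ : IsRegular I 2 Q) (h : DivForm I P Q) : IsEssentialSolution I P Q := by
  have hne : ∀ z : SpaceTime, z.1 ∈ interior I → z.1 ≠ 0 := fun z hz =>
    (hI0 (interior_subset hz)).ne'
  refine ⟨hP, hQ, fun φ hφ => ?_, fun φ hφ => ?_⟩
  · have e := integral_residual hI hP.dt_mem.locL2 hP.dx_mem.locL2 (locL1_sourceP hI hI0 hP hQ) hφ
    have hφ' := hφ.time_inv_mul hI hI0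
    have r1 := h.flux_P.test hI hP hQ (contDiff_const (c := (1 : ℝ))) (contDiff_const (c := (1 : ℝ)))
      hφ' (R := fun z => (P.dt z - Real.exp (2 * P.val z) * Q.val z * Q.dt z)
          * (z.1⁻¹ * φ z - pdt φ z)
        + (P.dx z - Real.exp (2 * P.val z) * Q.val z * Q.dx z) * pdx φ z)
      (fun z hz => by
        have := hne z hz
        simp only [hφ.pdt_time_inv_mul this, hφ.pdx_time_inv_mul, deriv_const, weight, Pi.zero_apply]
        field_simp
        ring)
      (fun z hz => by simp [hφ.eq_zero hz, (hφ.pdt hI).eq_zero hz, (hφ.pdx hI).eq_zero hz])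
    have r2 := h.flux_Q.test hI hP hQ (contDiff_const (c := (1 : ℝ))) contDiff_id
      hφ' (R := fun z => Real.exp (2 * P.val z) * Q.val z * Q.dt z * (z.1⁻¹ * φ z - pdt φ z)
        + Real.exp (2 * P.val z) * Q.val z * Q.dx z * pdx φ z
        - Real.exp (2 * P.val z) * ((Q.dt z) ^ 2 - (Q.dx z) ^ 2) * φ z)
      (fun z hz => by
        have := hne z hz
        simp only [hφ.pdt_time_inv_mul this, hφ.pdx_time_inv_mul, deriv_const, deriv_id, id, weight,
          Pi.zero_apply]
        field_simp
        ring)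
      (fun z hz => by simp [hφ.eq_zero hz, (hφ.pdt hI).eq_zero hz, (hφ.pdx hI).eq_zero hz])
    have r3 := integral_add r1.1 r2.1
    rw [r1.2, r2.2, zero_add] at r3
    have e2 : ∫ z in slab I, (-(P.dt z * pdt φ z) + P.dx z * pdx φ z - sourceP P Q z * φ z) = 0 := by
      rw [← r3]
      congr 1
      funext z
      simp only [sourceP]
      ring
    rw [e2] at e
    exact sub_eq_zero.1 e.symm
  · have e := integral_residual hI hQ.dt_mem.locL2 hQ.dx_mem.locL2 (locL1_sourceQ hI hI0 hP hQ) hφ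
    have hφ' := hφ.time_inv_mul hI hI0
    have r := (h.flux_Q.test hI hP hQ (contDiff_exp_mul (-2)) (contDiff_const (c := (1 : ℝ)))
      hφ' (R := fun z => -(Q.dt z * pdt φ z) + Q.dx z * pdx φ z - sourceQ P Q z * φ z)
      (fun z hz => by
        have := hne z hz
        have hexp : Real.exp (-2 * P.val z) = (Real.exp (2 * P.val z))⁻¹ := by
          rw [← Real.exp_neg]; ring_nf
        have hpos := (Real.exp_pos (2 * P.val z)).ne'
        simp only [hφ.pdt_time_inv_mul this, hφ.pdx_time_inv_mul, deriv_exp_mul, deriv_const,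
          sourceQ, weight, Pi.zero_apply, hexp]
        field_simp
        ring)
      (fun z hz => by simp [hφ.eq_zero hz, (hφ.pdt hI).eq_zero hz, (hφ.pdx hI).eq_zero hz])).2
    rw [r] at e
    exact sub_eq_zero.1 e.symm

end Equivalence

/-! ### Weak compactness -/

section Hilbert

variable {H : Type*} [NormedAddCommGroup H] [InnerProductSpace ℝ H] [CompleteSpace H]
  [TopologicalSpace.SeparableSpace H]

/-- Bounded sequences in a separable Hilbert space have weakly convergent subsequences. -/
lemma exists_weak_subseq {x : ℕ → H} {M : ℝ} (hx : ∀ n, ‖x n‖ ≤ M) :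
    ∃ (y : H) (k : ℕ → ℕ), StrictMono k ∧
      ∀ g : H, Tendsto (fun n => inner ℝ (x (k n)) g) atTop (𝓝 (inner ℝ y g)) := by
  have h1 := WeakDual.isSeqCompact_closedBall ℝ H (0 : StrongDual ℝ H) M
  have h2 : ∀ n, StrongDual.toWeakDual (InnerProductSpace.toDual ℝ H (x n)) ∈
      WeakDual.toStrongDual ⁻¹' Metric.closedBall (0 : StrongDual ℝ H) M := by
    intro n
    simpa using hx n
  obtain ⟨y, -, k, hk, hy⟩ := h1 h2
  refine ⟨(InnerProductSpace.toDual ℝ H).symm (WeakDual.toStrongDual y), k, hk, fun g => ?_⟩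
  have h3 := ((WeakDual.eval_continuous g).tendsto y).comp hy
  rw [InnerProductSpace.toDual_symm_apply]
  exact h3

/-- Finitely many bounded sequences have weakly convergent subsequences along common indices. -/
lemma exists_weak_subseq_family {ι : Type*} (s : Finset ι) {x : ι → ℕ → H} {M : ℝ}
    (hx : ∀ i n, ‖x i n‖ ≤ M) :
    ∃ k : ℕ → ℕ, StrictMono k ∧ ∀ i ∈ s, ∃ y : H,
      ∀ g : H, Tendsto (fun n => inner ℝ (x i (k n)) g) atTop (𝓝 (inner ℝ y g)) := by
  classical
  induction s using Finset.induction_on with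
  | empty => exact ⟨id, strictMono_id, by simp⟩
  | insert i s _ ih =>
    obtain ⟨k, hk, h⟩ := ih
    obtain ⟨y, l, hl, hy⟩ := exists_weak_subseq (x := fun n => x i (k n)) fun n => hx i (k n)
    refine ⟨fun n => k (l n), hk.comp hl, fun j hj => ?_⟩
    rcases Finset.mem_insert.1 hj with rfl | hj
    · exact ⟨y, hy⟩
    · obtain ⟨z, hz⟩ := h j hj
      exact ⟨z, fun g => (hz g).comp hl.tendsto_atTop⟩

end Hilbert

lemma inner_toLp {α : Type*} [MeasurableSpace α] {μ : Measure α} {f g : α → ℝ} (hf : MemLp f 2 μ)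
    (hg : MemLp g 2 μ) : inner ℝ (hf.toLp f) (hg.toLp g) = ∫ z, f z * g z ∂μ := by
  rw [L2.inner_def]
  refine integral_congr_ae ?_
  filter_upwards [hf.coeFn_toLp, hg.coeFn_toLp] with z h1 h2
  rw [h1, h2]; simp [mul_comm]

/-- Norms in `L²` are lower semicontinuous for weak convergence. -/
lemma eLpNorm_le_of_weak {α : Type*} [MeasurableSpace α] {μ : Measure α} {a : ℕ → α → ℝ}
    {a₀ : α → ℝ} {c : ℝ≥0∞} (ha : ∀ n, MemLp (a n) 2 μ) (ha₀ : MemLp a₀ 2 μ)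
    (hc : ∀ n, eLpNorm (a n) 2 μ ≤ c)
    (h : Tendsto (fun n => ∫ z, a n z * a₀ z ∂μ) atTop (𝓝 (∫ z, a₀ z * a₀ z ∂μ))) :
    eLpNorm a₀ 2 μ ≤ c := by
  by_cases hct : c = ⊤
  · rw [hct]; exact le_top
  set X := (eLpNorm a₀ 2 μ).toReal with hX
  have hX0 : 0 ≤ X := ENNReal.toReal_nonneg
  have e : ∫ z, a₀ z * a₀ z ∂μ = X * X := by
    rw [← inner_toLp ha₀ ha₀, real_inner_self_eq_norm_mul_norm, Lp.norm_toLp]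
  rw [e] at h
  have h1 : X * X ≤ c.toReal * X := by
    refine le_of_tendsto' h fun n => (le_abs_self _).trans ((abs_integral_mul_le (ha n) ha₀).trans ?_)
    exact mul_le_mul_of_nonneg_right (ENNReal.toReal_mono hct (hc n)) hX0
  have h2 : X ≤ c.toReal := by
    rcases hX0.eq_or_lt with h0 | h0
    · rw [← h0]; exact ENNReal.toReal_nonneg
    · exact le_of_mul_le_mul_right h1 h0
  exact (ENNReal.toReal_le_toReal ha₀.2.ne hct).1 h2

/-- Weak limits inherit bounds in `L^∞(L²)`. -/
lemma mixedNorm_le_of_weak {J : Set ℝ} (hJ : MeasurableSet J) (hJv : volume J < ⊤)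
    {u : ℕ → SpaceTime → ℝ} {v : SpaceTime → ℝ} (h : WeakL2 J u v) {M : ℝ≥0∞} (hM : M ≠ ⊤)
    (hu : ∀ n, mixedNorm J 2 (u n) ≤ M) : mixedNorm J 2 v ≤ M := by
  have hv := h.mem_lim
  have key : ∀ E : Set ℝ, MeasurableSet E → E ⊆ J →
      ∫⁻ z in slab E, ‖v z‖ₑ ^ 2 ≤ M ^ 2 * volume E := by
    intro E hE hEJ
    have hsub := slab_mono hEJ
    have hle : (volume.restrict (slab E) : Measure SpaceTime) ≤ volume.restrict (slab J) :=
      Measure.restrict_mono_set _ hsub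
    have hmE := measurableSet_slab hE
    have hvE := hv.mono_measure hle
    have hfin : M ^ 2 * volume E ≠ ⊤ :=
      ENNReal.mul_ne_top (ENNReal.pow_ne_top hM) ((measure_mono hEJ).trans_lt hJv).ne
    have hsq : ((M ^ 2 * volume E) ^ (1 / 2 : ℝ)) ^ 2 = M ^ 2 * volume E := by
      rw [← ENNReal.rpow_natCast, ← ENNReal.rpow_mul]; norm_num
    have h1 : eLpNorm v 2 (volume.restrict (slab E)) ≤ (M ^ 2 * volume E) ^ (1 / 2 : ℝ) := by
      refine eLpNorm_le_of_weak (a := u) (fun n => (h.mem n).mono_measure hle) hvE (fun n => ?_) ?_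
      · refine eLpNorm_two_le ?_
        rw [hsq]
        refine (lintegral_slab_sq_le ((h.mem n).mono_measure hle).1).trans ?_
        gcongr
        exact (mixedNorm_mono hEJ _ _).trans (hu n)
      · have h2 := h.tendsto ((slab E).indicator v) (hv.indicator hmE)
        have e : ∀ w : SpaceTime → ℝ, ∫ z in slab J, w z * (slab E).indicator v z
            = ∫ z in slab E, w z * v z := by
          intro w
          have : (fun z => w z * (slab E).indicator v z) = (slab E).indicator fun z => w z * v z := by
            funext z
            by_cases hz : z ∈ slab E <;> simp [hz]
          rw [this, setIntegral_indicator hmE, inter_eq_right.2 hsub]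
        simpa only [e] using h2
    rw [← eLpNorm_two_sq, ← hsq]
    gcongr
  have hvm := hv.1
  rw [restrict_slab] at hvm
  have hmeas : AEMeasurable (fun t => ∫⁻ θ : UnitAddCircle, ‖v (t, θ)‖ₑ ^ 2) (volume.restrict J) :=
    (hvm.enorm.pow_const 2).lintegral_prod_right'
  have hae : (fun t => ∫⁻ θ : UnitAddCircle, ‖v (t, θ)‖ₑ ^ 2) ≤ᵐ[volume.restrict J] fun _ => M ^ 2 := by
    refine ae_le_of_forall_setLIntegral_le_of_sigmaFinite₀ hmeas fun s hs _ => ?_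
    rw [Measure.restrict_restrict hs]
    have hEm : MeasurableSet (s ∩ J) := hs.inter hJ
    have h1 := key (s ∩ J) hEm inter_subset_right
    rw [restrict_slab, lintegral_prod] at h1
    · simpa using h1
    · refine (hvm.mono_measure ?_).enorm.pow_const 2
      exact Measure.prod_mono (Measure.restrict_mono_set _ inter_subset_right) le_rfl
  refine essSup_le_of_ae_le _ ?_
  filter_upwards [hae] with t ht
  exact eLpNorm_two_le ht

/-- The weight `e^{-t}`, integrable over an unbounded `I` as well, embeds `L^∞(I, L²)` into `L²`. -/
lemma lintegral_weight_sq_le {I : Set ℝ} (hI0 : I ⊆ Ioi 0) {u : SpaceTime → ℝ}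
    (hu : AEStronglyMeasurable u (volume.restrict (slab I))) :
    ∫⁻ z in slab I, ‖Real.exp (-z.1) * u z‖ₑ ^ 2 ≤ mixedNorm I 2 u ^ 2 := by
  have hexp : ∫⁻ t in Ioi (0 : ℝ), ENNReal.ofReal (Real.exp (-t)) = 1 := by
    rw [← ofReal_integral_eq_lintegral_ofReal (integrableOn_exp_neg_Ioi 0)
      (.of_forall fun t => (Real.exp_pos _).le), integral_exp_neg_Ioi_zero, ENNReal.ofReal_one]
  have hm : AEStronglyMeasurable (fun z : SpaceTime => Real.exp (-z.1) * u z)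
      (volume.restrict (slab I)) :=
    (Real.continuous_exp.comp continuous_fst.neg).aestronglyMeasurable.mul hu
  rw [restrict_slab] at hm ⊢
  rw [lintegral_prod _ (hm.enorm.pow_const 2)]
  have hb : ∀ᵐ t ∂(volume.restrict I), ∫⁻ θ : UnitAddCircle, ‖Real.exp (-t) * u (t, θ)‖ₑ ^ 2
      ≤ mixedNorm I 2 u ^ 2 * ENNReal.ofReal (Real.exp (-t)) := by
    have hIpos : ∀ᵐ t ∂(volume.restrict I), 0 < t := by
      have : ∀ᵐ t ∂(volume.restrict (Ioi (0 : ℝ))), 0 < t := ae_restrict_mem measurableSet_Ioi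
      exact (Measure.restrict_mono_set _ hI0).absolutelyContinuous.ae_le this
    filter_upwards [ae_eLpNorm_le_mixedNorm I 2 u, hIpos] with t ht ht0
    have e1 : ∀ θ : UnitAddCircle, ‖Real.exp (-t) * u (t, θ)‖ₑ ^ 2
        = ENNReal.ofReal (Real.exp (-t)) ^ 2 * ‖u (t, θ)‖ₑ ^ 2 := by
      intro θ
      rw [enorm_mul, mul_pow, Real.enorm_eq_ofReal (Real.exp_pos _).le]
    simp_rw [e1]
    rw [lintegral_const_mul' _ _ (by finiteness), ← eLpNorm_two_sq, mul_comm]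
    gcongr
    have : ENNReal.ofReal (Real.exp (-t)) ≤ 1 := ENNReal.ofReal_le_one.2 (Real.exp_le_one_iff.2 (by linarith))
    calc ENNReal.ofReal (Real.exp (-t)) ^ 2
        = ENNReal.ofReal (Real.exp (-t)) * ENNReal.ofReal (Real.exp (-t)) := sq _
      _ ≤ ENNReal.ofReal (Real.exp (-t)) * 1 := by gcongr
      _ = _ := mul_one _
  calc _ ≤ ∫⁻ t in I, mixedNorm I 2 u ^ 2 * ENNReal.ofReal (Real.exp (-t)) := lintegral_mono_ae hb
    _ = mixedNorm I 2 u ^ 2 * ∫⁻ t in I, ENNReal.ofReal (Real.exp (-t)) := by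
        rw [lintegral_const_mul _ (by fun_prop)]
    _ ≤ mixedNorm I 2 u ^ 2 * 1 := by
        gcongr
        rw [← hexp]
        exact lintegral_mono_set hI0
    _ = _ := mul_one _

/-- Families of sequences bounded in `L^∞(I, L²)` have a common subsequence converging weakly in `L²`
on all bounded time intervals. The weight `e^{-t}` reduces this to weak compactness in one Hilbert
space. -/
lemma exists_weakL2_subseq {I : Set ℝ} (hI0 : I ⊆ Ioi 0) {ι : Type*} (s : Finset ι)
    {u : ι → ℕ → SpaceTime → ℝ} {M : ℝ≥0∞} (hM : M ≠ ⊤)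
    (hu : ∀ i n, AEStronglyMeasurable (u i n) (volume.restrict (slab I)))
    (hb : ∀ i n, mixedNorm I 2 (u i n) ≤ M) :
    ∃ k : ℕ → ℕ, StrictMono k ∧ ∀ i ∈ s, ∃ v : SpaceTime → ℝ,
      AEStronglyMeasurable v (volume.restrict (slab I)) ∧
      ∀ J : Set ℝ, J ⊆ I → J.OrdConnected → Bornology.IsBounded J →
        WeakL2 J (fun n => u i (k n)) v := by
  set ν : Measure SpaceTime := volume.restrict (slab I) with hν
  have hκ : Continuous fun z : SpaceTime => Real.exp (-z.1) :=
    Real.continuous_exp.comp continuous_fst.neg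
  have hκ' : Continuous fun z : SpaceTime => Real.exp z.1 :=
    Real.continuous_exp.comp continuous_fst
  have hle : ∀ i n, eLpNorm (fun z => Real.exp (-z.1) * u i n z) 2 ν ≤ M := fun i n =>
    eLpNorm_two_le ((lintegral_weight_sq_le hI0 (hu i n)).trans (by gcongr; exact hb i n))
  have hmem : ∀ i n, MemLp (fun z => Real.exp (-z.1) * u i n z) 2 ν := fun i n =>
    ⟨hκ.aestronglyMeasurable.mul (hu i n), (hle i n).trans_lt hM.lt_top⟩
  have : Fact ((2 : ℝ≥0∞) ≠ ⊤) := ⟨by norm_num⟩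
  have : TopologicalSpace.SeparableSpace (Lp ℝ 2 ν) := by
    have : SecondCountableTopology (Lp ℝ 2 ν) := inferInstance
    infer_instance
  obtain ⟨k, hk, h⟩ := exists_weak_subseq_family s (H := Lp ℝ 2 ν) (M := M.toReal)
    (x := fun i n => (hmem i n).toLp _) fun i n => by
      rw [Lp.norm_toLp]; exact ENNReal.toReal_mono hM (hle i n)
  refine ⟨k, hk, fun i hi => ?_⟩
  obtain ⟨y, hy⟩ := h i hi
  refine ⟨fun z => Real.exp z.1 * y z, hκ'.aestronglyMeasurable.mul (Lp.memLp y).1, ?_⟩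
  intro J hJI hJo hJb
  have hsub := slab_mono hJI
  have hmJ : MeasurableSet (slab J) := measurableSet_slab hJo.measurableSet
  obtain ⟨T, hT⟩ := hJb.exists_norm_le
  have hle' : (volume.restrict (slab J) : Measure SpaceTime) ≤ ν := Measure.restrict_mono_set _ hsub
  have hexpb : ∀ᵐ z ∂(volume.restrict (slab J) : Measure SpaceTime), |Real.exp z.1| ≤ Real.exp T := by
    filter_upwards [ae_restrict_mem hmJ] with z hz
    rw [abs_of_pos (Real.exp_pos _)]
    exact Real.exp_le_exp.2 ((le_abs_self _).trans (hT _ (mem_slab.1 hz)))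
  refine ⟨fun n => ?_, ?_, fun g hg => ?_⟩
  · exact memLp_slab ((hu i (k n)).mono_measure hle')
      (((mixedNorm_mono hJI _ _).trans (hb i _)).trans_lt hM.lt_top) hJb.measure_lt_top
  · exact MemLp.bdd_mul ((Lp.memLp y).mono_measure hle') hκ'.aestronglyMeasurable hexpb
  · have hG : MemLp ((slab J).indicator fun z => Real.exp z.1 * g z) 2 ν := by
      rw [memLp_indicator_iff_restrict hmJ, hν, Measure.restrict_restrict hmJ,
        inter_eq_left.2 hsub]
      exact MemLp.bdd_mul hg hκ'.aestronglyMeasurable hexpb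
    have h1 := hy (hG.toLp _)
    have e0 : ∀ w : SpaceTime → ℝ,
        ∫ z, w z * (slab J).indicator (fun z => Real.exp z.1 * g z) z ∂ν
          = ∫ z in slab J, Real.exp z.1 * w z * g z := by
      intro w
      have : (fun z => w z * (slab J).indicator (fun z => Real.exp z.1 * g z) z)
          = (slab J).indicator fun z => Real.exp z.1 * w z * g z := by
        funext z
        by_cases hz : z ∈ slab J
        · simp [hz]; ring
        · simp [hz]
      rw [this, hν, setIntegral_indicator hmJ, inter_eq_right.2 hsub]
    have e1 : ∀ n, inner ℝ ((hmem i (k n)).toLp _) (hG.toLp _) = ∫ z in slab J, u i (k n) z * g z := by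
      intro n
      rw [inner_toLp, e0]
      congr 1
      funext z
      rw [← mul_assoc, ← Real.exp_add]; simp
    have e2 : inner ℝ y (hG.toLp _) = ∫ z in slab J, Real.exp z.1 * y z * g z := by
      rw [← e0, ← inner_toLp (Lp.memLp y) hG, Lp.toLp_coeFn]
    rw [e2] at h1
    exact h1.congr e1

/-! ### Strong convergence of bounded sequences of regular fields -/

lemma WeakL2.tendsto_of_slab {J : Set ℝ} {u : ℕ → SpaceTime → ℝ} {v : SpaceTime → ℝ}
    (h : WeakL2 J u v) {g : SpaceTime → ℝ} (hg : MemLp g 2 volume) :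
    Tendsto (fun n => ∫ z in slab J, u n z * g z) atTop (𝓝 (∫ z in slab J, v z * g z)) :=
  h.tendsto g (hg.restrict _)

lemma IsCutoff.eLpNorm_le {I : Set ℝ} {a b a' b' : ℝ} {η : ℝ → ℝ} (hη : IsCutoff I a b a' b' η)
    {u : SpaceTime → ℝ} (hu : LinfLoc I 2 u) {κ : ℝ → ℝ} (hκ0 : ∀ t, t ∉ Icc a' b' → κ t = 0)
    {D : ℝ} (hκ : ∀ t, |κ t| ≤ D) {M : ℝ≥0∞} (hM : mixedNorm (Icc a' b') 2 u ≤ M) :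
    eLpNorm (fun z : SpaceTime => κ z.1 * u z) 2 volume
      ≤ ENNReal.ofReal D * (M * ENNReal.ofReal (b' - a') ^ (1 / 2 : ℝ)) := by
  have hm := (hu.memLp (hη.sub.trans interior_subset)).1
  have h1 : eLpNorm (fun z : SpaceTime => κ z.1 * u z) 2 volume
      ≤ ENNReal.ofReal D * eLpNorm u 2 (volume.restrict (slab (Icc a' b'))) := by
    have e : (fun z : SpaceTime => κ z.1 * u z)
        = (slab (Icc a' b')).indicator fun z : SpaceTime => κ z.1 * u z := by
      symm
      refine indicator_eq_self.2 fun z hz => mem_slab.2 (by_contra fun hc => hz ?_)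
      simp [hκ0 _ hc]
    rw [e, eLpNorm_indicator_eq_eLpNorm_restrict (measurableSet_slab measurableSet_Icc)]
    refine eLpNorm_le_mul_eLpNorm_of_ae_le_mul (.of_forall fun z => ?_) 2
    rw [norm_mul]
    exact mul_le_mul_of_nonneg_right (hκ _) (norm_nonneg _)
  refine h1.trans ?_
  gcongr
  refine eLpNorm_two_le ((lintegral_slab_sq_le hm).trans ?_)
  rw [mul_pow, ← ENNReal.rpow_natCast (ENNReal.ofReal _ ^ _), ← ENNReal.rpow_mul]
  rw [Real.volume_Icc]
  norm_num
  gcongr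

/-- Rellich's theorem for sequences bounded in `L^∞(H¹) ∩ W^{1,∞}(L²)`: the mollifications at a fixed
scale converge pointwise, and the mollification error is uniformly small. -/
lemma tendsto_eLpNorm_of_weak {I : Set ℝ} (hI : I.OrdConnected) {u : ℕ → Field} {v : Field}
    (hu : ∀ n, IsRegular I 2 (u n)) (hv : IsRegular I 2 v) {M : ℝ≥0∞} (hM : M ≠ ⊤)
    (h1 : ∀ n, mixedNorm I 2 (u n).val ≤ M) (h2 : ∀ n, mixedNorm I 2 (u n).dt ≤ M)
    (h3 : ∀ n, mixedNorm I 2 (u n).dx ≤ M)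
    (hw : ∀ a b, Icc a b ⊆ I → WeakL2 (Icc a b) (fun n => (u n).val) v.val)
    {a b : ℝ} (hab : a ≤ b) (h : Icc a b ⊆ interior I) :
    Tendsto (fun n => eLpNorm (fun z => (u n).val z - v.val z) 2 (volume.restrict (slab (Icc a b))))
      atTop (𝓝 0) := by
  obtain ⟨a', b', η, hη⟩ := exists_cutoff hI hab h
  obtain ⟨D, hD⟩ := hη.exists_deriv_bound
  have hsub := hη.sub.trans interior_subset
  have hη1 : ∀ t, |η t| ≤ 1 := fun t => abs_le.2 ⟨by linarith [(hη.range t).1], (hη.range t).2⟩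
  have hms : MeasurableSet (slab (Icc a b)) := measurableSet_slab measurableSet_Icc
  set L := M * ENNReal.ofReal (b' - a') ^ (1 / 2 : ℝ) with hL
  have hLfin : L ≠ ⊤ := ENNReal.mul_ne_top hM (by finiteness)
  set N := ENNReal.ofReal 1 * L + ENNReal.ofReal D * L + ENNReal.ofReal 1 * L with hN
  have hNfin : N ≠ ⊤ := by finiteness
  have hmixed : ∀ {g : SpaceTime → ℝ}, mixedNorm I 2 g ≤ M → mixedNorm (Icc a' b') 2 g ≤ M :=
    fun hg => (mixedNorm_mono hsub _ _).trans hg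
  set p : ℕ → SpaceTime → ℝ := fun n z => η z.1 * (u n).val z with hp
  set p₀ : SpaceTime → ℝ := fun z => η z.1 * v.val z with hp₀
  have g := fun n => hη.weakGrad hI (hu n)
  have g₀ := hη.weakGrad hI hv
  have hgrad : ∀ n, eLpNorm (fun z => η z.1 * (u n).dt z + deriv η z.1 * (u n).val z) 2 volume
      + eLpNorm (fun z => η z.1 * (u n).dx z) 2 volume ≤ N := by
    intro n
    refine add_le_add ((eLpNorm_add_le (hη.memLp (hu n).dt_mem).1 (hη.memLp_deriv (hu n).val_mem).1
      (by norm_num)).trans (add_le_add ?_ ?_)) ?_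
    · exact hη.eLpNorm_le (hu n).dt_mem hη.zero hη1 (hmixed (h2 n))
    · exact hη.eLpNorm_le (hu n).val_mem (fun t ht => hη.deriv_eq_zero ht) hD (hmixed (h1 n))
    · exact hη.eLpNorm_le (hu n).dx_mem hη.zero hη1 (hmixed (h3 n))
  set N₀ := eLpNorm (fun z => η z.1 * v.dt z + deriv η z.1 * v.val z) 2 volume
      + eLpNorm (fun z => η z.1 * v.dx z) 2 volume with hN₀
  have hN₀fin : N₀ ≠ ⊤ := ENNReal.add_ne_top.2 ⟨(hη.memLp_dt hv).2.ne, (hη.memLp hv.dx_mem).2.ne⟩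
  -- convergence of the mollifications at a fixed scale
  have hfix : ∀ {δ : ℝ} {ρ : SpaceTime → ℝ}, IsKernel δ ρ → Tendsto (fun n =>
      eLpNorm (fun z => moll ρ (p n) z - moll ρ p₀ z) 2 (volume.restrict (slab (Icc a b))))
      atTop (𝓝 0) := by
    intro δ ρ hρ
    have hpt : ∀ z, Tendsto (fun n => moll ρ (p n) z) atTop (𝓝 (moll ρ p₀ z)) := by
      intro z
      have hsm : SmoothL fun w => η w.1 * ρ (z - w) :=
        (SmoothL.time hη.smooth).mul (hρ.smooth.reflect z)
      have ht : IsTest I fun w => η w.1 * ρ (z - w) :=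
        hsm.isTest isCompact_Icc hη.sub fun w hw => by simp [hη.zero _ hw]
      have h4 := (hw a' b' hsub).tendsto_of_slab (ht.memLp 2)
      have e : ∀ f : SpaceTime → ℝ, ∫ w in slab (Icc a' b'), f w * (η w.1 * ρ (z - w))
          = moll ρ (fun w => η w.1 * f w) z := by
        intro f
        rw [setIntegral_eq_integral_of_forall_compl_eq_zero, moll]
        · congr 1; funext w; ring
        · intro w hw
          rw [hη.zero _ fun hc => hw (mem_slab.2 hc)]; ring
      simpa only [e] using h4
    have hbd : ∀ n z, |moll ρ (p n) z|
        ≤ (eLpNorm ρ 2 volume).toReal * (ENNReal.ofReal 1 * L).toReal := by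
      intro n z
      have e1 : eLpNorm (fun w => ρ (z - w)) 2 volume = eLpNorm ρ 2 volume :=
        eLpNorm_comp_measurePreserving (hρ.isTest.memLp 2).1
          (Measure.measurePreserving_sub_left volume z)
      refine (abs_integral_mul_le ((hρ.isTest.reflect z).memLp 2) (hη.memLp (hu n).val_mem)).trans ?_
      rw [e1]
      refine mul_le_mul_of_nonneg_left (ENNReal.toReal_mono (by finiteness) ?_) ENNReal.toReal_nonneg
      exact hη.eLpNorm_le (hu n).val_mem hη.zero hη1 (hmixed (h1 n))
    have h5 := tendsto_eLpNorm_bdd (μ := volume.restrict (slab (Icc a b)))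
      (m := fun n => moll ρ (p n)) (m₀ := moll ρ p₀) (g := fun _ => (1 : ℝ))
      (fun n => (SmoothL.moll hρ.isTest (g n).int).continuous.aestronglyMeasurable)
      (fun n => .of_forall (hbd n)) (.of_forall hpt) (memLp_const 1)
    simpa only [mul_one] using h5
  rw [ENNReal.tendsto_nhds_zero]
  intro ε hε
  obtain ⟨δ, hδ, hδε⟩ : ∃ δ : ℝ, 0 < δ ∧ ENNReal.ofReal δ * (N + N₀) ≤ ε / 2 := by
    have : Tendsto (fun δ : ℝ => ENNReal.ofReal δ * (N + N₀)) (𝓝[>] 0) (𝓝 0) := by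
      have h6 : Tendsto (fun δ : ℝ => ENNReal.ofReal δ * (N + N₀)) (𝓝 0)
          (𝓝 (ENNReal.ofReal 0 * (N + N₀))) :=
        ENNReal.Tendsto.mul_const (ENNReal.continuous_ofReal.tendsto 0)
          (Or.inr (ENNReal.add_ne_top.2 ⟨hNfin, hN₀fin⟩))
      rw [ENNReal.ofReal_zero, zero_mul] at h6
      exact h6.mono_left nhdsWithin_le_nhds
    have h7 := (ENNReal.tendsto_nhds_zero.1 this) (ε / 2) (ENNReal.half_pos hε.ne')
    obtain ⟨δ, h8, h9⟩ := (h7.and self_mem_nhdsWithin).exists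
    exact ⟨δ, h9, h8⟩
  obtain ⟨ρ, hρ⟩ := exists_isKernel hδ
  filter_upwards [(ENNReal.tendsto_nhds_zero.1 (hfix hρ)) (ε / 2) (ENNReal.half_pos hε.ne')] with n hn
  have a1 : AEStronglyMeasurable (moll ρ (p n)) volume :=
    (SmoothL.moll hρ.isTest (g n).int).continuous.aestronglyMeasurable
  have a2 : AEStronglyMeasurable (moll ρ p₀) volume :=
    (SmoothL.moll hρ.isTest g₀.int).continuous.aestronglyMeasurable
  have a3 : AEStronglyMeasurable (p n) volume := (g n).int.aestronglyMeasurable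
  have a4 : AEStronglyMeasurable p₀ volume := g₀.int.aestronglyMeasurable
  have b1 := (g n).eLpNorm_moll_sub_le (hη.memLp (hu n).val_mem) (hη.memLp_dt (hu n))
    (hη.memLp (hu n).dx_mem) hρ
  have b2 := g₀.eLpNorm_moll_sub_le (hη.memLp hv.val_mem) (hη.memLp_dt hv)
    (hη.memLp hv.dx_mem) hρ
  have e1 : eLpNorm (fun z => (u n).val z - v.val z) 2 (volume.restrict (slab (Icc a b)))
      = eLpNorm (-(fun z => moll ρ (p n) z - p n z) + ((fun z => moll ρ (p n) z - moll ρ p₀ z)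
        + fun z => moll ρ p₀ z - p₀ z)) 2 (volume.restrict (slab (Icc a b))) := by
    refine eLpNorm_congr_ae ?_
    filter_upwards [ae_restrict_mem hms] with z hz
    simp only [Pi.add_apply, Pi.neg_apply, hp, hp₀, hη.one _ (mem_slab.1 hz)]
    ring
  have c1 : AEStronglyMeasurable (fun z => moll ρ (p n) z - p n z)
    (volume.restrict (slab (Icc a b))) := (a1.sub a3).restrict
  have c2 : AEStronglyMeasurable (fun z => moll ρ (p n) z - moll ρ p₀ z)
    (volume.restrict (slab (Icc a b))) := (a1.sub a2).restrict
  have c3 : AEStronglyMeasurable (fun z => moll ρ p₀ z - p₀ z)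
    (volume.restrict (slab (Icc a b))) := (a2.sub a4).restrict
  rw [e1]
  calc _ ≤ ENNReal.ofReal δ * N + (ε / 2 + ENNReal.ofReal δ * N₀) := by
        refine (eLpNorm_add_le c1.neg (c2.add c3) (by norm_num)).trans (add_le_add ?_ ?_)
        · rw [eLpNorm_neg]
          refine (eLpNorm_mono_measure _ Measure.restrict_le_self).trans (b1.trans ?_)
          gcongr
          exact hgrad n
        · refine (eLpNorm_add_le c2 c3 (by norm_num)).trans (add_le_add hn ?_)
          exact (eLpNorm_mono_measure _ Measure.restrict_le_self).trans b2
    _ = ENNReal.ofReal δ * (N + N₀) + ε / 2 := by ring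
    _ ≤ ε / 2 + ε / 2 := by gcongr
    _ = ε := ENNReal.add_halves ε

/-! ### Passage to the limit in the essential equations -/

section Limit

variable {I : Set ℝ}

lemma LocL1.locallyIntegrableOn {f : SpaceTime → ℝ} (hf : LocL1 I f) :
    LocallyIntegrableOn f (slab (interior I)) := by
  intro z hz
  obtain ⟨a, b, hz', hab⟩ := exists_Icc_mem_subset_of_mem_nhds
    (isOpen_interior.mem_nhds (mem_slab.1 hz))
  refine ⟨slab (Icc a b), mem_nhdsWithin_of_mem_nhds ?_, hf a b hab.2⟩
  exact prod_mem_nhds hab.1 univ_mem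

lemma WeakL2.sub {J : Set ℝ} {u u' : ℕ → SpaceTime → ℝ} {v v' : SpaceTime → ℝ}
    (h : WeakL2 J u v) (h' : WeakL2 J u' v') :
    WeakL2 J (fun n z => u n z - u' n z) fun z => v z - v' z := by
  refine ⟨fun n => (h.mem n).sub (h'.mem n), h.mem_lim.sub h'.mem_lim, fun g hg => ?_⟩
  have e : ∀ {f f' : SpaceTime → ℝ}, MemLp f 2 (volume.restrict (slab J)) →
      MemLp f' 2 (volume.restrict (slab J)) → ∫ z in slab J, (f z - f' z) * g z
        = (∫ z in slab J, f z * g z) - ∫ z in slab J, f' z * g z := fun hf hf' => by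
    rw [← integral_sub (integrable_mul_of_memLp hf hg) (integrable_mul_of_memLp hf' hg)]
    simp only [sub_mul]
  rw [e h.mem_lim h'.mem_lim]
  exact ((h.tendsto g hg).sub (h'.tendsto g hg)).congr fun n => (e (h.mem n) (h'.mem n)).symm

lemma WeakL2.subseq {J : Set ℝ} {u : ℕ → SpaceTime → ℝ} {v : SpaceTime → ℝ} (h : WeakL2 J u v)
    {k : ℕ → ℕ} (hk : StrictMono k) : WeakL2 J (fun n => u (k n)) v :=
  ⟨fun n => h.mem (k n), h.mem_lim, fun g hg => (h.tendsto g hg).comp hk.tendsto_atTop⟩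

/-- Products of bounded sequences converging almost everywhere and weakly convergent ones. -/
lemma WeakL2.coeff_mul {a b : ℝ} {p q : ℕ → SpaceTime → ℝ} {p₀ q₀ : SpaceTime → ℝ}
    {F : ℝ × ℝ × ℝ → ℝ} (hF : Continuous F) {C : ℝ} {M : ℝ≥0∞} (hM : M ≠ ⊤)
    {u : ℕ → SpaceTime → ℝ} {v : SpaceTime → ℝ}
    (hpm : ∀ n, AEStronglyMeasurable (p n) (volume.restrict (slab (Icc a b))))
    (hqm : ∀ n, AEStronglyMeasurable (q n) (volume.restrict (slab (Icc a b))))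
    (hp : ∀ n, ∀ᵐ z ∂(volume.restrict (slab (Icc a b))), |p n z| ≤ C)
    (hq : ∀ n, ∀ᵐ z ∂(volume.restrict (slab (Icc a b))), |q n z| ≤ C)
    (hp₀ : ∀ᵐ z ∂(volume.restrict (slab (Icc a b))), Tendsto (fun n => p n z) atTop (𝓝 (p₀ z)))
    (hq₀ : ∀ᵐ z ∂(volume.restrict (slab (Icc a b))), Tendsto (fun n => q n z) atTop (𝓝 (q₀ z)))
    (h : WeakL2 (Icc a b) u v) (hu : ∀ n, eLpNorm (u n) 2 (volume.restrict (slab (Icc a b))) ≤ M) :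
    WeakL2 (Icc a b) (fun n z => F (z.1, p n z, q n z) * u n z)
      fun z => F (z.1, p₀ z, q₀ z) * v z := by
  obtain ⟨D, hD⟩ := (isCompact_Icc.prod ((isCompact_Icc (a := -C) (b := C)).prod
    (isCompact_Icc (a := -C) (b := C)))).exists_bound_of_continuousOn (hF.continuousOn (s :=
      Icc a b ×ˢ Icc (-C) C ×ˢ Icc (-C) C))
  have hmeas : ∀ n, AEStronglyMeasurable (fun z : SpaceTime => F (z.1, p n z, q n z))
      (volume.restrict (slab (Icc a b))) := fun n =>
    hF.comp_aestronglyMeasurable (continuous_fst.aestronglyMeasurable.prodMk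
      ((hpm n).prodMk (hqm n)))
  have hbd : ∀ n, ∀ᵐ z : SpaceTime ∂(volume.restrict (slab (Icc a b))),
      |F (z.1, p n z, q n z)| ≤ D := fun n => by
    filter_upwards [hp n, hq n, ae_restrict_mem (measurableSet_slab measurableSet_Icc)]
      with z h1 h2 h3
    exact hD _ ⟨mem_slab.1 h3, abs_le.1 h1, abs_le.1 h2⟩
  have hlim : ∀ᵐ z : SpaceTime ∂(volume.restrict (slab (Icc a b))),
      Tendsto (fun n => F (z.1, p n z, q n z)) atTop (𝓝 (F (z.1, p₀ z, q₀ z))) := by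
    filter_upwards [hp₀, hq₀] with z h1 h2
    exact (hF.tendsto _).comp (tendsto_const_nhds.prodMk_nhds (h1.prodMk_nhds h2))
  refine ⟨fun n => MemLp.bdd_mul (h.mem n) (hmeas n) (hbd n), MemLp.bdd_mul h.mem_lim
    (aestronglyMeasurable_of_tendsto_ae atTop hmeas hlim) (ae_bound_of_tendsto hbd hlim),
    fun g hg => ?_⟩
  simpa only [mul_assoc] using tendsto_integral_weak hmeas hbd hlim hg h.mem hM hu h.tendsto

/-- Conservation laws pass to weak limits of their fluxes. The subsequence may depend on the interval of
times, because each test function sees only one such interval. -/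
lemma FluxEq.of_weak (hI : I.OrdConnected) {A B : ℕ → SpaceTime → ℝ} {A₀ B₀ : SpaceTime → ℝ}
    (h : ∀ n, FluxEq I (A n) (B n) 0) (hA₀ : LocL2 I A₀) (hB₀ : LocL2 I B₀)
    (hw : ∀ a b, a ≤ b → Icc a b ⊆ interior I → ∃ k : ℕ → ℕ,
      WeakL2 (Icc a b) (fun n => A (k n)) A₀ ∧ WeakL2 (Icc a b) (fun n => B (k n)) B₀) :
    FluxEq I A₀ B₀ 0 := by
  refine ⟨hA₀, hB₀, fun _ _ _ => integrable_zero _ _ _, fun φ hφ => ?_⟩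
  rcases hφ.exists_Icc hI with rfl | ⟨a, b, hab, hsub, h0⟩
  · simp [pdt, pdx]
  obtain ⟨k, hA, hB⟩ := hw a b hab hsub
  have e : ∀ {f g : SpaceTime → ℝ}, MemLp f 2 (volume.restrict (slab (Icc a b))) →
      MemLp g 2 (volume.restrict (slab (Icc a b))) →
      ∫ z in slab I, (-(f z * pdt φ z) + g z * pdx φ z - (0 : SpaceTime → ℝ) z * φ z)
        = -(∫ z in slab (Icc a b), f z * pdt φ z) + ∫ z in slab (Icc a b), g z * pdx φ z := by
    intro f g hf hg
    rw [setIntegral_slab_Icc hsub fun z hz => by simp [pdt_eq_zero isClosed_Icc h0 hz, pdx_eq_zero h0 hz, h0 z hz],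
      ← integral_neg]
    refine Eq.trans ?_ (integral_add (integrable_mul_of_memLp hf
      (((hφ.pdt hI).memLp 2).restrict _)).neg
      (integrable_mul_of_memLp hg (((hφ.pdx hI).memLp 2).restrict _)))
    simp
  rw [e hA.mem_lim hB.mem_lim]
  refine tendsto_nhds_unique ((hA.tendsto _ (((hφ.pdt hI).memLp 2).restrict _)).neg.add
    (hB.tendsto _ (((hφ.pdx hI).memLp 2).restrict _))) ?_
  refine tendsto_const_nhds.congr fun n => ?_
  rw [← e (hA.mem n) (hB.mem n), (h (k n)).eq φ hφ]

lemma HasWeakDt.of_weak (hI : I.OrdConnected) {u v : ℕ → SpaceTime → ℝ} {u₀ v₀ : SpaceTime → ℝ}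
    (h : ∀ n, HasWeakDt I (u n) (v n)) (hu : ∀ a b, Icc a b ⊆ I → WeakL2 (Icc a b) u u₀)
    (hv : ∀ a b, Icc a b ⊆ I → WeakL2 (Icc a b) v v₀) : HasWeakDt I u₀ v₀ := by
  refine ⟨LocL1.locallyIntegrableOn fun a b hab =>
      (hu a b (hab.trans interior_subset)).mem_lim.integrable (by norm_num),
    LocL1.locallyIntegrableOn fun a b hab =>
      (hv a b (hab.trans interior_subset)).mem_lim.integrable (by norm_num), fun φ hφ => ?_⟩
  rcases hφ.exists_Icc hI with rfl | ⟨a, b, hab, hsub, h0⟩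
  · simp [pdt]
  have hu' := (hu a b (hsub.trans interior_subset)).tendsto _ (((hφ.pdt hI).memLp 2).restrict _)
  have hv' := (hv a b (hsub.trans interior_subset)).tendsto _ ((hφ.memLp 2).restrict _)
  have e1 : ∀ f : SpaceTime → ℝ, ∫ z in slab I, f z * pdt φ z
      = ∫ z in slab (Icc a b), f z * pdt φ z := fun f =>
    setIntegral_slab_Icc hsub fun z hz => by simp [pdt_eq_zero isClosed_Icc h0 hz]
  have e2 : ∀ f : SpaceTime → ℝ, ∫ z in slab I, f z * φ z
      = ∫ z in slab (Icc a b), f z * φ z := fun f =>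
    setIntegral_slab_Icc hsub fun z hz => by simp [h0 z hz]
  simp only [← e1, ← e2] at hu' hv'
  exact tendsto_nhds_unique hu' (hv'.neg.congr fun n => ((h n).eq φ hφ).symm)

lemma HasWeakDx.of_weak (hI : I.OrdConnected) {u v : ℕ → SpaceTime → ℝ} {u₀ v₀ : SpaceTime → ℝ}
    (h : ∀ n, HasWeakDx I (u n) (v n)) (hu : ∀ a b, Icc a b ⊆ I → WeakL2 (Icc a b) u u₀)
    (hv : ∀ a b, Icc a b ⊆ I → WeakL2 (Icc a b) v v₀) : HasWeakDx I u₀ v₀ := by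
  refine ⟨LocL1.locallyIntegrableOn fun a b hab =>
      (hu a b (hab.trans interior_subset)).mem_lim.integrable (by norm_num),
    LocL1.locallyIntegrableOn fun a b hab =>
      (hv a b (hab.trans interior_subset)).mem_lim.integrable (by norm_num), fun φ hφ => ?_⟩
  rcases hφ.exists_Icc hI with rfl | ⟨a, b, hab, hsub, h0⟩
  · simp [pdx]
  have hu' := (hu a b (hsub.trans interior_subset)).tendsto _ (((hφ.pdx hI).memLp 2).restrict _)
  have hv' := (hv a b (hsub.trans interior_subset)).tendsto _ ((hφ.memLp 2).restrict _)
  have e1 : ∀ f : SpaceTime → ℝ, ∫ z in slab I, f z * pdx φ z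
      = ∫ z in slab (Icc a b), f z * pdx φ z := fun f =>
    setIntegral_slab_Icc hsub fun z hz => by simp [pdx_eq_zero h0 hz]
  have e2 : ∀ f : SpaceTime → ℝ, ∫ z in slab I, f z * φ z
      = ∫ z in slab (Icc a b), f z * φ z := fun f =>
    setIntegral_slab_Icc hsub fun z hz => by simp [h0 z hz]
  simp only [← e1, ← e2] at hu' hv'
  exact tendsto_nhds_unique hu' (hv'.neg.congr fun n => ((h n).eq φ hφ).symm)

lemma exists_Icc_of_isCompact (hI : I.OrdConnected) {J : Set ℝ} (hJ : IsCompact J) (hJI : J ⊆ I) :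
    ∃ a b, J ⊆ Icc a b ∧ Icc a b ⊆ I := by
  rcases J.eq_empty_or_nonempty with rfl | hne
  · exact ⟨1, 0, by simp, by simp⟩
  · exact ⟨sInf J, sSup J, subset_Icc_csInf_csSup hJ.bddBelow hJ.bddAbove,
      hI.out (hJI (hJ.sInf_mem hne)) (hJI (hJ.sSup_mem hne))⟩

lemma LinfLoc.of_weak (hI : I.OrdConnected) {u : ℕ → SpaceTime → ℝ} {v : SpaceTime → ℝ}
    (hv : AEStronglyMeasurable v (volume.restrict (slab I)))
    (hu : ∀ a b, Icc a b ⊆ I → WeakL2 (Icc a b) u v) {M : ℝ≥0∞} (hM : M ≠ ⊤)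
    (hb : ∀ n, mixedNorm I 2 (u n) ≤ M) : LinfLoc I 2 v := by
  refine ⟨hv, fun J hJ hJI => ?_⟩
  obtain ⟨a, b, h1, h2⟩ := exists_Icc_of_isCompact hI hJ hJI
  refine (mixedNorm_mono h1 _ _).trans_lt (lt_of_le_of_lt ?_ hM.lt_top)
  exact mixedNorm_le_of_weak measurableSet_Icc (by simp) (hu a b h2) hM
    fun n => (mixedNorm_mono h2 _ _).trans (hb n)

/-- The system is stable: passing to the limit in the conservation laws only needs strong convergence
of the fields and weak convergence of their derivatives. -/
theorem exists_subseq_essential (hI : I.OrdConnected) (hI0 : I ⊆ Ioi 0) {P Q : ℕ → Field}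
    (h : ∀ n, IsEssentialSolution I (P n) (Q n)) {M : ℝ≥0∞} (hM : M ≠ ⊤)
    (hb : ∀ n, totalNorm I (P n) (Q n) ≤ M) :
    ∃ (k : ℕ → ℕ) (Plim Qlim : Field), StrictMono k ∧ WeakH1 I (fun n => P (k n)) Plim ∧
      WeakH1 I (fun n => Q (k n)) Qlim ∧ IsEssentialSolution I Plim Qlim := by
  -- the six components, indexed by a field and a component of that field
  set c : Fin 3 → Field → SpaceTime → ℝ := ![Field.val, Field.dt, Field.dx] with hc
  set S : Fin 2 → ℕ → Field := ![P, Q] with hS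
  have hreg : ∀ i n, IsRegular I 2 (S i n) := by
    intro i n; fin_cases i
    exacts [(h n).reg_P, (h n).reg_Q]
  have hmem : ∀ j {u : Field}, IsRegular I 2 u → LinfLoc I 2 (c j u) := by
    intro j u hu; fin_cases j
    exacts [hu.val_mem, hu.dt_mem, hu.dx_mem]
  have hbd : ∀ i j n, mixedNorm I 2 (c j (S i n)) ≤ M := by
    intro i j n
    refine le_trans ?_ (hb n)
    unfold totalNorm
    fin_cases i <;> fin_cases j <;> simp only [hc, hS]
    · exact le_add_right (le_add_right (le_add_right (le_add_right le_self_add)))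
    · exact le_add_right (le_add_right (le_add_right le_add_self))
    · exact le_add_right le_add_self
    · exact le_add_right (le_add_right (le_add_right (le_add_right le_add_self)))
    · exact le_add_right (le_add_right le_add_self)
    · exact le_add_self
  obtain ⟨k, hk, hlim⟩ := exists_weakL2_subseq hI0 (Finset.univ : Finset (Fin 2 × Fin 3)) hM
    (u := fun i n => c i.2 (S i.1 n)) (fun i n => (hmem _ (hreg _ _)).meas) fun i n => hbd _ _ n
  choose v hvm hvw using fun i => hlim i (Finset.mem_univ i)
  set T : Fin 2 → Field := fun i => ⟨v (i, 0), v (i, 1), v (i, 2)⟩ with hT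
  have hw : ∀ i j, ∀ a b, Icc a b ⊆ I → WeakL2 (Icc a b) (fun n => c j (S i (k n))) (v (i, j)) :=
    fun i j a b hab => hvw (i, j) _ hab ordConnected_Icc (Metric.isBounded_Icc a b)
  have hLinf : ∀ i j, LinfLoc I 2 (v (i, j)) := fun i j =>
    LinfLoc.of_weak hI (hvm _) (hw i j) hM fun n => hbd i j _
  have hTreg : ∀ i, IsRegular I 2 (T i) := fun i =>
    ⟨HasWeakDt.of_weak hI (fun n => (hreg i (k n)).weak_dt) (hw i 0) (hw i 1),
      HasWeakDx.of_weak hI (fun n => (hreg i (k n)).weak_dx) (hw i 0) (hw i 2),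
      hLinf i 0, hLinf i 1, hLinf i 2⟩
  have hP : IsRegular I 2 (T 0) := hTreg 0
  have hQ : IsRegular I 2 (T 1) := hTreg 1
  refine ⟨k, T 0, T 1, hk, fun J hJ hJo hJb => ⟨hvw (0, 0) J hJ hJo hJb, hvw (0, 1) J hJ hJo hJb,
    hvw (0, 2) J hJ hJo hJb⟩, fun J hJ hJo hJb => ⟨hvw (1, 0) J hJ hJo hJb,
    hvw (1, 1) J hJ hJo hJb, hvw (1, 2) J hJ hJo hJb⟩, DivForm.essential hI hI0 hP hQ ?_⟩
  -- along a further subsequence the products of coefficients and derivatives converge weakly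
  have key : ∀ a b, a ≤ b → Icc a b ⊆ interior I → ∃ l : ℕ → ℕ, ∀ F : ℝ × ℝ × ℝ → ℝ, Continuous F →
      ∀ i j, WeakL2 (Icc a b)
        (fun n z => F (z.1, (P (k (l n))).val z, (Q (k (l n))).val z) * c j (S i (k (l n))) z)
        fun z => F (z.1, (T 0).val z, (T 1).val z) * v (i, j) z := by
    intro a b hab hsub
    have hsubI := hsub.trans interior_subset
    have hstr : ∀ i, Tendsto (fun n => eLpNorm (fun z => (S i (k n)).val z - (T i).val z) 2
        (volume.restrict (slab (Icc a b)))) atTop (𝓝 0) := fun i =>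
      tendsto_eLpNorm_of_weak hI (fun n => hreg i (k n)) (hTreg i) hM (fun n => hbd i 0 _)
        (fun n => hbd i 1 _) (fun n => hbd i 2 _) (hw i 0) hab hsub
    have hms : ∀ i n, AEStronglyMeasurable (S i n).val (volume.restrict (slab (Icc a b))) :=
      fun i n => ((hreg i n).val_mem.memLp hsubI).1
    have hmT : ∀ i, AEStronglyMeasurable (T i).val (volume.restrict (slab (Icc a b))) :=
      fun i => ((hTreg i).val_mem.memLp hsubI).1
    obtain ⟨l₁, hl₁, hlim₁⟩ := exists_subseq_ae (fun n => hms 0 (k n)) (hmT 0) (hstr 0)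
    obtain ⟨l₂, hl₂, hlim₂⟩ := exists_subseq_ae (fun n => hms 1 (k (l₁ n))) (hmT 1)
      ((hstr 1).comp hl₁.tendsto_atTop)
    obtain ⟨a', b', η, hη⟩ := exists_cutoff hI hab hsub
    have hval : ∀ i n, ∀ᵐ z ∂(volume.restrict (slab (Icc a b))),
        |(S i n).val z| ≤ (M + M).toReal := by
      intro i n
      filter_upwards [ae_restrict_of_ae (hη.ae_bound hI (hreg i n)),
        ae_restrict_mem (measurableSet_slab measurableSet_Icc)] with z hz hz'
      rw [hη.one _ (mem_slab.1 hz'), one_mul] at hz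
      have hs := hη.sub.trans interior_subset
      exact hz.trans (ENNReal.toReal_mono (ENNReal.add_ne_top.2 ⟨hM, hM⟩) (add_le_add
        ((mixedNorm_mono hs _ _).trans (hbd i 0 n)) ((mixedNorm_mono hs _ _).trans (hbd i 2 n))))
    refine ⟨fun n => l₁ (l₂ n), fun F hF i j => ?_⟩
    refine WeakL2.coeff_mul hF (C := (M + M).toReal)
      (M := (M ^ 2 * volume (Icc a b)) ^ (1 / 2 : ℝ)) ?_ (fun n => hms 0 _) (fun n => hms 1 _)
      (fun n => hval 0 _) (fun n => hval 1 _) ?_ hlim₂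
      ((hw i j a b hsubI).subseq (hl₁.comp hl₂)) fun n => ?_
    · rw [Real.volume_Icc]; finiteness
    · filter_upwards [hlim₁] with z hz
      exact hz.comp hl₂.tendsto_atTop
    · refine eLpNorm_two_le ((lintegral_slab_sq_le ((hw i j a b hsubI).mem _).1).trans ?_)
      rw [← ENNReal.rpow_natCast (_ ^ _) 2, ← ENNReal.rpow_mul]
      norm_num only [ENNReal.rpow_one]
      gcongr
      exact (mixedNorm_mono hsubI _ _).trans (hbd i j _)
  have hdiv := fun n => (h (k n)).divForm hI hI0
  refine ⟨FluxEq.of_weak hI (fun n => (hdiv n).flux_Q) (locL2_weight hI hI0 hP hQ (hLinf 1 1).locL2)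
    (locL2_weight hI hI0 hP hQ (hLinf 1 2).locL2) fun a b hab hsub => ?_,
    FluxEq.of_weak hI (fun n => (hdiv n).flux_P)
    (locL2_weight_mul hI hI0 hP hQ (hLinf 0 1).locL2 (hLinf 1 1).locL2)
    (locL2_weight_mul hI hI0 hP hQ (hLinf 0 2).locL2 (hLinf 1 2).locL2) fun a b hab hsub => ?_⟩
  · obtain ⟨l, hl⟩ := key a b hab hsub
    have hF : Continuous fun p : ℝ × ℝ × ℝ => p.1 * Real.exp (2 * p.2.1) := by fun_prop
    exact ⟨l, hl _ hF 1 1, hl _ hF 1 2⟩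
  · obtain ⟨l, hl⟩ := key a b hab hsub
    have hF : Continuous fun p : ℝ × ℝ × ℝ => p.1 * Real.exp (2 * p.2.1) * p.2.2 := by fun_prop
    exact ⟨l, (hl _ continuous_fst 0 1).sub (hl _ hF 1 1),
      (hl _ continuous_fst 0 2).sub (hl _ hF 1 2)⟩

/-- A bound on the upper limit of the norms is a uniform bound from some index on. -/
theorem stability_essential (hI : I.OrdConnected) (hI0 : I ⊆ Ioi 0) {P Q : ℕ → Field}
    (h : ∀ n, IsEssentialSolution I (P n) (Q n))
    (hb : limsup (fun n => totalNorm I (P n) (Q n)) atTop < ⊤) :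
    ∃ (k : ℕ → ℕ) (Plim Qlim : Field), StrictMono k ∧ WeakH1 I (fun n => P (k n)) Plim ∧
      WeakH1 I (fun n => Q (k n)) Qlim ∧ IsEssentialSolution I Plim Qlim := by
  obtain ⟨M, hM1, hM2⟩ := exists_between hb
  obtain ⟨N, hN⟩ := eventually_atTop.1 (eventually_lt_of_limsup_lt hM1)
  obtain ⟨k, Plim, Qlim, hk, hP, hQ, hlim⟩ := exists_subseq_essential hI hI0
    (P := fun n => P (n + N)) (Q := fun n => Q (n + N)) (fun n => h _) hM2.ne
    fun n => (hN (n + N) (by omega)).le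
  exact ⟨fun n => k n + N, Plim, Qlim, fun a b hab => by simpa using hk hab, hP, hQ, hlim⟩

end Limit

/-! ### Classical derivatives are weak derivatives -/

/-- `f` is continuous at positive times, with classical first derivatives `ft` and `fx` there. -/
structure HasPd (f ft fx : SpaceTime → ℝ) : Prop where
  cont : ContinuousOn f (slab (Ioi 0))
  dt : ∀ z : SpaceTime, 0 < z.1 → HasDerivAt (fun s : ℝ => f (s, z.2)) (ft z) z.1
  dx : ∀ z : SpaceTime, 0 < z.1 →
    HasDerivAt (fun h : ℝ => f (z.1, z.2 + (h : UnitAddCircle))) (fx z) 0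

namespace HasPd

variable {f ft fx g gt gx : SpaceTime → ℝ}

lemma congr (h : HasPd f ft fx) (ht : ∀ z : SpaceTime, 0 < z.1 → ft z = gt z)
    (hx : ∀ z : SpaceTime, 0 < z.1 → fx z = gx z) : HasPd f gt gx :=
  ⟨h.cont, fun z hz => ht z hz ▸ h.dt z hz, fun z hz => hx z hz ▸ h.dx z hz⟩

lemma add (h : HasPd f ft fx) (h' : HasPd g gt gx) :
    HasPd (fun z => f z + g z) (fun z => ft z + gt z) fun z => fx z + gx z :=
  ⟨h.cont.add h'.cont, fun z hz => (h.dt z hz).add (h'.dt z hz),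
    fun z hz => (h.dx z hz).add (h'.dx z hz)⟩

lemma sub (h : HasPd f ft fx) (h' : HasPd g gt gx) :
    HasPd (fun z => f z - g z) (fun z => ft z - gt z) fun z => fx z - gx z :=
  ⟨h.cont.sub h'.cont, fun z hz => (h.dt z hz).sub (h'.dt z hz),
    fun z hz => (h.dx z hz).sub (h'.dx z hz)⟩

lemma mul (h : HasPd f ft fx) (h' : HasPd g gt gx) :
    HasPd (fun z => f z * g z) (fun z => ft z * g z + f z * gt z)
      fun z => fx z * g z + f z * gx z :=
  ⟨h.cont.mul h'.cont, fun z hz => (h.dt z hz).mul (h'.dt z hz), fun z hz => by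
    refine ((h.dx z hz).mul (h'.dx z hz)).congr_deriv ?_
    simp⟩

lemma const_mul (c : ℝ) (h : HasPd f ft fx) :
    HasPd (fun z => c * f z) (fun z => c * ft z) fun z => c * fx z :=
  ⟨continuousOn_const.mul h.cont, fun z hz => (h.dt z hz).const_mul c,
    fun z hz => (h.dx z hz).const_mul c⟩

lemma time {a a' : ℝ → ℝ} (h : ∀ t, 0 < t → HasDerivAt a (a' t) t) :
    HasPd (fun z => a z.1) (fun z => a' z.1) fun _ => 0 :=
  ⟨fun z hz => ((h z.1 (mem_slab.1 hz)).continuousAt.comp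
    (f := fun z : SpaceTime => z.1) continuous_fst.continuousAt).continuousWithinAt,
    fun z hz => h z.1 hz, fun z _ => hasDerivAt_const 0 (a z.1)⟩

lemma space {f f' : UnitAddCircle → ℝ} (hc : Continuous f)
    (h : ∀ θ, HasDerivAt (fun h : ℝ => f (θ + (h : UnitAddCircle))) (f' θ) 0) :
    HasPd (fun z => f z.2) (fun _ => 0) fun z => f' z.2 :=
  ⟨(hc.comp continuous_snd).continuousOn, fun z _ => hasDerivAt_const z.1 (f z.2), fun z _ => h z.2⟩

end HasPd

lemma SmoothL.hasPd {φ : SpaceTime → ℝ} (h : SmoothL φ) : HasPd φ (Gowdy.pdt φ) (Gowdy.pdx φ) :=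
  ⟨h.continuous.continuousOn, fun z _ => h.hasDerivAt_t z, fun z _ => h.hasDerivAt_x z⟩

/-- The derivative of a function on the circle has mean zero. -/
lemma integral_circle_deriv {f f' : UnitAddCircle → ℝ} (hf' : Continuous f')
    (h : ∀ θ, HasDerivAt (fun h : ℝ => f (θ + (h : UnitAddCircle))) (f' θ) 0) :
    ∫ θ, f' θ = 0 := by
  have hd : ∀ x : ℝ, HasDerivAt (fun s : ℝ => f (s : UnitAddCircle)) (f' (x : UnitAddCircle)) x := by
    intro x
    have h1 := h (x : UnitAddCircle)
    have h2 : HasDerivAt (fun s : ℝ => s - x) 1 x := (hasDerivAt_id x).sub_const x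
    have h3 := HasDerivAt.comp x (h₂ := fun h : ℝ => f ((x : UnitAddCircle) + (h : UnitAddCircle)))
      (h := fun s : ℝ => s - x) (by rw [sub_self]; exact h1) h2
    have e : (fun s : ℝ => f (s : UnitAddCircle))
        = (fun h : ℝ => f ((x : UnitAddCircle) + (h : UnitAddCircle))) ∘ fun s : ℝ => s - x := by
      funext s
      rw [Function.comp_apply, ← AddCircle.coe_add, add_sub_cancel]
    rw [e]
    exact h3.congr_deriv (mul_one _)
  rw [← UnitAddCircle.intervalIntegral_preimage 0 f',
    intervalIntegral.integral_eq_sub_of_hasDerivAt (fun x _ => hd x)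
      ((hf'.comp (AddCircle.continuous_mk' 1)).intervalIntegrable _ _)]
  have : ((0 + 1 : ℝ) : UnitAddCircle) = ((0 : ℝ) : UnitAddCircle) := by
    rw [zero_add, AddCircle.coe_zero]; exact AddCircle.coe_period 1
  rw [this, sub_self]

section Slab

variable {f ft fx : SpaceTime → ℝ} {a b : ℝ}

lemma slab_Icc_subset (ha : 0 < a) : slab (Icc a b) ⊆ slab (Ioi 0) :=
  slab_mono fun _ ht => ha.trans_le ht.1

lemma integrable_slab_Icc (ha : 0 < a) (hf : ContinuousOn f (slab (Ioi 0))) :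
    Integrable f (volume.restrict (slab (Icc a b))) :=
  (hf.mono (slab_Icc_subset ha)).integrableOn_compact (isCompact_slab isCompact_Icc)

lemma integrable_slab_mul (ha : 0 < a) {g : SpaceTime → ℝ} (hf : ContinuousOn f (slab (Ioi 0)))
    (hg : ContinuousOn g (slab (Ioi 0))) :
    Integrable (fun z => f z * g z) (volume.restrict (slab (Icc a b))) :=
  integrable_slab_Icc ha (hf.mul hg)

lemma integral_slab_dx (ha : 0 < a) (h : HasPd f ft fx) (hfx : ContinuousOn fx (slab (Ioi 0))) :
    ∫ z in slab (Icc a b), fx z = 0 := by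
  have hi := integrable_slab_Icc (b := b) ha hfx
  rw [restrict_slab] at hi ⊢
  rw [integral_prod _ hi]
  refine integral_eq_zero_of_ae ?_
  filter_upwards [ae_restrict_mem measurableSet_Icc] with t ht
  have ht0 : 0 < t := ha.trans_le ht.1
  refine integral_circle_deriv (f := fun θ => f (t, θ)) ?_ fun θ => h.dx (t, θ) ht0
  exact hfx.comp_continuous (by fun_prop) fun θ => mem_slab.2 ht0

lemma integral_slab_dt (hab : a ≤ b) (ha : 0 < a) (h : HasPd f ft fx)
    (hft : ContinuousOn ft (slab (Ioi 0)))
    (h0 : ∀ θ, f (a, θ) = 0) (h1 : ∀ θ, f (b, θ) = 0) :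
    ∫ z in slab (Icc a b), ft z = 0 := by
  have hi := integrable_slab_Icc (b := b) ha hft
  rw [restrict_slab] at hi ⊢
  rw [integral_prod_symm _ hi]
  refine integral_eq_zero_of_ae (.of_forall fun θ => ?_)
  have hc : ContinuousOn (fun t => ft (t, θ)) (Icc a b) :=
    hft.comp (Continuous.continuousOn (by fun_prop)) fun t ht => mem_slab.2 (ha.trans_le ht.1)
  change ∫ t in Icc a b, ft (t, θ) = 0
  rw [integral_Icc_eq_integral_Ioc, ← intervalIntegral.integral_of_le hab,
    intervalIntegral.integral_eq_sub_of_hasDerivAt (f := fun t => f (t, θ)), h0, h1, sub_self]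
  · intro t ht
    rw [uIcc_of_le hab] at ht
    exact h.dt (t, θ) (ha.trans_le ht.1)
  · exact (hc.mono (by rw [uIcc_of_le hab])).intervalIntegrable

end Slab

lemma eq_zero_endpoints_of_continuous {φ : SpaceTime → ℝ} (hφ : Continuous φ) {a b : ℝ}
    (h0 : ∀ z : SpaceTime, z.1 ∉ Icc a b → φ z = 0) (θ : UnitAddCircle) :
    φ (a, θ) = 0 ∧ φ (b, θ) = 0 := by
  have hcl : IsClosed {t : ℝ | φ (t, θ) = 0} := isClosed_eq (by fun_prop) continuous_const
  have h1 : closure (Iio a) ⊆ {t : ℝ | φ (t, θ) = 0} :=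
    closure_minimal (fun t ht => h0 _ fun hc => (not_le.2 ht) hc.1) hcl
  have h2 : closure (Ioi b) ⊆ {t : ℝ | φ (t, θ) = 0} :=
    closure_minimal (fun t ht => h0 _ fun hc => (not_le.2 ht) hc.2) hcl
  rw [closure_Iio] at h1
  rw [closure_Ioi] at h2
  exact ⟨h1 self_mem_Iic, h2 self_mem_Ici⟩

namespace HasPd

variable {I : Set ℝ} {f ft fx : SpaceTime → ℝ}

lemma locallyIntegrableOn (hI0 : I ⊆ Ioi 0) {f : SpaceTime → ℝ} (hf : ContinuousOn f (slab (Ioi 0))) :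
    LocallyIntegrableOn f (slab (interior I)) :=
  (hf.mono (slab_mono (interior_subset.trans hI0))).locallyIntegrableOn
    (measurableSet_slab isOpen_interior.measurableSet)

lemma hasWeakDt (hI : I.OrdConnected) (hI0 : I ⊆ Ioi 0) (h : HasPd f ft fx)
    (hft : ContinuousOn ft (slab (Ioi 0))) : HasWeakDt I f ft := by
  refine ⟨locallyIntegrableOn hI0 h.cont, locallyIntegrableOn hI0 hft, fun φ hφ => ?_⟩
  rcases hφ.exists_Icc hI with rfl | ⟨a, b, hab, hsub, h0⟩
  · simp [pdt]
  have ha : 0 < a := hI0 (interior_subset (hsub (left_mem_Icc.2 hab)))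
  have hφc : ContinuousOn φ (slab (Ioi 0)) := hφ.smoothL.continuous.continuousOn
  have hφtc : ContinuousOn (pdt φ) (slab (Ioi 0)) := hφ.smoothL.pdt.continuous.continuousOn
  have h1 := integral_slab_dt hab ha (h.mul hφ.smoothL.hasPd) ((hft.mul hφc).add (h.cont.mul hφtc))
    (fun θ => by simp [(eq_zero_endpoints_of_continuous hφ.smoothL.continuous h0 θ).1])
    fun θ => by simp [(eq_zero_endpoints_of_continuous hφ.smoothL.continuous h0 θ).2]
  rw [integral_add (integrable_slab_mul ha hft hφc)
    (integrable_slab_mul ha h.cont hφtc)] at h1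
  rw [setIntegral_slab_Icc hsub fun z hz => by simp [pdt_eq_zero isClosed_Icc h0 hz],
    setIntegral_slab_Icc hsub fun z hz => by simp [h0 z hz]]
  linarith

lemma hasWeakDx (hI : I.OrdConnected) (hI0 : I ⊆ Ioi 0) (h : HasPd f ft fx)
    (hfx : ContinuousOn fx (slab (Ioi 0))) : HasWeakDx I f fx := by
  refine ⟨locallyIntegrableOn hI0 h.cont, locallyIntegrableOn hI0 hfx, fun φ hφ => ?_⟩
  rcases hφ.exists_Icc hI with rfl | ⟨a, b, hab, hsub, h0⟩
  · simp [pdx]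
  have ha : 0 < a := hI0 (interior_subset (hsub (left_mem_Icc.2 hab)))
  have hφc : ContinuousOn φ (slab (Ioi 0)) := hφ.smoothL.continuous.continuousOn
  have hφxc : ContinuousOn (pdx φ) (slab (Ioi 0)) := hφ.smoothL.pdx.continuous.continuousOn
  have h1 := integral_slab_dx (b := b) ha (h.mul hφ.smoothL.hasPd)
    ((hfx.mul hφc).add (h.cont.mul hφxc))
  rw [integral_add (integrable_slab_mul ha hfx hφc)
    (integrable_slab_mul ha h.cont hφxc)] at h1
  rw [setIntegral_slab_Icc hsub fun z hz => by simp [pdx_eq_zero h0 hz],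
    setIntegral_slab_Icc hsub fun z hz => by simp [h0 z hz]]
  linarith

/-- A classical wave equation holds in the sense of distributions. -/
lemma weakWave (hI : I.OrdConnected) (hI0 : I ⊆ Ioi 0) {u : Field} {utt utx uxt uxx r : SpaceTime → ℝ}
    (ht : HasPd u.dt utt utx) (hx : HasPd u.dx uxt uxx) (htt : ContinuousOn utt (slab (Ioi 0)))
    (hxx : ContinuousOn uxx (slab (Ioi 0)))
    (hr : ∀ z : SpaceTime, 0 < z.1 → utt z - uxx z = r z) : WeakWave I u r := by
  intro φ hφ
  rcases hφ.exists_Icc hI with rfl | ⟨a, b, hab, hsub, h0⟩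
  · simp [pdx, pdt]
  have ha : 0 < a := hI0 (interior_subset (hsub (left_mem_Icc.2 hab)))
  have hφc : ContinuousOn φ (slab (Ioi 0)) := hφ.smoothL.continuous.continuousOn
  have hφtc : ContinuousOn (pdt φ) (slab (Ioi 0)) := hφ.smoothL.pdt.continuous.continuousOn
  have hφxc : ContinuousOn (pdx φ) (slab (Ioi 0)) := hφ.smoothL.pdx.continuous.continuousOn
  have e1 := (ht.hasWeakDt hI hI0 htt).eq φ hφ
  have e2 := (hx.hasWeakDx hI hI0 hxx).eq φ hφ
  have z1 : ∀ (f : SpaceTime → ℝ) (z : SpaceTime), z.1 ∉ Icc a b → f z * φ z = 0 :=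
    fun f z hz => by simp [h0 z hz]
  have z2 : ∀ (f : SpaceTime → ℝ) (z : SpaceTime), z.1 ∉ Icc a b → f z * pdt φ z = 0 :=
    fun f z hz => by simp [pdt_eq_zero isClosed_Icc h0 hz]
  have z3 : ∀ (f : SpaceTime → ℝ) (z : SpaceTime), z.1 ∉ Icc a b → f z * pdx φ z = 0 :=
    fun f z hz => by simp [pdx_eq_zero h0 hz]
  rw [setIntegral_slab_Icc hsub (z1 _), setIntegral_slab_Icc hsub (z2 _)] at e1
  rw [setIntegral_slab_Icc hsub (z1 _), setIntegral_slab_Icc hsub (z3 _)] at e2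
  rw [setIntegral_slab_Icc hsub (z1 _), setIntegral_slab_Icc hsub fun z hz => by
    rw [z2 _ z hz, z3 _ z hz]; simp]
  have e3 : ∫ z in slab (Icc a b), r z * φ z = (∫ z in slab (Icc a b), utt z * φ z)
      - ∫ z in slab (Icc a b), uxx z * φ z := by
    rw [← integral_sub (integrable_slab_mul ha htt hφc) (integrable_slab_mul ha hxx hφc)]
    refine setIntegral_congr_fun (measurableSet_slab measurableSet_Icc) fun z hz => ?_
    simp only [← hr z (ha.trans_le (mem_slab.1 hz).1), sub_mul]
  refine (integral_add (integrable_slab_mul ha ht.cont hφtc).neg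
    (integrable_slab_mul ha hx.cont hφxc)).trans ?_
  simp only [Pi.neg_apply, integral_neg]
  rw [e1, e2, e3]
  ring

end HasPd

lemma mixedNorm_le_of_bound {J : Set ℝ} (hJ : MeasurableSet J) {f : SpaceTime → ℝ} {C : ℝ}
    (p : ℝ≥0∞) (hC : ∀ z : SpaceTime, z.1 ∈ J → |f z| ≤ C) : mixedNorm J p f ≤ ENNReal.ofReal C := by
  refine essSup_le_of_ae_le _ ?_
  filter_upwards [ae_restrict_mem hJ] with t ht
  refine (eLpNorm_le_of_ae_bound (C := C) (.of_forall fun θ => hC (t, θ) ht)).trans ?_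
  simp

lemma linfLoc_of_continuousOn {I : Set ℝ} (hI : I.OrdConnected) (hI0 : I ⊆ Ioi 0) (p : ℝ≥0∞)
    {f : SpaceTime → ℝ} (hf : ContinuousOn f (slab (Ioi 0))) : LinfLoc I p f := by
  refine ⟨(hf.mono (slab_mono hI0)).aestronglyMeasurable (measurableSet_slab hI.measurableSet),
    fun J hJ hJI => ?_⟩
  obtain ⟨C, hC⟩ := (isCompact_slab hJ).exists_bound_of_continuousOn
    (hf.mono (slab_mono (hJI.trans hI0)))
  exact (mixedNorm_le_of_bound hJ.measurableSet p fun z hz => hC z (mem_slab.2 hz)).trans_lt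
    ENNReal.ofReal_lt_top

lemma HasPd.isRegular {I : Set ℝ} (hI : I.OrdConnected) (hI0 : I ⊆ Ioi 0) (p : ℝ≥0∞) {u : Field}
    (h : HasPd u.val u.dt u.dx) (ht : ContinuousOn u.dt (slab (Ioi 0)))
    (hx : ContinuousOn u.dx (slab (Ioi 0))) : IsRegular I p u :=
  ⟨h.hasWeakDt hI hI0 ht, h.hasWeakDx hI hI0 hx, linfLoc_of_continuousOn hI hI0 p h.cont,
    linfLoc_of_continuousOn hI hI0 p ht, linfLoc_of_continuousOn hI hI0 p hx⟩

/-! ### The radial ordinary differential equation -/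

section PowerSeries

variable {c : ℕ → ℝ}

/-- The sum of the real power series with coefficients `c`. -/
noncomputable def powerSum (c : ℕ → ℝ) (x : ℝ) : ℝ := ∑' m, c m * x ^ m

/-- The coefficients of the derived series. -/
def shiftCoeff (c : ℕ → ℝ) (m : ℕ) : ℝ := (m + 1) * c (m + 1)

/-- Coefficients of an entire function of exponential type. -/
def IsEntire (c : ℕ → ℝ) : Prop := ∃ C B : ℝ, 0 ≤ B ∧ ∀ m, |c m| ≤ C * (B ^ m / m.factorial)

lemma IsEntire.shift (h : IsEntire c) : IsEntire (shiftCoeff c) := by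
  obtain ⟨C, B, hB, h⟩ := h
  refine ⟨C * B, B, hB, fun m => ?_⟩
  have hm : (0 : ℝ) < m + 1 := by positivity
  rw [shiftCoeff, abs_mul, abs_of_pos hm]
  calc ((m : ℝ) + 1) * |c (m + 1)| ≤ (m + 1) * (C * (B ^ (m + 1) / (m + 1).factorial)) := by
        gcongr; exact h _
    _ = C * B * (B ^ m / m.factorial) := by
        rw [Nat.factorial_succ]; push_cast; field_simp; ring

lemma IsEntire.summable (h : IsEntire c) (x : ℝ) : Summable fun m => c m * x ^ m := by
  obtain ⟨C, B, hB, h⟩ := h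
  refine Summable.of_norm_bounded ((Real.summable_pow_div_factorial (B * |x|)).mul_left C) fun m => ?_
  rw [norm_mul, norm_pow, Real.norm_eq_abs, Real.norm_eq_abs, mul_pow, mul_div_right_comm, ← mul_assoc]
  gcongr
  exact h m

lemma IsEntire.hasDerivAt (h : IsEntire c) (x : ℝ) :
    HasDerivAt (powerSum c) (powerSum (shiftCoeff c) x) x := by
  obtain ⟨C, B, hB, hc⟩ := h.shift
  set r := |x| + 1 with hr
  have hC : 0 ≤ C := by simpa using (abs_nonneg _).trans (hc 0)
  have hs : Summable fun m : ℕ => C * ((B * r) ^ (m - 1) / (m - 1).factorial) := by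
    refine (summable_nat_add_iff 1).1 ?_
    simpa using (Real.summable_pow_div_factorial (B * r)).mul_left C
  have key := hasDerivAt_tsum_of_isPreconnected (𝕜 := ℝ) (g := fun m x => c m * x ^ m)
    (g' := fun m x => c m * (m * x ^ (m - 1))) (t := Metric.ball 0 r) (y₀ := 0) (y := x) hs
    Metric.isOpen_ball (convex_ball (0 : ℝ) r).isPreconnected
    (fun m y _ => (hasDerivAt_pow m y).const_mul (c m)) (fun m y hy => ?_)
    (Metric.mem_ball_self (by positivity)) (h.summable 0) (by simp [hr])
  · refine key.congr_deriv ?_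
    have hs' : Summable fun m : ℕ => c m * (m * x ^ (m - 1)) := by
      refine (summable_nat_add_iff 1).1 ?_
      refine (h.shift.summable x).congr fun m => ?_
      simp [shiftCoeff]; ring
    rw [hs'.tsum_eq_zero_add, powerSum]
    simp only [Nat.cast_zero, zero_mul, mul_zero, zero_add, shiftCoeff]
    refine tsum_congr fun m => ?_
    simp; ring
  · rcases m with _ | m
    · simp; positivity
    · have hy' : |y| ≤ r := by simpa using (mem_ball_zero_iff.1 hy).le
      have e : c (m + 1) * ((m + 1 : ℕ) * y ^ (m + 1 - 1)) = shiftCoeff c m * y ^ m := by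
        simp [shiftCoeff]; ring
      rw [e, norm_mul, norm_pow, Real.norm_eq_abs, Real.norm_eq_abs, Nat.add_sub_cancel, mul_pow,
        mul_div_right_comm, ← mul_assoc]
      gcongr
      exact hc m

end PowerSeries

/-- Coefficients of the solution of `x J'' + J' + J = 0` which is regular at the origin. -/
noncomputable def besselJ (m : ℕ) : ℝ := (-1) ^ m / (m.factorial : ℝ) ^ 2

/-- Coefficients of the entire function `R` with `x R'' + R' + R = -2 J'`, so that
`J log x + R` solves the same equation as `J`. -/
noncomputable def besselR : ℕ → ℝ
  | 0 => 0
  | m + 1 => -(besselR m + 2 * ((m + 1) * besselJ (m + 1))) / ((m : ℝ) + 1) ^ 2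

lemma besselJ_succ (m : ℕ) : ((m : ℝ) + 1) ^ 2 * besselJ (m + 1) = - besselJ m := by
  rw [besselJ, besselJ, Nat.factorial_succ]
  push_cast
  field_simp
  ring

lemma abs_besselJ (m : ℕ) : |besselJ m| = 1 / (m.factorial : ℝ) ^ 2 := by
  rw [besselJ, abs_div, abs_pow, abs_neg, abs_one, one_pow, abs_of_pos (by positivity)]

lemma one_le_factorial (m : ℕ) : (1 : ℝ) ≤ m.factorial := by
  exact_mod_cast Nat.factorial_pos m

lemma isEntire_besselJ : IsEntire besselJ := by
  refine ⟨1, 1, zero_le_one, fun m => ?_⟩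
  rw [abs_besselJ, one_pow, one_mul]
  have := one_le_factorial m
  exact one_div_le_one_div_of_le (by positivity) (by nlinarith)

lemma isEntire_besselR : IsEntire besselR := by
  refine ⟨1, 3, by norm_num, fun m => ?_⟩
  rw [one_mul]
  induction m with
  | zero => simp [besselR]
  | succ m ih =>
    have hm : (0 : ℝ) < (m : ℝ) + 1 := by positivity
    have hf : (0 : ℝ) < m.factorial := by positivity
    have hf1 := one_le_factorial m
    have hJ : |besselJ (m + 1)| ≤ 1 / (((m : ℝ) + 1) * m.factorial) := by
      rw [abs_besselJ, Nat.factorial_succ]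
      push_cast
      refine one_div_le_one_div_of_le (by positivity) ?_
      have : (1 : ℝ) ≤ ((m : ℝ) + 1) * m.factorial := by
        nlinarith [(Nat.cast_nonneg m : (0 : ℝ) ≤ m)]
      nlinarith
    rw [besselR, abs_div, abs_neg, abs_of_pos (show (0 : ℝ) < ((m : ℝ) + 1) ^ 2 by positivity),
      div_le_iff₀ (by positivity)]
    have h1 : |besselR m + 2 * (((m : ℝ) + 1) * besselJ (m + 1))|
        ≤ 3 ^ m / m.factorial + 2 * (1 / m.factorial) := by
      refine (abs_add_le _ _).trans (add_le_add ih ?_)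
      rw [abs_mul, abs_mul, abs_of_pos hm, abs_of_pos (by norm_num : (0 : ℝ) < 2)]
      gcongr
      calc ((m : ℝ) + 1) * |besselJ (m + 1)| ≤ (m + 1) * (1 / (((m : ℝ) + 1) * m.factorial)) := by
            gcongr
        _ = 1 / m.factorial := by field_simp
    refine h1.trans ?_
    have e : (3 : ℝ) ^ (m + 1) / (m + 1).factorial * ((m : ℝ) + 1) ^ 2
        = (3 * 3 ^ m * (m + 1)) / m.factorial := by
      rw [Nat.factorial_succ]; push_cast; field_simp; ring
    rw [e, mul_one_div, ← add_div]
    gcongr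
    have : (1 : ℝ) ≤ 3 ^ m := one_le_pow₀ (by norm_num)
    nlinarith [(Nat.cast_nonneg m : (0 : ℝ) ≤ m), mul_nonneg (Nat.cast_nonneg (α := ℝ) m)
      (zero_le_one.trans this)]

/-- The operator `x F'' + F' + F` on power series. -/
lemma powerSum_bessel {c : ℕ → ℝ} (h : IsEntire c) (x : ℝ) :
    x * powerSum (shiftCoeff (shiftCoeff c)) x + powerSum (shiftCoeff c) x + powerSum c x
      = ∑' m : ℕ, (((m : ℝ) + 1) ^ 2 * c (m + 1) + c m) * x ^ m := by
  have s0 := h.summable x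
  have s1 := h.shift.summable x
  have s2 := h.shift.shift.summable x
  have s3 : Summable fun m : ℕ => (m : ℝ) * ((m + 1) * c (m + 1)) * x ^ m := by
    refine (summable_nat_add_iff 1).1 ((s2.mul_left x).congr fun m => ?_)
    simp [shiftCoeff, pow_succ]; ring
  have e2 : x * powerSum (shiftCoeff (shiftCoeff c)) x
      = ∑' m : ℕ, (m : ℝ) * ((m + 1) * c (m + 1)) * x ^ m := by
    rw [s3.tsum_eq_zero_add, powerSum, ← tsum_mul_left]
    simp only [Nat.cast_zero, zero_mul, zero_add]
    refine tsum_congr fun m => ?_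
    simp [shiftCoeff, pow_succ]; ring
  rw [e2, powerSum, powerSum, ← s3.tsum_add s1, ← (s3.add s1).tsum_add s0]
  refine tsum_congr fun m => ?_
  simp only [shiftCoeff]; ring

lemma bessel_J (x : ℝ) : x * powerSum (shiftCoeff (shiftCoeff besselJ)) x
    + powerSum (shiftCoeff besselJ) x + powerSum besselJ x = 0 := by
  rw [powerSum_bessel isEntire_besselJ]
  simp [besselJ_succ]

lemma bessel_R (x : ℝ) : x * powerSum (shiftCoeff (shiftCoeff besselR)) x
    + powerSum (shiftCoeff besselR) x + powerSum besselR x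
      = -2 * powerSum (shiftCoeff besselJ) x := by
  rw [powerSum_bessel isEntire_besselR, powerSum, ← tsum_mul_left]
  refine tsum_congr fun m => ?_
  have hm : (m : ℝ) + 1 ≠ 0 := by positivity
  rw [besselR, mul_div_cancel₀ _ (pow_ne_zero 2 hm), shiftCoeff]
  ring

lemma powerSum_zero (c : ℕ → ℝ) : powerSum c 0 = c 0 := by
  rw [powerSum, tsum_eq_single 0]
  · simp
  · intro m hm; simp [hm]

/-- The Wronskian identity for the solutions `J` and `J log x + R`. The logarithms cancel, and the
constant is found at `x = 0`, where all terms are regular. -/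
lemma bessel_wronskian (x : ℝ) :
    powerSum besselJ x ^ 2 + x * (powerSum besselJ x * powerSum (shiftCoeff besselR) x
      - powerSum (shiftCoeff besselJ) x * powerSum besselR x) = 1 := by
  set G : ℝ → ℝ := fun x => powerSum besselJ x ^ 2
    + x * (powerSum besselJ x * powerSum (shiftCoeff besselR) x
      - powerSum (shiftCoeff besselJ) x * powerSum besselR x) with hG
  have hd : ∀ x, HasDerivAt G 0 x := by
    intro x
    have h := ((isEntire_besselJ.hasDerivAt x).pow 2).add ((hasDerivAt_id x).mul
      (((isEntire_besselJ.hasDerivAt x).mul (isEntire_besselR.shift.hasDerivAt x)).sub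
      ((isEntire_besselJ.shift.hasDerivAt x).mul (isEntire_besselR.hasDerivAt x))))
    refine h.congr_deriv ?_
    have h1 := bessel_J x
    have h2 := bessel_R x
    simp only [id, Nat.cast_ofNat, Pi.sub_apply, Pi.mul_apply]
    linear_combination powerSum besselJ x * h2 - powerSum besselR x * h1
  have hc := is_const_of_deriv_eq_zero (fun x => (hd x).differentiableAt) (fun x => (hd x).deriv) x 0
  have h0 : G 0 = 1 := by simp [hG, powerSum_zero, besselJ]
  exact hc.trans h0

/-- Solutions of `a'' + a' / t + k² a = 0` with prescribed data: in the variable `x = k² t² / 4` the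
equation is `x Y'' + Y' + Y = 0`, with the independent solutions `J` and `J log x + R`. -/
lemma exists_mode {k t₀ : ℝ} (hk : 0 < k) (ht₀ : 0 < t₀) (α β : ℝ) :
    ∃ a a' : ℝ → ℝ, (∀ t, 0 < t → HasDerivAt a (a' t) t) ∧
      (∀ t, 0 < t → HasDerivAt a' (-(a' t) / t - k ^ 2 * a t) t) ∧ a t₀ = α ∧ a' t₀ = β := by
  set J := powerSum besselJ
  set J' := powerSum (shiftCoeff besselJ)
  set J'' := powerSum (shiftCoeff (shiftCoeff besselJ))
  set R := powerSum besselR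
  set R' := powerSum (shiftCoeff besselR)
  set R'' := powerSum (shiftCoeff (shiftCoeff besselR))
  have dJ : ∀ x, HasDerivAt J (J' x) x := isEntire_besselJ.hasDerivAt
  have dJ' : ∀ x, HasDerivAt J' (J'' x) x := isEntire_besselJ.shift.hasDerivAt
  have dR : ∀ x, HasDerivAt R (R' x) x := isEntire_besselR.hasDerivAt
  have dR' : ∀ x, HasDerivAt R' (R'' x) x := isEntire_besselR.shift.hasDerivAt
  set x₀ := k ^ 2 * t₀ ^ 2 / 4 with hx₀
  have hx₀pos : 0 < x₀ := by positivity
  -- by the Wronskian identity the initial conditions can be solved for the coefficients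
  set L := Real.log x₀
  set β' := β / (k ^ 2 * t₀ / 2) with hβ'
  set Y₀ := J x₀ * L + R x₀ with hY₀
  set Y₁ := J' x₀ * L + J x₀ / x₀ + R' x₀ with hY₁
  have hW : x₀ * (J x₀ * Y₁ - J' x₀ * Y₀) = 1 := by
    rw [← bessel_wronskian x₀, hY₀, hY₁]
    change _ = J x₀ ^ 2 + x₀ * (J x₀ * R' x₀ - J' x₀ * R x₀)
    field_simp
    ring
  set c₁ := x₀ * (α * Y₁ - β' * Y₀) with hc₁
  set c₂ := x₀ * (β' * J x₀ - α * J' x₀) with hc₂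
  set Y : ℝ → ℝ := fun x => c₁ * J x + c₂ * (J x * Real.log x + R x) with hY
  set Y' : ℝ → ℝ := fun x => c₁ * J' x + c₂ * (J' x * Real.log x + J x * x⁻¹ + R' x) with hY'
  have dY : ∀ x, 0 < x → HasDerivAt Y (Y' x) x := fun x hx =>
    ((dJ x).const_mul c₁).add ((((dJ x).mul (Real.hasDerivAt_log hx.ne')).add (dR x)).const_mul c₂)
  have dY' : ∀ x, 0 < x → HasDerivAt Y' (-(Y' x + Y x) / x) x := by
    intro x hx
    have h := ((dJ' x).const_mul c₁).add (((((dJ' x).mul (Real.hasDerivAt_log hx.ne')).add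
      ((dJ x).mul (hasDerivAt_inv hx.ne'))).add (dR' x)).const_mul c₂)
    refine h.congr_deriv ?_
    have h1 : x * J'' x + J' x + J x = 0 := bessel_J x
    have h2 : x * R'' x + R' x + R x = -2 * J' x := bessel_R x
    rw [eq_div_iff hx.ne', hY, hY']
    have hxx : x * x⁻¹ = 1 := mul_inv_cancel₀ hx.ne'
    have h3 : (x ^ 2)⁻¹ * x = x⁻¹ := by field_simp
    simp only
    linear_combination (c₁ + c₂ * Real.log x) * h1 + c₂ * h2 + 2 * c₂ * J' x * hxx
      - c₂ * J x * h3
  have hpos : ∀ t : ℝ, 0 < t → 0 < k ^ 2 * t ^ 2 / 4 := fun t ht => by positivity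
  have dx : ∀ t : ℝ, HasDerivAt (fun t : ℝ => k ^ 2 * t ^ 2 / 4) (k ^ 2 * t / 2) t := fun t => by
    refine (((hasDerivAt_pow 2 t).const_mul (k ^ 2)).div_const 4).congr_deriv ?_
    norm_num; ring
  refine ⟨fun t => Y (k ^ 2 * t ^ 2 / 4), fun t => Y' (k ^ 2 * t ^ 2 / 4) * (k ^ 2 * t / 2),
    fun t ht => HasDerivAt.comp (h₂ := Y) t (dY _ (hpos t ht)) (dx t), fun t ht => ?_, ?_, ?_⟩
  · have h1 := (HasDerivAt.comp (h₂ := Y') t (dY' _ (hpos t ht)) (dx t)).mul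
      (((hasDerivAt_id t).const_mul (k ^ 2)).div_const 2)
    refine h1.congr_deriv ?_
    simp only [Function.comp_apply, id]
    field_simp
    ring
  · change c₁ * J x₀ + c₂ * (J x₀ * L + R x₀) = α
    rw [← hY₀, hc₁, hc₂]
    linear_combination α * hW
  · change (c₁ * J' x₀ + c₂ * (J' x₀ * L + J x₀ * x₀⁻¹ + R' x₀)) * (k ^ 2 * t₀ / 2) = β
    have e : c₁ * J' x₀ + c₂ * Y₁ = β' := by
      rw [hc₁, hc₂]
      linear_combination β' * hW
    rw [← div_eq_mul_inv, ← hY₁, e, hβ', div_mul_cancel₀ _ (by positivity)]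

/-! ### Energy decay of a single mode -/

/-- `a` solves `a'' + a' / t + k² a = 0` for `t > 0`, with derivative `a'`. -/
structure IsMode (k : ℝ) (a a' : ℝ → ℝ) : Prop where
  deriv : ∀ t, 0 < t → HasDerivAt a (a' t) t
  deriv' : ∀ t, 0 < t → HasDerivAt a' (-(a' t) / t - k ^ 2 * a t) t

/-- The energy of a mode. -/
def modeEnergy (k : ℝ) (a a' : ℝ → ℝ) (t : ℝ) : ℝ := a' t ^ 2 + k ^ 2 * a t ^ 2

namespace IsMode

variable {k t₀ t : ℝ} {a a' b b' : ℝ → ℝ}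

lemma hasDerivAt_energy (h : IsMode k a a') (ht : 0 < t) :
    HasDerivAt (modeEnergy k a a') (-2 * a' t ^ 2 / t) t := by
  have := ((h.deriv' t ht).pow 2).add (((h.deriv t ht).pow 2).const_mul (k ^ 2))
  refine this.congr_deriv ?_
  simp only [Nat.cast_ofNat]
  field_simp
  ring

lemma energy_le (h : IsMode k a a') (ht₀ : 0 < t₀) (ht : t₀ ≤ t) :
    modeEnergy k a a' t ≤ modeEnergy k a a' t₀ := by
  have hd : ∀ s ∈ Ici t₀, HasDerivAt (modeEnergy k a a') (-2 * a' s ^ 2 / s) s :=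
    fun s hs => h.hasDerivAt_energy (ht₀.trans_le hs)
  refine antitoneOn_of_deriv_nonpos (convex_Ici t₀)
    (fun s hs => (hd s hs).continuousAt.continuousWithinAt)
    (fun s hs => (hd s (interior_subset hs)).differentiableAt.differentiableWithinAt)
    (fun s hs => ?_) self_mem_Ici ht ht
  rw [(hd s (interior_subset hs)).deriv]
  have hs0 : 0 < s := ht₀.trans_le (interior_subset hs)
  exact div_nonpos_of_nonpos_of_nonneg (by nlinarith [sq_nonneg (a' s)]) hs0.le

lemma abs_deriv_le (h : IsMode k a a') (ht₀ : 0 < t₀) (he : modeEnergy k a a' t₀ = 1)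
    (ht : t₀ ≤ t) : |a' t| ≤ 1 := by
  have := h.energy_le ht₀ ht
  rw [he, modeEnergy] at this
  exact abs_le_one_iff_mul_self_le_one.2 (by nlinarith [sq_nonneg (k * a t)])

lemma abs_le (h : IsMode k a a') (hk : 0 < k) (ht₀ : 0 < t₀) (he : modeEnergy k a a' t₀ = 1)
    (ht : t₀ ≤ t) : |a t| ≤ 1 / k := by
  have := h.energy_le ht₀ ht
  rw [he, modeEnergy] at this
  rw [le_div_iff₀ hk, mul_comm]
  nth_rewrite 1 [← abs_of_pos hk]
  rw [← abs_mul]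
  exact abs_le_one_iff_mul_self_le_one.2 (by nlinarith [sq_nonneg (a' t)])

/-- `t` times the energy is asymptotically conserved for large frequencies, because
`(t e + a a')' = - a a' / t`. -/
lemma abs_mul_energy_sub_le (h : IsMode k a a') (hk : 0 < k) (ht₀ : 0 < t₀)
    (he : modeEnergy k a a' t₀ = 1) (h0 : a t₀ * a' t₀ = 0) (ht : t₀ ≤ t) :
    |t * modeEnergy k a a' t - t₀| ≤ t / (k * t₀) := by
  set f : ℝ → ℝ := fun s => s * modeEnergy k a a' s + a s * a' s with hf
  have hprod : ∀ s, t₀ ≤ s → |a s * a' s| ≤ 1 / k := fun s hs => by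
    rw [abs_mul]
    calc |a s| * |a' s| ≤ 1 / k * 1 :=
          mul_le_mul (h.abs_le hk ht₀ he hs) (h.abs_deriv_le ht₀ he hs) (abs_nonneg _) (by positivity)
      _ = 1 / k := mul_one _
  have hd : ∀ s ∈ Icc t₀ t, HasDerivWithinAt f (-(a s * a' s) / s) (Icc t₀ t) s := by
    intro s hs
    have hs0 : 0 < s := ht₀.trans_le hs.1
    have := ((hasDerivAt_id s).mul (h.hasDerivAt_energy hs0)).add
      ((h.deriv s hs0).mul (h.deriv' s hs0))
    refine (this.congr_deriv ?_).hasDerivWithinAt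
    simp only [id, modeEnergy]
    field_simp
    ring
  have hb : ∀ s ∈ Icc t₀ t, ‖-(a s * a' s) / s‖ ≤ 1 / (k * t₀) := by
    intro s hs
    have hs0 : 0 < s := ht₀.trans_le hs.1
    rw [Real.norm_eq_abs, abs_div, abs_neg, abs_of_pos hs0, ← div_div]
    exact div_le_div₀ (by positivity) (hprod s hs.1) ht₀ hs.1
  have h1 := (convex_Icc t₀ t).norm_image_sub_le_of_norm_hasDerivWithin_le hd hb
    (left_mem_Icc.2 ht) (right_mem_Icc.2 ht)
  have h2 : f t₀ = t₀ := by simp [hf, he, h0]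
  rw [h2, Real.norm_eq_abs, Real.norm_eq_abs, abs_of_nonneg (sub_nonneg.2 ht)] at h1
  have h3 := hprod t ht
  have e : t * modeEnergy k a a' t - t₀ = (f t - t₀) - a t * a' t := by simp only [hf]; ring
  calc |t * modeEnergy k a a' t - t₀| ≤ |f t - t₀| + |a t * a' t| := by rw [e]; exact abs_sub _ _
    _ ≤ 1 / (k * t₀) * (t - t₀) + 1 / k := add_le_add h1 h3
    _ = t / (k * t₀) := by field_simp; ring

/-- `t` times the Wronskian of two modes is constant. -/
lemma wronskian (ha : IsMode k a a') (hb : IsMode k b b') (ht₀ : 0 < t₀) (ht : 0 < t) :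
    t * (a t * b' t - a' t * b t) = t₀ * (a t₀ * b' t₀ - a' t₀ * b t₀) := by
  have hd : ∀ s ∈ Ioi (0 : ℝ),
      HasDerivAt (fun s => s * (a s * b' s - a' s * b s)) 0 s := by
    intro s hs
    have hs0 : 0 < s := hs
    have := (hasDerivAt_id s).mul (((ha.deriv s hs).mul (hb.deriv' s hs)).sub
      ((ha.deriv' s hs).mul (hb.deriv s hs)))
    refine this.congr_deriv ?_
    simp only [id, Pi.sub_apply, Pi.mul_apply]
    field_simp
    ring
  exact isOpen_Ioi.is_const_of_deriv_eq_zero isPreconnected_Ioi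
    (fun s hs => (hd s hs).differentiableAt.differentiableWithinAt)
    (fun s hs => (hd s hs).deriv) ht ht₀

end IsMode

/-- Two modes of frequency `k`, a cosine-like and a sine-like one, with unit energy at time `t₀`. There
`t` times their Wronskian is `t₀ / k`, and the products `A A'` and `B B'` vanish. -/
structure ModePair (k t₀ : ℝ) where
  A : ℝ → ℝ
  A' : ℝ → ℝ
  B : ℝ → ℝ
  B' : ℝ → ℝ
  modeA : IsMode k A A'
  modeB : IsMode k B B'
  A_init : A t₀ = 1 / k
  A'_init : A' t₀ = 0
  B_init : B t₀ = 0
  B'_init : B' t₀ = 1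

lemma nonempty_modePair {k t₀ : ℝ} (hk : 0 < k) (ht₀ : 0 < t₀) : Nonempty (ModePair k t₀) := by
  obtain ⟨a, a', h1, h2, h3, h4⟩ := exists_mode hk ht₀ (1 / k) 0
  obtain ⟨b, b', h5, h6, h7, h8⟩ := exists_mode hk ht₀ 0 1
  exact ⟨⟨a, a', b, b', ⟨h1, h2⟩, ⟨h5, h6⟩, h3, h4, h7, h8⟩⟩

/-! ### Polarized waves -/

/-- A function on space-time with candidates for its derivatives of order at most two. -/
structure Wave where
  v : SpaceTime → ℝ
  t : SpaceTime → ℝ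
  x : SpaceTime → ℝ
  tx : SpaceTime → ℝ
  xx : SpaceTime → ℝ

namespace Wave

/-- `w` is a classical solution of the polarized equation `v_tt + v_t / t = v_θθ` at positive times,
and its entries are its derivatives. -/
structure IsSol (w : Wave) : Prop where
  pd : HasPd w.v w.t w.x
  pd_t : HasPd w.t (fun z => -(w.t z) / z.1 + w.xx z) w.tx
  pd_x : HasPd w.x w.tx w.xx
  cont_tx : ContinuousOn w.tx (slab (Ioi 0))
  cont_xx : ContinuousOn w.xx (slab (Ioi 0))

/-- Solutions whose dependence on `θ` is a trigonometric function of frequency `k`. -/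
structure IsModeSol (k : ℝ) (w : Wave) : Prop where
  sol : IsSol w
  xx_eq : ∀ z, w.xx z = -k ^ 2 * w.v z
  pd_tx : HasPd w.tx (fun z => -(w.tx z) / z.1 - k ^ 2 * w.x z) fun z => -k ^ 2 * w.t z

/-- Superposition of waves. -/
def add (u w : Wave) : Wave :=
  ⟨fun z => u.v z + w.v z, fun z => u.t z + w.t z, fun z => u.x z + w.x z,
    fun z => u.tx z + w.tx z, fun z => u.xx z + w.xx z⟩

lemma IsSol.add {u w : Wave} (hu : IsSol u) (hw : IsSol w) : IsSol (u.add w) :=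
  ⟨hu.pd.add hw.pd, (hu.pd_t.add hw.pd_t).congr (fun z _ => by simp only [Wave.add]; ring)
    fun _ _ => rfl, hu.pd_x.add hw.pd_x, hu.cont_tx.add hw.cont_tx, hu.cont_xx.add hw.cont_xx⟩

/-- The field underlying a wave. -/
def field (w : Wave) : Field := ⟨w.v, w.t, w.x⟩

end Wave

/-- The zero field. -/
def zeroField : Field := ⟨fun _ => 0, fun _ => 0, fun _ => 0⟩

lemma energyDensity_polarized (w : Wave) (z : SpaceTime) :
    energyDensity w.field zeroField z = w.t z ^ 2 + w.x z ^ 2 := by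
  simp [energyDensity, Wave.field, zeroField]

lemma momentumDensity_polarized (w : Wave) (z : SpaceTime) :
    momentumDensity w.field zeroField z = 2 * w.t z * w.x z := by
  simp [momentumDensity, Wave.field, zeroField]

lemma hasPd_zero : HasPd (fun _ => 0) (fun _ => 0) fun _ => 0 :=
  ⟨continuousOn_const, fun z _ => hasDerivAt_const z.1 (0 : ℝ),
    fun _ _ => hasDerivAt_const (0 : ℝ) (0 : ℝ)⟩

lemma continuousOn_inv_time : ContinuousOn (fun z : SpaceTime => z.1⁻¹) (slab (Ioi 0)) :=
  continuousOn_fst.inv₀ fun z hz => ne_of_gt (mem_slab.1 hz : (0 : ℝ) < z.1)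

namespace Wave.IsSol

variable {w : Wave} {I : Set ℝ}

lemma cont_tt (h : w.IsSol) : ContinuousOn (fun z => -(w.t z) / z.1 + w.xx z) (slab (Ioi 0)) :=
  (h.pd_t.cont.neg.mul continuousOn_inv_time).add h.cont_xx

lemma isEssentialSolution (h : w.IsSol) (hI : I.OrdConnected) (hI0 : I ⊆ Ioi 0) :
    IsEssentialSolution I w.field zeroField := by
  refine ⟨HasPd.isRegular hI hI0 2 h.pd h.pd_t.cont h.pd_x.cont,
    HasPd.isRegular hI hI0 2 hasPd_zero hasPd_zero.cont hasPd_zero.cont, ?_, ?_⟩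
  · exact HasPd.weakWave hI hI0 (u := w.field) h.pd_t h.pd_x h.cont_tt h.cont_xx fun z _ => by
      simp only [Wave.field, zeroField]; ring
  · exact HasPd.weakWave hI hI0 (u := zeroField) hasPd_zero hasPd_zero hasPd_zero.cont
      hasPd_zero.cont fun z _ => by simp [Wave.field, zeroField]

/-- Classical solutions of the constraints give solutions of the full equations. -/
lemma isGowdySolution (h : w.IsSol) (hI : I.OrdConnected) (hI0 : I ⊆ Ioi 0) {lam : SpaceTime → ℝ}
    (hlam : HasPd lam (fun z => z.1 * (w.t z ^ 2 + w.x z ^ 2)) fun z => z.1 * (2 * w.t z * w.x z)) :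
    IsGowdySolution I w.field zeroField ⟨lam, fun z => z.1 * (w.t z ^ 2 + w.x z ^ 2),
      fun z => z.1 * (2 * w.t z * w.x z)⟩ := by
  have htime : HasPd (fun z => z.1) (fun _ => 1) fun _ => 0 :=
    HasPd.time (a := fun t => t) (a' := fun _ => 1) fun t _ => hasDerivAt_id t
  have h1 := htime.mul ((h.pd_t.mul h.pd_t).add (h.pd_x.mul h.pd_x))
  have h2 := htime.mul ((h.pd_t.const_mul 2).mul h.pd_x)
  have c1 : ContinuousOn (fun z : SpaceTime => z.1 * (w.t z ^ 2 + w.x z ^ 2)) (slab (Ioi 0)) :=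
    continuousOn_fst.mul ((h.pd_t.cont.pow 2).add (h.pd_x.cont.pow 2))
  have hms := measurableSet_slab hI.measurableSet
  refine ⟨h.isEssentialSolution hI hI0, HasPd.isRegular hI hI0 1 hlam c1 h2.cont, ?_, ?_, ?_⟩
  · simp only [← sq] at h1
    refine HasPd.weakWave hI hI0 (u := ⟨lam, _, _⟩) h1 h2 ?_ ?_ fun z hz => ?_
    · exact (continuousOn_const.mul ((h.pd_t.cont.pow 2).add (h.pd_x.cont.pow 2))).add
        (continuousOn_fst.mul (((h.cont_tt.mul h.pd_t.cont).add (h.pd_t.cont.mul h.cont_tt)).add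
          ((h.cont_tx.mul h.pd_x.cont).add (h.pd_x.cont.mul h.cont_tx))))
    · exact (continuousOn_const.mul ((continuousOn_const.mul h.pd_t.cont).mul h.pd_x.cont)).add
        (continuousOn_fst.mul (((continuousOn_const.mul h.cont_tx).mul h.pd_x.cont).add
          ((continuousOn_const.mul h.pd_t.cont).mul h.cont_xx)))
    · simp only [Wave.field, zeroField]
      field_simp
      ring
  · filter_upwards [ae_restrict_mem hms] with z hz
    have hz0 : (0 : ℝ) < z.1 := hI0 (mem_slab.1 hz)
    rw [energyDensity_polarized]
    field_simp
  · filter_upwards [ae_restrict_mem hms] with z hz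
    have hz0 : (0 : ℝ) < z.1 := hI0 (mem_slab.1 hz)
    rw [momentumDensity_polarized]
    field_simp

end Wave.IsSol

/-! ### Trigonometric waves -/

/-- The frequency of the `m`-th trigonometric function on the circle of length one. -/
noncomputable def freq (m : ℤ) : ℝ := 2 * Real.pi * m

lemma freq_pos {m : ℤ} (hm : 0 < m) : 0 < freq m := by
  have : (0 : ℝ) < m := by exact_mod_cast hm
  unfold freq; positivity

lemma cosC_sq_add_sinC_sq (m : ℤ) (θ : UnitAddCircle) : cosC m θ ^ 2 + sinC m θ ^ 2 = 1 := by
  obtain ⟨x, rfl⟩ := QuotientAddGroup.mk_surjective θ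
  rw [cosC_coe, sinC_coe, Real.cos_sq_add_sin_sq]

lemma abs_cosC_le (m : ℤ) (θ : UnitAddCircle) : |cosC m θ| ≤ 1 :=
  abs_le_one_iff_mul_self_le_one.2 (by nlinarith [cosC_sq_add_sinC_sq m θ, sq_nonneg (sinC m θ)])

lemma abs_sinC_le (m : ℤ) (θ : UnitAddCircle) : |sinC m θ| ≤ 1 :=
  abs_le_one_iff_mul_self_le_one.2 (by nlinarith [cosC_sq_add_sinC_sq m θ, sq_nonneg (cosC m θ)])

lemma continuous_cosC (m : ℤ) : Continuous (cosC m) :=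
  Complex.continuous_re.comp (fourier m).continuous

lemma continuous_sinC (m : ℤ) : Continuous (sinC m) :=
  Complex.continuous_im.comp (fourier m).continuous

lemma hasPd_cosC (m : ℤ) :
    HasPd (fun z => cosC m z.2) (fun _ => 0) fun z => -freq m * sinC m z.2 := by
  refine HasPd.space (f' := fun θ => -freq m * sinC m θ) (continuous_cosC m) fun θ => ?_
  obtain ⟨x, rfl⟩ := QuotientAddGroup.mk_surjective θ
  change HasDerivAt (fun h : ℝ => cosC m ((x : UnitAddCircle) + (h : UnitAddCircle)))
    (-freq m * sinC m (x : UnitAddCircle)) 0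
  simp_rw [← AddCircle.coe_add, cosC_coe, sinC_coe]
  have h1 : HasDerivAt (fun h : ℝ => 2 * Real.pi * m * (x + h)) (2 * Real.pi * m) 0 := by
    simpa using ((hasDerivAt_id (0 : ℝ)).const_add x).const_mul (2 * Real.pi * m)
  refine h1.cos.congr_deriv ?_
  rw [add_zero, freq]; ring

lemma hasPd_sinC (m : ℤ) :
    HasPd (fun z => sinC m z.2) (fun _ => 0) fun z => freq m * cosC m z.2 := by
  refine HasPd.space (f' := fun θ => freq m * cosC m θ) (continuous_sinC m) fun θ => ?_
  obtain ⟨x, rfl⟩ := QuotientAddGroup.mk_surjective θ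
  change HasDerivAt (fun h : ℝ => sinC m ((x : UnitAddCircle) + (h : UnitAddCircle)))
    (freq m * cosC m (x : UnitAddCircle)) 0
  simp_rw [← AddCircle.coe_add, cosC_coe, sinC_coe]
  have h1 : HasDerivAt (fun h : ℝ => 2 * Real.pi * m * (x + h)) (2 * Real.pi * m) 0 := by
    simpa using ((hasDerivAt_id (0 : ℝ)).const_add x).const_mul (2 * Real.pi * m)
  refine h1.sin.congr_deriv ?_
  rw [add_zero, freq]; ring

/-- `α(t) cos + β(t) sin` for the trigonometric functions of index `m`. -/
noncomputable def trig (m : ℤ) (α β : ℝ → ℝ) (z : SpaceTime) : ℝ :=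
  α z.1 * cosC m z.2 + β z.1 * sinC m z.2

lemma hasPd_trig (m : ℤ) {α α' β β' : ℝ → ℝ} (hα : ∀ t, 0 < t → HasDerivAt α (α' t) t)
    (hβ : ∀ t, 0 < t → HasDerivAt β (β' t) t) :
    HasPd (trig m α β) (trig m α' β')
      (trig m (fun t => freq m * β t) fun t => -(freq m * α t)) :=
  (((HasPd.time hα).mul (hasPd_cosC m)).add ((HasPd.time hβ).mul (hasPd_sinC m))).congr
    (fun z _ => by simp only [trig]; ring) fun z _ => by simp only [trig]; ring

lemma abs_trig_le (m : ℤ) {α β : ℝ → ℝ} {C : ℝ} {z : SpaceTime} (hα : |α z.1| ≤ C)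
    (hβ : |β z.1| ≤ C) : |trig m α β z| ≤ 2 * C := by
  have hC := (abs_nonneg _).trans hα
  calc |trig m α β z| ≤ |α z.1| * |cosC m z.2| + |β z.1| * |sinC m z.2| := by
        rw [← abs_mul, ← abs_mul]; exact abs_add_le _ _
    _ ≤ C * 1 + C * 1 := by
        gcongr
        exacts [abs_cosC_le _ _, abs_sinC_le _ _]
    _ = 2 * C := by ring

namespace ModePair

variable {m : ℤ} {t₀ : ℝ}

/-- The wave `A cos + σ B sin` of frequency index `m`. The sign `σ` is the sign of its momentum. -/
noncomputable def wave (p : ModePair (freq m) t₀) (σ : ℝ) : Wave where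
  v := trig m p.A fun t => σ * p.B t
  t := trig m p.A' fun t => σ * p.B' t
  x := trig m (fun t => freq m * (σ * p.B t)) fun t => -(freq m * p.A t)
  tx := trig m (fun t => freq m * (σ * p.B' t)) fun t => -(freq m * p.A' t)
  xx := fun z => -freq m ^ 2 * trig m p.A (fun t => σ * p.B t) z

variable (p : ModePair (freq m) t₀) (σ : ℝ)

lemma isModeSol : (p.wave σ).IsModeSol (freq m) := by
  have hv := hasPd_trig m p.modeA.deriv fun t ht => (p.modeB.deriv t ht).const_mul σ
  have ht := hasPd_trig m p.modeA.deriv' fun t ht => (p.modeB.deriv' t ht).const_mul σ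
  have hx := hasPd_trig m (fun t ht => ((p.modeB.deriv t ht).const_mul σ).const_mul (freq m))
    fun t ht => ((p.modeA.deriv t ht).const_mul (freq m)).neg
  have htx := hasPd_trig m (fun t ht => ((p.modeB.deriv' t ht).const_mul σ).const_mul (freq m))
    fun t ht => ((p.modeA.deriv' t ht).const_mul (freq m)).neg
  refine ⟨⟨hv, ht.congr (fun z _ => ?_) fun z _ => rfl, hx.congr (fun z _ => rfl) fun z _ => ?_,
    htx.cont, continuousOn_const.mul hv.cont⟩, fun z => rfl,
    htx.congr (fun z _ => ?_) fun z _ => ?_⟩ <;> simp only [wave, trig, Pi.neg_apply] <;> ring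

/-- Sum of the energies of the two modes. -/
noncomputable def energy (t : ℝ) : ℝ := modeEnergy (freq m) p.A p.A' t + modeEnergy (freq m) p.B p.B' t

/-- The solution of the constraints associated with a single wave. Its `θ`-derivative is off by the
constant momentum of the wave, which is a multiple of the Wronskian of the two modes. -/
noncomputable def lam (z : SpaceTime) : ℝ :=
  z.1 * ((p.wave σ).v z * (p.wave σ).t z) + 1 / 2 * (z.1 ^ 2 * p.energy z.1)

lemma hasPd_lam (ht₀ : 0 < t₀) (hm : 0 < m) (hσ : σ ^ 2 = 1) :
    HasPd (p.lam σ) (fun z => z.1 * ((p.wave σ).t z ^ 2 + (p.wave σ).x z ^ 2))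
      fun z => z.1 * (2 * (p.wave σ).t z * (p.wave σ).x z) + σ * t₀ := by
  have hs := (p.isModeSol σ).sol
  have htime : HasPd (fun z => z.1) (fun _ => 1) fun _ => 0 :=
    HasPd.time (a := fun t => t) (a' := fun _ => 1) fun t _ => hasDerivAt_id t
  have hE := HasPd.time (a := fun t => t ^ 2 * p.energy t) fun t ht => (hasDerivAt_pow 2 t).mul
    ((p.modeA.hasDerivAt_energy ht).add (p.modeB.hasDerivAt_energy ht))
  refine ((htime.mul (hs.pd.mul hs.pd_t)).add (hE.const_mul (1 / 2))).congr (fun z hz => ?_)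
    fun z hz => ?_
  · have hcs := cosC_sq_add_sinC_sq m z.2
    simp only [wave, trig, modeEnergy, Nat.cast_ofNat, Pi.add_apply]
    field_simp
    linear_combination (-(z.1 * freq m ^ 2 * (p.A z.1 ^ 2 + σ ^ 2 * p.B z.1 ^ 2))) * hcs
      - z.1 * freq m ^ 2 * p.B z.1 ^ 2 * hσ
  · have hw := p.modeA.wronskian p.modeB ht₀ hz
    rw [p.A_init, p.A'_init, p.B'_init] at hw
    have hk : freq m * (1 / freq m) = 1 := mul_one_div_cancel (freq_pos hm).ne'
    have hcs := cosC_sq_add_sinC_sq m z.2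
    simp only [wave, trig]
    linear_combination (freq m * σ * (cosC m z.2 ^ 2 + sinC m z.2 ^ 2)) * hw + σ * t₀ * hk +
      σ * t₀ * freq m * (1 / freq m) * hcs

end ModePair

/-- The interaction term of two waves of frequencies `k` and `l` in the solution of the constraints. -/
noncomputable def lamCross (k l : ℝ) (u w : Wave) (z : SpaceTime) : ℝ :=
  2 / (l ^ 2 - k ^ 2) * (z.1 * (l ^ 2 * (u.t z * w.v z) + u.tx z * w.x z - k ^ 2 * (w.t z * u.v z)
    - w.tx z * u.x z))

/-- Since the amplitudes of the two waves are eigenfunctions for different eigenvalues `-k²` and `-l²`,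
the mixed terms of the constraints can be integrated explicitly. -/
lemma hasPd_lamCross {k l : ℝ} {u w : Wave} (hu : u.IsModeSol k) (hw : w.IsModeSol l)
    (hkl : l ^ 2 - k ^ 2 ≠ 0) :
    HasPd (lamCross k l u w) (fun z => z.1 * (2 * (u.t z * w.t z + u.x z * w.x z)))
      fun z => z.1 * (2 * (u.t z * w.x z + w.t z * u.x z)) := by
  have htime : HasPd (fun z => z.1) (fun _ => 1) fun _ => 0 :=
    HasPd.time (a := fun t => t) (a' := fun _ => 1) fun t _ => hasDerivAt_id t
  have h := (htime.mul (((((hu.sol.pd_t.mul hw.sol.pd).const_mul (l ^ 2)).add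
    (hu.pd_tx.mul hw.sol.pd_x)).sub ((hw.sol.pd_t.mul hu.sol.pd).const_mul (k ^ 2))).sub
    (hw.pd_tx.mul hu.sol.pd_x))).const_mul (2 / (l ^ 2 - k ^ 2))
  refine h.congr (fun z hz => ?_) fun z hz => ?_
  · rw [hu.xx_eq, hw.xx_eq]
    field_simp
    ring
  · rw [hu.xx_eq, hw.xx_eq]
    field_simp
    ring

/-! ### The Riemann–Lebesgue lemma in space -/

/-- Fourier coefficients tend to zero, by the Riemann–Lebesgue lemma on the line for one period. -/
lemma tendsto_integral_fourier {G : UnitAddCircle → ℝ} (hG : Integrable G) :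
    Tendsto (fun n : ℕ => ∫ θ, cosC n θ * G θ) atTop (𝓝 0) ∧
      Tendsto (fun n : ℕ => ∫ θ, sinC n θ * G θ) atTop (𝓝 0) := by
  have h0 := Real.tendsto_integral_exp_smul_cocompact
    ((Ioc (0 : ℝ) (0 + 1)).indicator fun x => ((G (x : UnitAddCircle) : ℝ) : ℂ))
  have h1 : Tendsto (fun n : ℕ => -(n : ℝ)) atTop (cocompact ℝ) :=
    (tendsto_neg_atTop_atBot.comp tendsto_natCast_atTop_atTop).mono_right atBot_le_cocompact
  have h2 := h0.comp h1
  have e : ∀ n : ℕ, ∫ v : ℝ, Real.fourierChar (-(v * -(n : ℝ))) •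
      (Ioc (0 : ℝ) (0 + 1)).indicator (fun x => ((G (x : UnitAddCircle) : ℝ) : ℂ)) v
        = ∫ θ : UnitAddCircle, fourier (n : ℤ) θ * (G θ : ℂ) := by
    intro n
    rw [← UnitAddCircle.integral_preimage 0, ← integral_indicator measurableSet_Ioc]
    congr 1
    funext v
    by_cases hv : v ∈ Ioc (0 : ℝ) (0 + 1)
    · rw [indicator_of_mem hv, indicator_of_mem hv, Circle.smul_def, Real.fourierChar_apply,
        fourier_coe_apply, smul_eq_mul]
      congr 2
      push_cast
      ring
    · rw [indicator_of_notMem hv, indicator_of_notMem hv, smul_zero]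
  have hint : ∀ n : ℕ, Integrable fun θ : UnitAddCircle => fourier (n : ℤ) θ * (G θ : ℂ) := by
    intro n
    refine hG.ofReal.bdd_mul (c := 1) (fourier (n : ℤ)).continuous.aestronglyMeasurable
      (.of_forall fun θ => ?_)
    rw [fourier_apply, Circle.norm_coe]
  have h3 : Tendsto (fun n : ℕ => ∫ θ : UnitAddCircle, fourier (n : ℤ) θ * (G θ : ℂ)) atTop (𝓝 0) :=
    h2.congr e
  constructor
  · refine ((Complex.continuous_re.tendsto _).comp h3).congr fun n => ?_
    have := Complex.reCLM.integral_comp_comm (hint n)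
    simpa [cosC] using this.symm
  · refine ((Complex.continuous_im.tendsto _).comp h3).congr fun n => ?_
    have := Complex.imCLM.integral_comp_comm (hint n)
    simpa [sinC] using this.symm

/-- Trigonometric functions with bounded time-dependent amplitudes converge weakly to zero as their
frequency tends to infinity. -/
lemma tendsto_integral_trig {J : Set ℝ} (hJ : MeasurableSet J) {μ : ℕ → ℕ}
    (hμ : Tendsto μ atTop atTop) {α β : ℕ → ℝ → ℝ} {C : ℝ} (hαm : ∀ n, ContinuousOn (α n) J) (hβm : ∀ n, ContinuousOn (β n) J)
    (hα : ∀ n, ∀ t ∈ J, |α n t| ≤ C) (hβ : ∀ n, ∀ t ∈ J, |β n t| ≤ C) {g : SpaceTime → ℝ}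
    (hg : Integrable g (volume.restrict (slab J))) :
    Tendsto (fun n : ℕ => ∫ z in slab J, trig (μ n) (α n) (β n) z * g z) atTop (𝓝 0) := by
  have hms := measurableSet_slab hJ
  have hcont : ∀ n : ℕ, ContinuousOn (trig (μ n) (α n) (β n)) (slab J) := fun n =>
    (((hαm n).comp continuousOn_fst fun z hz => mem_slab.1 hz).mul
      ((continuous_cosC (μ n)).comp continuous_snd).continuousOn).add
    (((hβm n).comp continuousOn_fst fun z hz => mem_slab.1 hz).mul
      ((continuous_sinC (μ n)).comp continuous_snd).continuousOn)
  have hint : ∀ n : ℕ, Integrable (fun z => trig (μ n) (α n) (β n) z * g z) (volume.restrict (slab J)) := by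
    intro n
    refine hg.bdd_mul (c := 2 * C) ((hcont n).aestronglyMeasurable hms) ?_
    filter_upwards [ae_restrict_mem hms] with z hz
    exact abs_trig_le _ (hα n _ (mem_slab.1 hz)) (hβ n _ (mem_slab.1 hz))
  rw [restrict_slab] at hg hint
  simp_rw [restrict_slab]
  have e : ∀ n : ℕ, ∫ z, trig (μ n) (α n) (β n) z * g z ∂((volume.restrict J).prod volume)
      = ∫ t in J, ∫ θ, trig (μ n) (α n) (β n) (t, θ) * g (t, θ) := fun n => integral_prod _ (hint n)
  simp_rw [e]
  have hz : ∫ _ in J, (0 : ℝ) = 0 := by simp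
  rw [← hz]
  refine tendsto_integral_of_dominated_convergence (fun t => 2 * C * ∫ θ, ‖g (t, θ)‖)
    (fun n => (hint n).integral_prod_left.aestronglyMeasurable)
    (hg.integral_norm_prod_left.const_mul _) (fun n => ?_) ?_
  · filter_upwards [hg.prod_right_ae, ae_restrict_mem hJ] with t ht htJ
    rw [← integral_const_mul]
    refine norm_integral_le_of_norm_le (ht.norm.const_mul _) (.of_forall fun θ => ?_)
    rw [norm_mul]
    gcongr
    exact abs_trig_le (z := (t, θ)) _ (hα n t htJ) (hβ n t htJ)
  · filter_upwards [hg.prod_right_ae, ae_restrict_mem hJ] with t ht htJ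
    obtain ⟨h1, h2⟩ := tendsto_integral_fourier ht
    have hc : ∀ n : ℕ, Integrable fun θ => cosC (μ n) θ * g (t, θ) := fun n =>
      ht.bdd_mul (c := 1) (continuous_cosC (μ n)).aestronglyMeasurable (.of_forall (abs_cosC_le (μ n)))
    have hs : ∀ n : ℕ, Integrable fun θ => sinC (μ n) θ * g (t, θ) := fun n =>
      ht.bdd_mul (c := 1) (continuous_sinC (μ n)).aestronglyMeasurable (.of_forall (abs_sinC_le (μ n)))
    have e2 : ∀ n : ℕ, ∫ θ, trig (μ n) (α n) (β n) (t, θ) * g (t, θ)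
        = α n t * (∫ θ, cosC (μ n) θ * g (t, θ)) + β n t * ∫ θ, sinC (μ n) θ * g (t, θ) := by
      intro n
      rw [← integral_const_mul, ← integral_const_mul,
        ← integral_add ((hc n).const_mul _) ((hs n).const_mul _)]
      congr 1; funext θ; simp only [trig]; ring
    simp_rw [e2]
    have key : ∀ {c d : ℕ → ℝ}, (∀ n, |c n| ≤ C) → Tendsto d atTop (𝓝 0) →
        Tendsto (fun n => c n * d n) atTop (𝓝 0) := by
      intro c d hc hd
      refine squeeze_zero_norm (fun n => ?_) (by simpa using hd.abs.const_mul C)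
      rw [norm_mul]; exact mul_le_mul_of_nonneg_right (hc n) (abs_nonneg _)
    simpa using (key (fun n => hα n t htJ) (h1.comp hμ)).add (key (fun n => hβ n t htJ) (h2.comp hμ))

/-! ### Bounds for trigonometric waves -/

lemma one_le_freq {m : ℤ} (hm : 0 < m) : 1 ≤ freq m := by
  have h1 : (1 : ℝ) ≤ m := by exact_mod_cast hm
  have := Real.pi_gt_three
  unfold freq
  nlinarith

namespace ModePair

variable {m : ℤ} {t₀ : ℝ} (p : ModePair (freq m) t₀) {σ : ℝ} {t : ℝ}

lemma energy_A (hm : 0 < m) : modeEnergy (freq m) p.A p.A' t₀ = 1 := by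
  have := (freq_pos hm).ne'
  rw [modeEnergy, p.A_init, p.A'_init]; field_simp; ring

lemma energy_B : modeEnergy (freq m) p.B p.B' t₀ = 1 := by
  rw [modeEnergy, p.B_init, p.B'_init]; ring

lemma bounds (hm : 0 < m) (ht₀ : 0 < t₀) (hσ : |σ| = 1) (ht : t₀ ≤ t) :
    |p.A t| ≤ 1 / freq m ∧ |p.A' t| ≤ 1 ∧ |σ * p.B t| ≤ 1 / freq m ∧ |σ * p.B' t| ≤ 1 := by
  rw [abs_mul, abs_mul, hσ, one_mul, one_mul]
  exact ⟨p.modeA.abs_le (freq_pos hm) ht₀ (p.energy_A hm) ht,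
    p.modeA.abs_deriv_le ht₀ (p.energy_A hm) ht,
    p.modeB.abs_le (freq_pos hm) ht₀ p.energy_B ht, p.modeB.abs_deriv_le ht₀ p.energy_B ht⟩

lemma abs_freq_mul_le (hm : 0 < m) {a : ℝ} (ha : |a| ≤ 1 / freq m) : |freq m * a| ≤ 1 := by
  have := freq_pos hm
  rw [abs_mul, abs_of_pos this]
  calc freq m * |a| ≤ freq m * (1 / freq m) := by gcongr
    _ = 1 := mul_one_div_cancel this.ne'

lemma wave_bounds (hm : 0 < m) (ht₀ : 0 < t₀) (hσ : |σ| = 1) {z : SpaceTime} (hz : t₀ ≤ z.1) :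
    |(p.wave σ).v z| ≤ 2 / freq m ∧ |(p.wave σ).t z| ≤ 2 ∧ |(p.wave σ).x z| ≤ 2 ∧
      |(p.wave σ).tx z| ≤ 2 * freq m := by
  obtain ⟨h1, h2, h3, h4⟩ := p.bounds hm ht₀ hσ hz
  have hk := freq_pos hm
  have h5 : ∀ {a : ℝ}, |a| ≤ 1 → |freq m * a| ≤ freq m := fun ha => by
    rw [abs_mul, abs_of_pos hk]; exact mul_le_of_le_one_right hk.le ha
  refine ⟨?_, ?_, ?_, abs_trig_le m
    (α := fun t => freq m * (σ * p.B' t)) (β := fun t => -(freq m * p.A' t)) (h5 h4)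
    (by rw [abs_neg]; exact h5 h2)⟩
  · rw [← mul_one_div]; exact abs_trig_le m (β := fun t => σ * p.B t) h1 h3
  · rw [← mul_one (2 : ℝ)]; exact abs_trig_le m (β := fun t => σ * p.B' t) h2 h4
  · rw [← mul_one (2 : ℝ)]
    exact abs_trig_le m (α := fun t => freq m * (σ * p.B t)) (β := fun t => -(freq m * p.A t))
      (abs_freq_mul_le hm h3) (by rw [abs_neg]; exact abs_freq_mul_le hm h1)

/-- For large frequencies the contribution of a wave to the solution of the constraints is close to
`t₀ t`, although its amplitude tends to zero. -/
lemma abs_lam_sub_le (hm : 0 < m) (ht₀ : 0 < t₀) (hσ : |σ| = 1) {z : SpaceTime} (hz : t₀ ≤ z.1) :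
    |p.lam σ z - t₀ * z.1| ≤ (4 * z.1 + z.1 ^ 2 / t₀) / freq m := by
  obtain ⟨h1, h2, -, -⟩ := p.wave_bounds hm ht₀ hσ hz
  have hk := freq_pos hm
  have hz0 : 0 < z.1 := ht₀.trans_le hz
  have hA := p.modeA.abs_mul_energy_sub_le hk ht₀ (p.energy_A hm) (by simp [p.A'_init]) hz
  have hB := p.modeB.abs_mul_energy_sub_le hk ht₀ p.energy_B (by simp [p.B_init]) hz
  have e : p.lam σ z - t₀ * z.1 = z.1 * ((p.wave σ).v z * (p.wave σ).t z)
      + 1 / 2 * z.1 * ((z.1 * modeEnergy (freq m) p.A p.A' z.1 - t₀)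
      + (z.1 * modeEnergy (freq m) p.B p.B' z.1 - t₀)) := by
    simp only [lam, energy]; ring
  have h3 : |z.1 * ((p.wave σ).v z * (p.wave σ).t z)| ≤ z.1 * (2 / freq m * 2) := by
    rw [abs_mul, abs_mul, abs_of_pos hz0]; gcongr
  have h4 : |1 / 2 * z.1 * ((z.1 * modeEnergy (freq m) p.A p.A' z.1 - t₀)
      + (z.1 * modeEnergy (freq m) p.B p.B' z.1 - t₀))|
      ≤ 1 / 2 * z.1 * (z.1 / (freq m * t₀) + z.1 / (freq m * t₀)) := by
    rw [abs_mul, abs_of_pos (by positivity : 0 < 1 / 2 * z.1)]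
    gcongr
    exact (abs_add_le _ _).trans (add_le_add hA hB)
  rw [e]
  refine (abs_add_le _ _).trans ((add_le_add h3 h4).trans_eq ?_)
  field_simp
  ring

end ModePair

/-- The interaction of a fixed wave with a wave of high frequency `l` is of order `1 / l`. -/
lemma abs_lamCross_le {k l : ℝ} (hk : 1 ≤ k) (hkl : 2 * k ≤ l) {u w : Wave} {z : SpaceTime}
    (hz : 0 < z.1) (huv : |u.v z| ≤ 2) (hut : |u.t z| ≤ 2) (hux : |u.x z| ≤ 2)
    (hutx : |u.tx z| ≤ 2 * k) (hwv : |w.v z| ≤ 2 / l) (hwt : |w.t z| ≤ 2) (hwx : |w.x z| ≤ 2)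
    (hwtx : |w.tx z| ≤ 2 * l) : |lamCross k l u w z| ≤ (48 + 16 * k) * z.1 / l := by
  have hl : 0 < l := by linarith
  have hd : l ^ 2 / 2 ≤ l ^ 2 - k ^ 2 := by nlinarith
  have hd0 : 0 < l ^ 2 - k ^ 2 := lt_of_lt_of_le (by positivity) hd
  have hp : ∀ {a b A B : ℝ}, |a| ≤ A → |b| ≤ B → |a * b| ≤ A * B := fun {a b A B} ha hb => by
    rw [abs_mul]; exact mul_le_mul ha hb (abs_nonneg _) ((abs_nonneg _).trans ha)
  have h1 : |l ^ 2 * (u.t z * w.v z)| ≤ l ^ 2 * (2 * (2 / l)) := by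
    rw [abs_mul, abs_of_pos (by positivity : 0 < l ^ 2)]; gcongr; exact hp hut hwv
  have h2 : |u.tx z * w.x z| ≤ 2 * k * 2 := hp hutx hwx
  have h3 : |k ^ 2 * (w.t z * u.v z)| ≤ k ^ 2 * (2 * 2) := by
    rw [abs_mul, abs_of_pos (by positivity : 0 < k ^ 2)]; gcongr; exact hp hwt huv
  have h4 : |w.tx z * u.x z| ≤ 2 * l * 2 := hp hwtx hux
  have h5 : |l ^ 2 * (u.t z * w.v z) + u.tx z * w.x z - k ^ 2 * (w.t z * u.v z) - w.tx z * u.x z|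
      ≤ (12 + 4 * k) * l := by
    have e : l ^ 2 * (2 * (2 / l)) = 4 * l := by field_simp; ring
    rw [e] at h1
    rw [abs_le] at *
    constructor <;> nlinarith
  rw [lamCross, abs_mul, abs_of_pos (by positivity), abs_mul, abs_of_pos hz]
  calc 2 / (l ^ 2 - k ^ 2) * (z.1 * _) ≤ 2 / (l ^ 2 / 2) * (z.1 * ((12 + 4 * k) * l)) := by
        gcongr
    _ = (48 + 16 * k) * z.1 / l := by field_simp; ring

/-! ### Instability of the constraints -/

/-- A constant added to a derivative is detected by test functions of time alone. -/
lemma exists_test_integral_ne {I : Set ℝ} (hI : I.OrdConnected) (hI0 : I ⊆ Ioi 0)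
    (hIn : I.Nontrivial) {v : SpaceTime → ℝ} (hv : ContinuousOn v (slab (Ioi 0))) {c : ℝ}
    (hc : c ≠ 0) : ∃ φ : SpaceTime → ℝ, IsTest I φ ∧ (∀ z, pdx φ z = 0) ∧
      ∫ z in slab I, (v z + c) * φ z ≠ ∫ z in slab I, v z * φ z := by
  obtain ⟨x, hx, y, hy, hxy⟩ := hIn.exists_lt
  obtain ⟨a, hxa, hay⟩ := exists_between hxy
  obtain ⟨b, hab, hby⟩ := exists_between hay
  have hsub : Icc a b ⊆ interior I := by
    have h1 : Ioo x y ⊆ interior I :=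
      interior_maximal (Ioo_subset_Icc_self.trans (hI.out hx hy)) isOpen_Ioo
    exact (Icc_subset_Ioo hxa hby).trans h1
  obtain ⟨a', b', η, hη⟩ := exists_cutoff hI hab.le hsub
  have hφ : IsTest I fun z => η z.1 :=
    (SmoothL.time hη.smooth).isTest isCompact_Icc hη.sub fun z hz => hη.zero _ hz
  have hφi : IntegrableOn (fun z : SpaceTime => η z.1) (slab I) := hφ.integrable.integrableOn
  have hvi : IntegrableOn (fun z : SpaceTime => v z * η z.1) (slab I) :=
    hφ.integrableOn_mul hI fun a b hab => by
      by_cases h : a ≤ b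
      · exact integrable_slab_Icc (hI0 (interior_subset (hab (left_mem_Icc.2 h)))) hv
      · rw [Icc_eq_empty h]; simp [slab]
  refine ⟨_, hφ, pdx_time η, ?_⟩
  simp_rw [add_mul]
  rw [integral_add hvi (hφi.const_mul c), integral_const_mul, Ne, add_eq_left]
  refine mul_ne_zero hc (ne_of_gt ?_)
  have hms := measurableSet_slab (measurableSet_Icc (a := a) (b := b))
  have h1 : ∫ z in slab (Icc a b), η z.1 ≤ ∫ z in slab I, η z.1 :=
    setIntegral_mono_set hφi (.of_forall fun z => (hη.range z.1).1)
      (slab_mono (hsub.trans interior_subset)).eventuallyLE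
  have h2 : ∫ z in slab (Icc a b), η z.1 = b - a := by
    rw [setIntegral_congr_fun (g := fun _ => (1 : ℝ)) hms fun z hz => hη.one _ (mem_slab.1 hz),
      restrict_slab]
    simp [Measure.real, Real.volume_Icc, hab.le, Measure.prod_apply]
  linarith

/-- Adding high-frequency oscillations of bounded amplitude does not change the weak limit. -/
lemma weakL2_add_trig {J : Set ℝ} (hJ : MeasurableSet J) (hJv : volume J < ⊤) (hJ0 : J ⊆ Ioi 0)
    {μ : ℕ → ℕ} (hμ : Tendsto μ atTop atTop) {U : SpaceTime → ℝ}
    (hU : ContinuousOn U (slab (Ioi 0))) {C : ℝ} (hUC : ∀ z : SpaceTime, z.1 ∈ J → |U z| ≤ C)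
    {α β : ℕ → ℝ → ℝ} (hαm : ∀ n, ContinuousOn (α n) (Ioi 0)) (hβm : ∀ n, ContinuousOn (β n) (Ioi 0))
    (hα : ∀ n, ∀ t ∈ J, |α n t| ≤ 1) (hβ : ∀ n, ∀ t ∈ J, |β n t| ≤ 1) :
    WeakL2 J (fun n z => U z + trig (μ n) (α n) (β n) z) U := by
  have hms := measurableSet_slab hJ
  have hfin : IsFiniteMeasure ((volume : Measure SpaceTime).restrict (slab J)) := by
    refine ⟨?_⟩
    rw [restrict_slab]
    simpa [Measure.prod_apply] using hJv
  have hUm : MemLp U 2 (volume.restrict (slab J)) := by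
    refine MemLp.of_bound ((hU.mono (slab_mono hJ0)).aestronglyMeasurable hms) C ?_
    filter_upwards [ae_restrict_mem hms] with z hz using hUC z (mem_slab.1 hz)
  have hT : ∀ n, MemLp (trig (μ n) (α n) (β n)) 2 (volume.restrict (slab J)) := by
    intro n
    have hc : ContinuousOn (trig (μ n) (α n) (β n)) (slab J) :=
      (((hαm n).comp continuousOn_fst fun z hz => hJ0 (mem_slab.1 hz)).mul
        ((continuous_cosC (μ n)).comp continuous_snd).continuousOn).add
      (((hβm n).comp continuousOn_fst fun z hz => hJ0 (mem_slab.1 hz)).mul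
        ((continuous_sinC (μ n)).comp continuous_snd).continuousOn)
    refine MemLp.of_bound (hc.aestronglyMeasurable hms) (2 * 1) ?_
    filter_upwards [ae_restrict_mem hms] with z hz
    exact abs_trig_le _ (hα n _ (mem_slab.1 hz)) (hβ n _ (mem_slab.1 hz))
  refine ⟨fun n => hUm.add (hT n), hUm, fun g hg => ?_⟩
  have h1 := tendsto_integral_trig hJ hμ (fun n => (hαm n).mono hJ0) (fun n => (hβm n).mono hJ0)
    hα hβ (hg.integrable (by norm_num))
  have e : ∀ n, ∫ z in slab J, (U z + trig (μ n) (α n) (β n) z) * g z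
      = (∫ z in slab J, U z * g z) + ∫ z in slab J, trig (μ n) (α n) (β n) z * g z := by
    intro n
    rw [← integral_add (integrable_mul_of_memLp hUm hg) (integrable_mul_of_memLp (hT n) hg)]
    simp only [add_mul]
  simp_rw [e]
  simpa using h1.const_add (∫ z in slab J, U z * g z)

section Construction

variable {t₀ : ℝ} (p : ModePair (freq 1) t₀) (q : ∀ n : ℕ, ModePair (freq ((n + 2 : ℕ) : ℤ)) t₀)

/-- The sum of a fixed wave and of a wave of high frequency with opposite momentum. -/
noncomputable def superposition (n : ℕ) : Wave := (p.wave 1).add ((q n).wave (-1))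

/-- The solution of the constraints for the superposition. The two momenta cancel. -/
noncomputable def lamSeq (n : ℕ) (z : SpaceTime) : ℝ :=
  p.lam 1 z + (q n).lam (-1) z
    + lamCross (freq 1) (freq ((n + 2 : ℕ) : ℤ)) (p.wave 1) ((q n).wave (-1)) z

/-- The limit of `lamSeq`. The high-frequency wave contributes `t₀ t`, the time integral of `t₀`, the
weak limit of `t` times its energy density. -/
noncomputable def lamLim (z : SpaceTime) : ℝ := p.lam 1 z + t₀ * z.1

lemma isSol_superposition (n : ℕ) : (superposition p q n).IsSol :=
  (p.isModeSol 1).sol.add ((q n).isModeSol (-1)).sol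

lemma freq_two_mul_le (n : ℕ) : 2 * freq 1 ≤ freq ((n + 2 : ℕ) : ℤ) := by
  unfold freq
  push_cast
  nlinarith [Real.pi_pos, mul_nonneg Real.pi_pos.le (Nat.cast_nonneg (α := ℝ) n)]

lemma tendsto_freq : Tendsto (fun n : ℕ => freq ((n + 2 : ℕ) : ℤ)) atTop atTop := by
  unfold freq
  refine Tendsto.const_mul_atTop Real.two_pi_pos ?_
  simp only [Int.cast_natCast]
  exact tendsto_natCast_atTop_atTop.comp (tendsto_add_atTop_nat 2)

/-- `lamSeq` solves both constraints: the constants `σ t₀` in the `θ`-derivatives of the two waves cancel. -/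
lemma hasPd_lamSeq (ht₀ : 0 < t₀) (n : ℕ) : HasPd (lamSeq p q n)
    (fun z => z.1 * ((superposition p q n).t z ^ 2 + (superposition p q n).x z ^ 2))
    fun z => z.1 * (2 * (superposition p q n).t z * (superposition p q n).x z) := by
  have hk := freq_pos (m := 1) (by norm_num)
  have hkl := freq_two_mul_le n
  have h1 := p.hasPd_lam 1 ht₀ (by norm_num) (by norm_num)
  have h2 := (q n).hasPd_lam (-1) ht₀ (by positivity) (by norm_num)
  have h3 := hasPd_lamCross (p.isModeSol 1) ((q n).isModeSol (-1))
    (ne_of_gt (by nlinarith) : freq ((n + 2 : ℕ) : ℤ) ^ 2 - freq 1 ^ 2 ≠ 0)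
  refine ((h1.add h2).add h3).congr (fun z _ => ?_) fun z _ => ?_ <;>
    simp only [superposition, Wave.add] <;> ring

/-- The limit violates both constraints by the constant `t₀`. -/
lemma hasPd_lamLim (ht₀ : 0 < t₀) : HasPd (lamLim p)
    (fun z => z.1 * ((p.wave 1).t z ^ 2 + (p.wave 1).x z ^ 2) + t₀)
    fun z => z.1 * (2 * (p.wave 1).t z * (p.wave 1).x z) + t₀ := by
  have h1 := p.hasPd_lam 1 ht₀ (by norm_num) (by norm_num)
  have h2 : HasPd (fun z => t₀ * z.1) (fun _ => t₀) fun _ => 0 :=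
    HasPd.time (a := fun t => t₀ * t) (a' := fun _ => t₀) fun t _ => by
      simpa using (hasDerivAt_id t).const_mul t₀
  exact (h1.add h2).congr (fun z _ => by ring) fun z _ => by ring

variable {p q}

lemma abs_wave_le_two (ht₀ : 0 < t₀) {m : ℤ} (hm : 0 < m) (r : ModePair (freq m) t₀) {σ : ℝ}
    (hσ : |σ| = 1) {z : SpaceTime} (hz : t₀ ≤ z.1) : |(r.wave σ).v z| ≤ 2 :=
  (r.wave_bounds hm ht₀ hσ hz).1.trans (div_le_self (by norm_num) (one_le_freq hm))

lemma abs_lamSeq_sub_le (ht₀ : 0 < t₀) (n : ℕ) {z : SpaceTime} (hz : t₀ ≤ z.1) :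
    |lamSeq p q n z - lamLim p z| ≤
      (4 * z.1 + z.1 ^ 2 / t₀ + (48 + 16 * freq 1) * z.1) / freq ((n + 2 : ℕ) : ℤ) := by
  have hm : (0 : ℤ) < ((n + 2 : ℕ) : ℤ) := by positivity
  have hσ : |(-1 : ℝ)| = 1 := by norm_num
  obtain ⟨-, u2, u3, u4⟩ := p.wave_bounds (m := 1) (by norm_num) ht₀ abs_one hz
  obtain ⟨w1, w2, w3, w4⟩ := (q n).wave_bounds hm ht₀ hσ hz
  have h1 := (q n).abs_lam_sub_le hm ht₀ hσ hz
  have h2 := abs_lamCross_le (one_le_freq (m := 1) (by norm_num)) (freq_two_mul_le n)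
    (ht₀.trans_le hz) (abs_wave_le_two ht₀ (by norm_num) p abs_one hz) u2 u3 u4 w1 w2 w3 w4
  have e : lamSeq p q n z - lamLim p z = ((q n).lam (-1) z - t₀ * z.1)
      + lamCross (freq 1) (freq ((n + 2 : ℕ) : ℤ)) (p.wave 1) ((q n).wave (-1)) z := by
    simp only [lamSeq, lamLim]; ring
  rw [e, add_div]
  exact (abs_add_le _ _).trans (add_le_add h1 h2)

lemma totalNorm_superposition_le (ht₀ : 0 < t₀) {I : Set ℝ} (hI : MeasurableSet I)
    (hI0 : I ⊆ Ici t₀) (n : ℕ) :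
    totalNorm I (superposition p q n).field zeroField ≤ ENNReal.ofReal 4 * 6 := by
  have hm : (0 : ℤ) < ((n + 2 : ℕ) : ℤ) := by positivity
  have hσ : |(-1 : ℝ)| = 1 := by norm_num
  have h4 : ∀ {a b : ℝ}, |a| ≤ 2 → |b| ≤ 2 → |a + b| ≤ 4 := fun ha hb =>
    (abs_add_le _ _).trans (by linarith)
  have h0 : mixedNorm I 2 (fun _ => 0) ≤ ENNReal.ofReal 4 :=
    mixedNorm_le_of_bound hI 2 fun z _ => by norm_num
  have hu := fun (z : SpaceTime) (hz : z.1 ∈ I) =>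
    p.wave_bounds (m := 1) (by norm_num) ht₀ abs_one (hI0 hz)
  have hw := fun (z : SpaceTime) (hz : z.1 ∈ I) => (q n).wave_bounds hm ht₀ hσ (hI0 hz)
  have h1 : mixedNorm I 2 (superposition p q n).v ≤ ENNReal.ofReal 4 :=
    mixedNorm_le_of_bound hI 2 fun z hz => h4 (abs_wave_le_two ht₀ (by norm_num) p abs_one (hI0 hz))
      (abs_wave_le_two ht₀ hm (q n) hσ (hI0 hz))
  have h2 : mixedNorm I 2 (superposition p q n).t ≤ ENNReal.ofReal 4 :=
    mixedNorm_le_of_bound hI 2 fun z hz => h4 (hu z hz).2.1 (hw z hz).2.1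
  have h3 : mixedNorm I 2 (superposition p q n).x ≤ ENNReal.ofReal 4 :=
    mixedNorm_le_of_bound hI 2 fun z hz => h4 (hu z hz).2.2.1 (hw z hz).2.2.1
  calc totalNorm I (superposition p q n).field zeroField
      ≤ ENNReal.ofReal 4 + ENNReal.ofReal 4 + ENNReal.ofReal 4 + ENNReal.ofReal 4
        + ENNReal.ofReal 4 + ENNReal.ofReal 4 :=
        add_le_add (add_le_add (add_le_add (add_le_add (add_le_add h1 h0) h2) h0) h3) h0
    _ = ENNReal.ofReal 4 * 6 := by ring

lemma weakH1_superposition (ht₀ : 0 < t₀) {I : Set ℝ} (hI0 : I ⊆ Ici t₀) :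
    WeakH1 I (fun n => (superposition p q n).field) (p.wave 1).field := by
  intro J hJI hJo hJb
  have hJ := hJo.measurableSet
  have hJt : J ⊆ Ici t₀ := hJI.trans hI0
  have hJ0 : J ⊆ Ioi 0 := hJt.trans (Ici_subset_Ioi.2 ht₀)
  have hm : ∀ n : ℕ, (0 : ℤ) < ((n + 2 : ℕ) : ℤ) := fun n => by positivity
  have hσ : |(-1 : ℝ)| = 1 := by norm_num
  have hs := (p.isModeSol 1).sol
  have hu := fun (z : SpaceTime) (hz : z.1 ∈ J) =>
    p.wave_bounds (m := 1) (by norm_num) ht₀ abs_one (hJt hz)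
  have hb := fun n t (ht : t ∈ J) => (q n).bounds (hm n) ht₀ hσ (hJt ht)
  have h1 : ∀ {a : ℝ} {n : ℕ}, |a| ≤ 1 / freq ((n + 2 : ℕ) : ℤ) → |a| ≤ 1 := fun {a n} ha =>
    ha.trans (div_le_self zero_le_one (one_le_freq (hm n)))
  have cA : ∀ n, ContinuousOn (q n).A (Ioi 0) := fun n t ht =>
    ((q n).modeA.deriv t ht).continuousAt.continuousWithinAt
  have cA' : ∀ n, ContinuousOn (q n).A' (Ioi 0) := fun n t ht =>
    ((q n).modeA.deriv' t ht).continuousAt.continuousWithinAt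
  have cB : ∀ n, ContinuousOn (q n).B (Ioi 0) := fun n t ht =>
    ((q n).modeB.deriv t ht).continuousAt.continuousWithinAt
  have cB' : ∀ n, ContinuousOn (q n).B' (Ioi 0) := fun n t ht =>
    ((q n).modeB.deriv' t ht).continuousAt.continuousWithinAt
  refine ⟨?_, ?_, ?_⟩
  · exact weakL2_add_trig (C := 2) (U := (p.wave 1).v) (μ := fun n => n + 2) hJ hJb.measure_lt_top hJ0
      (tendsto_add_atTop_nat 2) hs.pd.cont
      (fun z hz => abs_wave_le_two ht₀ (by norm_num) p abs_one (hJt hz)) cA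
      (fun n => continuousOn_const.mul (cB n)) (fun n t ht => h1 (hb n t ht).1)
      fun n t ht => h1 (hb n t ht).2.2.1
  · exact weakL2_add_trig (C := 2) (U := (p.wave 1).t) (μ := fun n => n + 2) hJ hJb.measure_lt_top hJ0
      (tendsto_add_atTop_nat 2) hs.pd_t.cont (fun z hz => (hu z hz).2.1) cA'
      (fun n => continuousOn_const.mul (cB' n)) (fun n t ht => (hb n t ht).2.1)
      fun n t ht => (hb n t ht).2.2.2
  · exact weakL2_add_trig (C := 2) (U := (p.wave 1).x) (μ := fun n => n + 2) hJ hJb.measure_lt_top hJ0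
      (tendsto_add_atTop_nat 2) hs.pd_x.cont (fun z hz => (hu z hz).2.2.1)
      (fun n => continuousOn_const.mul (continuousOn_const.mul (cB n)))
      (fun n => (continuousOn_const.mul (cA n)).neg)
      (fun n t ht => ModePair.abs_freq_mul_le (hm n) (hb n t ht).2.2.1)
      fun n t ht => by
        rw [Pi.neg_apply, abs_neg]
        exact ModePair.abs_freq_mul_le (hm n) (hb n t ht).1

lemma tendsto_lamSeq (ht₀ : 0 < t₀) {z : SpaceTime} (hz : t₀ ≤ z.1) :
    Tendsto (fun n => lamSeq p q n z) atTop (𝓝 (lamLim p z)) := by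
  rw [tendsto_iff_norm_sub_tendsto_zero]
  exact squeeze_zero (fun n => norm_nonneg _) (fun n => abs_lamSeq_sub_le ht₀ n hz)
    (tendsto_const_nhds.div_atTop tendsto_freq)

lemma tendsto_eLpNorm_lamSeq (ht₀ : 0 < t₀) {J : Set ℝ} (hJ : IsCompact J) (hJ0 : J ⊆ Ici t₀) :
    Tendsto (fun n => eLpNorm (fun z => lamSeq p q n z - lamLim p z) 1 (volume.restrict (slab J)))
      atTop (𝓝 0) := by
  obtain ⟨T, hT⟩ := hJ.bddAbove
  set K := 4 * T + T ^ 2 / t₀ + (48 + 16 * freq 1) * T with hK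
  have hb : ∀ n, eLpNorm (fun z => lamSeq p q n z - lamLim p z) 1 (volume.restrict (slab J))
      ≤ volume (slab J) * ENNReal.ofReal (K / freq ((n + 2 : ℕ) : ℤ)) := by
    intro n
    refine (eLpNorm_le_of_ae_bound (C := K / freq ((n + 2 : ℕ) : ℤ)) ?_).trans_eq (by simp)
    filter_upwards [ae_restrict_mem (measurableSet_slab hJ.measurableSet)] with z hz
    have hz' := hJ0 (mem_slab.1 hz)
    have hzT : z.1 ≤ T := hT (mem_slab.1 hz)
    have hz0 : 0 < z.1 := ht₀.trans_le hz'
    have hk := freq_pos (m := 1) (by norm_num)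
    refine (abs_lamSeq_sub_le ht₀ n hz').trans
      (div_le_div_of_nonneg_right ?_ (freq_pos (by positivity)).le)
    rw [hK]
    gcongr
  refine tendsto_of_tendsto_of_tendsto_of_le_of_le tendsto_const_nhds ?_ (fun _ => zero_le) hb
  have h1 : Tendsto (fun n : ℕ => ENNReal.ofReal (K / freq ((n + 2 : ℕ) : ℤ))) atTop (𝓝 0) := by
    rw [← ENNReal.ofReal_zero]
    exact ENNReal.tendsto_ofReal (tendsto_const_nhds.div_atTop tendsto_freq)
  have hfin : (volume : Measure SpaceTime) (slab J) < ⊤ := (isCompact_slab hJ).measure_lt_top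
  have h2 := ENNReal.Tendsto.const_mul h1 (Or.inr hfin.ne)
  rwa [mul_zero] at h2

end Construction

/-- The fields `Q` vanish. The limit of the `P` is the fixed wave alone, whose nonzero momentum is no
longer compensated, so that the momentum constraint cannot be solved on a circle. -/
theorem instability_full {I : Set ℝ} (hI : I.OrdConnected) (hIn : I.Nontrivial) {t₀ : ℝ}
    (ht₀ : 0 < t₀) (hIt : I ⊆ Ici t₀) :
    ∃ (P Q lam : ℕ → Field) (Plim Qlim : Field) (lamlim : SpaceTime → ℝ),
      (∀ n, IsGowdySolution I (P n) (Q n) (lam n)) ∧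
      limsup (fun n => totalNorm I (P n) (Q n)) atTop < ⊤ ∧
      WeakH1 I P Plim ∧ WeakH1 I Q Qlim ∧ IsEssentialSolution I Plim Qlim ∧
      (∀ᵐ z ∂(volume.restrict (slab I)),
        Tendsto (fun n => (lam n).val z) atTop (𝓝 (lamlim z))) ∧
      (∀ J : Set ℝ, IsCompact J → J ⊆ I → MemLp lamlim 1 (volume.restrict (slab J)) ∧
        Tendsto (fun n => eLpNorm (fun z => (lam n).val z - lamlim z) 1
          (volume.restrict (slab J))) atTop (𝓝 0)) ∧
      ¬ HasWeakDt I lamlim (fun z => z.1 * energyDensity Plim Qlim z) ∧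
      ¬ HasWeakDx I lamlim (fun z => z.1 * momentumDensity Plim Qlim z) ∧
      ∀ lam' : Field, ¬ IsGowdySolution I Plim Qlim lam' := by
  obtain ⟨p⟩ := nonempty_modePair (freq_pos (m := 1) (by norm_num)) ht₀
  have hq : ∀ n : ℕ, Nonempty (ModePair (freq ((n + 2 : ℕ) : ℤ)) t₀) := fun n =>
    nonempty_modePair (freq_pos (by positivity)) ht₀
  let q := fun n => (hq n).some
  have hI0 : I ⊆ Ioi 0 := hIt.trans (Ici_subset_Ioi.2 ht₀)
  have hms := measurableSet_slab hI.measurableSet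
  have hs := (p.isModeSol 1).sol
  have hlim := hasPd_lamLim p ht₀
  have ct : ContinuousOn (fun z => z.1 * ((p.wave 1).t z ^ 2 + (p.wave 1).x z ^ 2)) (slab (Ioi 0)) :=
    continuousOn_fst.mul ((hs.pd_t.cont.pow 2).add (hs.pd_x.cont.pow 2))
  have cx : ContinuousOn (fun z => z.1 * (2 * (p.wave 1).t z * (p.wave 1).x z)) (slab (Ioi 0)) :=
    continuousOn_fst.mul ((continuousOn_const.mul hs.pd_t.cont).mul hs.pd_x.cont)
  have hdt := hlim.hasWeakDt hI hI0 (ct.add continuousOn_const)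
  have hdx := hlim.hasWeakDx hI hI0 (cx.add continuousOn_const)
  obtain ⟨φ, hφ, -, hφne⟩ := exists_test_integral_ne hI hI0 hIn ct ht₀.ne'
  obtain ⟨ψ, hψ, hψx, hψne⟩ := exists_test_integral_ne hI hI0 hIn cx ht₀.ne'
  refine ⟨fun n => (superposition p q n).field, fun _ => zeroField, fun n => ⟨lamSeq p q n, _, _⟩,
    (p.wave 1).field, zeroField, lamLim p,
    fun n => (isSol_superposition p q n).isGowdySolution hI hI0 (hasPd_lamSeq p q ht₀ n), ?_,
    weakH1_superposition ht₀ hIt, ?_, hs.isEssentialSolution hI hI0, ?_, ?_, ?_, ?_, ?_⟩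
  · refine lt_of_le_of_lt (limsup_le_of_le (h := .of_forall fun n =>
      totalNorm_superposition_le ht₀ hI.measurableSet hIt n)) (by finiteness)
  · intro J _ _ _
    have h0 : WeakL2 J (fun _ _ => 0) fun _ => 0 :=
      ⟨fun _ => MemLp.zero, MemLp.zero, fun g _ => tendsto_const_nhds⟩
    exact ⟨h0, h0, h0⟩
  · filter_upwards [ae_restrict_mem hms] with z hz
    exact tendsto_lamSeq ht₀ (hIt (mem_slab.1 hz))
  · intro J hJ hJI
    refine ⟨memLp_one_iff_integrable.2 ?_, tendsto_eLpNorm_lamSeq ht₀ hJ (hJI.trans hIt)⟩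
    exact (hlim.cont.mono (slab_mono (hJI.trans hI0))).integrableOn_compact (isCompact_slab hJ)
  · intro h
    simp_rw [energyDensity_polarized] at h
    exact hφne (neg_injective ((hdt.eq φ hφ).symm.trans (h.eq φ hφ)))
  · intro h
    simp_rw [momentumDensity_polarized] at h
    exact hψne (neg_injective ((hdx.eq ψ hψ).symm.trans (h.eq ψ hψ)))
  · intro lam' h
    -- a test function of time alone only sees the mean of the momentum density
    have h1 := h.reg_lam.weak_dx.eq ψ hψ
    have h2 := hdx.eq ψ hψ
    simp only [hψx, mul_zero, integral_zero] at h1 h2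
    have h3 : ∫ z in slab I, lam'.dx z * ψ z
        = ∫ z in slab I, z.1 * (2 * (p.wave 1).t z * (p.wave 1).x z) * ψ z := by
      refine integral_congr_ae ?_
      filter_upwards [h.constraint_x, ae_restrict_mem hms] with z hz hzI
      have hz0 : (0 : ℝ) < z.1 := hI0 (mem_slab.1 hzI)
      rw [momentumDensity_polarized] at hz
      rw [← hz]
      field_simp
    rw [h3] at h1
    exact hψne (neg_injective (h2.symm.trans h1))

end Gowdy

theorem mainTheorem3 :
    -- stability of the essential Gowdy equations
    (∀ I : Set ℝ, I.OrdConnected → I ⊆ Ioi 0 →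
      ∀ P Q : ℕ → Gowdy.Field,
        (∀ n, Gowdy.IsEssentialSolution I (P n) (Q n)) →
        limsup (fun n => Gowdy.totalNorm I (P n) (Q n)) atTop < ⊤ →
        ∃ (k : ℕ → ℕ) (Plim Qlim : Gowdy.Field), StrictMono k ∧
          Gowdy.WeakH1 I (fun n => P (k n)) Plim ∧
          Gowdy.WeakH1 I (fun n => Q (k n)) Qlim ∧
          Gowdy.IsEssentialSolution I Plim Qlim) ∧
    -- instability of the full set of Gowdy equations
    (∀ I : Set ℝ, I.OrdConnected → I.Nontrivial → (∃ t₀ : ℝ, 0 < t₀ ∧ I ⊆ Ici t₀) →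
      ∃ (P Q lam : ℕ → Gowdy.Field) (Plim Qlim : Gowdy.Field) (lamlim : Gowdy.SpaceTime → ℝ),
        (∀ n, Gowdy.IsGowdySolution I (P n) (Q n) (lam n)) ∧
        limsup (fun n => Gowdy.totalNorm I (P n) (Q n)) atTop < ⊤ ∧
        Gowdy.WeakH1 I P Plim ∧ Gowdy.WeakH1 I Q Qlim ∧
        Gowdy.IsEssentialSolution I Plim Qlim ∧
        (∀ᵐ z ∂(volume.restrict (Gowdy.slab I)),
          Tendsto (fun n => (lam n).val z) atTop (𝓝 (lamlim z))) ∧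
        (∀ J : Set ℝ, IsCompact J → J ⊆ I →
          MemLp lamlim 1 (volume.restrict (Gowdy.slab J)) ∧
          Tendsto (fun n => eLpNorm (fun z => (lam n).val z - lamlim z) 1
            (volume.restrict (Gowdy.slab J))) atTop (𝓝 0)) ∧
        -- the limit of the `lam n` violates each of the two constraints, even as distributions
        ¬ Gowdy.HasWeakDt I lamlim (fun z => z.1 * Gowdy.energyDensity Plim Qlim z) ∧
        ¬ Gowdy.HasWeakDx I lamlim (fun z => z.1 * Gowdy.momentumDensity Plim Qlim z) ∧
        -- and no other function completes the limit to a solution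
        ∀ lam' : Gowdy.Field, ¬ Gowdy.IsGowdySolution I Plim Qlim lam') := by
  refine ⟨fun I hI hI0 P Q h hb => Gowdy.stability_essential hI hI0 h hb, ?_⟩
  rintro I hI hIn ⟨t₀, ht₀, hIt⟩
  exact Gowdy.instability_full hI hIn ht₀ hIt
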